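/- Let $K/F$ be a Galois extension of fields of characteristic different from $2$ with $G=\operatorname{Gal}(K/F)$ cyclic of order $4$, let $C_2\le G$ be the subgroup of order $2$, and let $E=K^{C_2}$. Let $\Delta,a,b,x\in F$ with $a,b,x\ne 0$, $\Delta=a^2+b^2$ and $E=F(\sqrt\Delta)$, and such that $K=E(\sqrt\delta)$ with $\delta=x(\Delta-a\sqrt\Delta)\in E$. Let $\underline A_G$ be the Burnside Tambara functor of $G$: its value at $G/H$ is the Burnside ring $A(H)$; restriction, transfer and norm for $L\le H$ are induced by restricting the action, by $X\mapsto H\times_L X$ and by $X\mapsto \mathrm{Map}_L(H,X)$. A Tambara ideal is a family of ideals $\mathcal I(G/H)\subseteq A(H)$, $H\le G$, closed under restriction, transfer and conjugation and satisfying $N_L^H(\mathcal I(G/L))\subseteq \mathcal I(G/H)+N_L^H(0)$; write $(\!(\,\cdot\,)\!)$ for the smallest Tambara ideal containing given elements. The trace ideal $\mathcal{TI}(K/F)$ is the family of kernels, for $H\le G$, of the Dress maps $A(H)\to GW(K^H)$, $H/L\mapsto [\,y\in K^L\mapsto \operatorname{tr}_{K^L/K^H}(y^2)\,]$, where $GW$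 denotes the Grothendieck--Witt ring of regular quadratic forms. Let $t_{4,4}=[G/e]$ and $t_{4,2}=[G/C_2]$ in $A(G)$, and $t_{2,2}=[C_2/e]$ in $A(C_2)$. For a field $k$ and $\alpha\in k^\times$ let $\tau_k(\alpha)$ be the least power of $2$ (including $1=2^0$) such that $\alpha$ is a sum of that many squares in $k$, and $\tau_k(\alpha)=0$ if $\alpha$ is not a sum of squares. Put $\pi_F(x)=0$ if $\tau_F(x)=0$, $\pi_F(x)=2$ if $\tau_F(x)\in\{1,2\}$, and $\pi_F(x)=\tau_F(x)/2$ if $\tau_F(x)\ge 4$. If $K/F$ embeds into a cyclic extension of $F$ of degree $8$ (that is, there is a field $M\supseteq K$ with $M/F$ Galois and cyclic of degree $8$), then $$\mathcal{TI}(K/F)=(\!(\,t_{4,4}-t_{4,2}-2\,)\!).$$ Otherwise $$\mathcal{TI}(K/F)=(\!(\,2t_{4,2}-4,\ \pi_F(x)\,(t_{4,4}-4),\ \tau_E(\delta)\,(t_{2,2}-2)\,)\!).$$ -/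

import Mathlib

universe u v

/-! ## Finite `G`-sets and the Burnside ring -/

namespace Burnside

/-- A finite `G`-set. -/
structure FinGSet (G : Type u) [Group G] where
  carrier : Type u
  [action : MulAction G carrier]
  [finite : Finite carrier]

namespace FinGSet

instance {G : Type u} [Group G] : CoeSort (FinGSet G) (Type u) := ⟨FinGSet.carrier⟩

attribute [instance] FinGSet.action FinGSet.finite

/-- Isomorphism of finite `G`-sets: an equivariant bijection exists. -/
def Iso {G : Type u} [Group G] (X Y : FinGSet G) : Prop :=
  ∃ e : X ≃ Y, ∀ (g : G) (x : X), e (g • x) = g • e x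

instance setoid (G : Type u) [Group G] : Setoid (FinGSet G) where
  r := Iso
  iseqv :=
    { refl := fun X => ⟨Equiv.refl X, fun _ _ => rfl⟩
      symm := by
        rintro X Y ⟨e, he⟩
        exact ⟨e.symm, fun g y => by rw [Equiv.symm_apply_eq, he, Equiv.apply_symm_apply]⟩
      trans := by
        rintro X Y Z ⟨e, he⟩ ⟨f, hf⟩
        exact ⟨e.trans f, fun g x => by simp [he, hf]⟩ }

/-- The empty `G`-set. -/
def empty (G : Type u) [Group G] : FinGSet G :=
  { carrier := PEmpty.{u + 1}
    action := { smul := fun _ x => x, one_smul := fun _ => rfl, mul_smul := fun _ _ _ => rfl } }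

/-- The one-point `G`-set. -/
def point (G : Type u) [Group G] : FinGSet G :=
  { carrier := PUnit.{u + 1}
    action := { smul := fun _ x => x, one_smul := fun _ => rfl, mul_smul := fun _ _ _ => rfl } }

/-- Disjoint union. -/
def sum {G : Type u} [Group G] (X Y : FinGSet G) : FinGSet G := { carrier := X ⊕ Y }

/-- Cartesian product with the diagonal action. -/
def prod {G : Type u} [Group G] (X Y : FinGSet G) : FinGSet G := { carrier := X × Y }

/-- The transitive `G`-set `G ⧸ L`. -/
def coset {G : Type u} [Group G] [Finite G] (L : Subgroup G) : FinGSet G := { carrier := G ⧸ L }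

/-- Restriction of the action along a group homomorphism `φ`. -/
def res {L H : Type u} [Group L] [Group H] (φ : L →* H) (X : FinGSet H) : FinGSet L :=
  { carrier := X
    action := MulAction.compHom X φ }

/-- The relation `(h φ(l), x) ∼ (h, l x)` on `H × X`. -/
def indSetoid {L H : Type u} [Group L] [Group H] (φ : L →* H) (X : FinGSet L) :
    Setoid (H × X) where
  r p q := ∃ l : L, p.1 = q.1 * φ l ∧ l • p.2 = q.2
  iseqv :=
    { refl := fun p => ⟨1, by simp, by simp⟩
      symm := by
        rintro p q ⟨l, h1, h2⟩
        exact ⟨l⁻¹, by rw [h1]; simp, by rw [← h2]; simp⟩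
      trans := by
        rintro p q r ⟨l, h1, h2⟩ ⟨m, h3, h4⟩
        exact ⟨m * l, by rw [h1, h3]; simp [mul_assoc], by rw [mul_smul, h2, h4]⟩ }

/-- Induction `H ×_L X`, where `L` maps to `H` by `φ`; `H` acts by left multiplication. -/
def ind {L H : Type u} [Group L] [Group H] [Finite H] (φ : L →* H) (X : FinGSet L) :
    FinGSet H :=
  { carrier := Quotient (indSetoid φ X)
    action :=
      { smul := fun h => Quotient.map (fun p => (h * p.1, p.2)) (by
          rintro p q ⟨l, h1, h2⟩
          exact ⟨l, by simp [h1, mul_assoc], h2⟩)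
        one_smul := by
          rintro ⟨p⟩
          exact congrArg (Quotient.mk _) (by simp)
        mul_smul := by
          rintro a b ⟨p⟩
          exact congrArg (Quotient.mk _) (by simp [mul_assoc]) } }

/-- Coinduction `Map_L(H, X)`, where `L` maps to `H` by `φ`: the maps `f : H → X` with
`f (φ(l) h) = l f(h)`, on which `H` acts by `(k • f) h = f (h k)`. -/
def coind {L H : Type u} [Group L] [Group H] [Finite H] (φ : L →* H) (X : FinGSet L) :
    FinGSet H :=
  { carrier := {f : H → X // ∀ (l : L) (h : H), f (φ l * h) = l • f h}
    action :=
      { smul := fun k f => ⟨fun h => f.1 (h * k), fun l h => by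
          simpa only [mul_assoc] using f.2 l (h * k)⟩
        one_smul := fun f => Subtype.ext (funext fun h => congrArg f.1 (mul_one h))
        mul_smul := fun a b f =>
          Subtype.ext (funext fun h => congrArg f.1 (mul_assoc h a b).symm) } }

end FinGSet

open FinGSet

/-- Isomorphism classes of finite `G`-sets. -/
def GSetClass (G : Type u) [Group G] : Type (u + 1) := Quotient (FinGSet.setoid G)

/-- The isomorphism class of a finite `G`-set. -/
def cls {G : Type u} [Group G] (X : FinGSet G) : GSetClass G := Quotient.mk _ X

theorem cls_eq {G : Type u} [Group G] {X Y : FinGSet G} (e : X ≃ Y)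
    (he : ∀ (g : G) (x : X), e (g • x) = g • e x) : cls X = cls Y :=
  Quotient.sound ⟨e, he⟩

theorem exists_cls {G : Type u} [Group G] (x : GSetClass G) : ∃ X, x = cls X :=
  ⟨x.out, (Quotient.out_eq x).symm⟩

instance {G : Type u} [Group G] : Zero (GSetClass G) := ⟨cls (empty G)⟩

instance {G : Type u} [Group G] : One (GSetClass G) := ⟨cls (point G)⟩

instance {G : Type u} [Group G] : Add (GSetClass G) :=
  ⟨Quotient.map₂ FinGSet.sum (by
    rintro X X' ⟨e, he⟩ Y Y' ⟨f, hf⟩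
    refine ⟨Equiv.sumCongr e f, ?_⟩
    rintro g (x | y)
    · exact congrArg Sum.inl (he g x)
    · exact congrArg Sum.inr (hf g y))⟩

instance {G : Type u} [Group G] : Mul (GSetClass G) :=
  ⟨Quotient.map₂ FinGSet.prod (by
    rintro X X' ⟨e, he⟩ Y Y' ⟨f, hf⟩
    refine ⟨Equiv.prodCongr e f, ?_⟩
    rintro g ⟨x, y⟩
    exact Prod.ext (he g x) (hf g y))⟩

/-- The semiring of isomorphism classes of finite `G`-sets under disjoint union and product. -/
instance {G : Type u} [Group G] : CommSemiring (GSetClass G) where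
  add_assoc := by
    rintro ⟨X⟩ ⟨Y⟩ ⟨Z⟩
    refine cls_eq (Equiv.sumAssoc X Y Z) ?_
    rintro g ((x | y) | z) <;> rfl
  zero_add := by
    rintro ⟨X⟩
    refine cls_eq (Equiv.emptySum PEmpty X) ?_
    rintro g (x | y)
    · exact x.elim
    · rfl
  add_zero := by
    rintro ⟨X⟩
    refine cls_eq (Equiv.sumEmpty X PEmpty) ?_
    rintro g (x | y)
    · rfl
    · exact y.elim
  add_comm := by
    rintro ⟨X⟩ ⟨Y⟩
    refine cls_eq (Equiv.sumComm X Y) ?_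
    rintro g (x | y) <;> rfl
  mul_assoc := by
    rintro ⟨X⟩ ⟨Y⟩ ⟨Z⟩
    exact cls_eq (Equiv.prodAssoc X Y Z) fun _ _ => rfl
  one_mul := by
    rintro ⟨X⟩
    exact cls_eq (Equiv.punitProd X) fun _ _ => rfl
  mul_one := by
    rintro ⟨X⟩
    exact cls_eq (Equiv.prodPUnit X) fun _ _ => rfl
  mul_comm := by
    rintro ⟨X⟩ ⟨Y⟩
    exact cls_eq (Equiv.prodComm X Y) fun _ _ => rfl
  zero_mul := by
    rintro ⟨X⟩
    refine cls_eq (Equiv.pemptyProd X) ?_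
    rintro g ⟨x, _⟩
    exact x.elim
  mul_zero := by
    rintro ⟨X⟩
    refine cls_eq (Equiv.prodPEmpty X) ?_
    rintro g ⟨_, x⟩
    exact x.elim
  left_distrib := by
    rintro ⟨X⟩ ⟨Y⟩ ⟨Z⟩
    refine cls_eq (Equiv.prodSumDistrib X Y Z) ?_
    rintro g ⟨x, (y | z)⟩ <;> rfl
  right_distrib := by
    rintro ⟨X⟩ ⟨Y⟩ ⟨Z⟩
    refine cls_eq (Equiv.sumProdDistrib X Y Z) ?_
    rintro g ⟨(x | y), z⟩ <;> rfl
  nsmul := nsmulRec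

theorem cls_sum {G : Type u} [Group G] (X Y : FinGSet G) : cls (X.sum Y) = cls X + cls Y := rfl

/-! ### The Grothendieck ring of a commutative semiring -/

section Grothendieck

open Algebra.GrothendieckAddGroup

theorem lift_of {M : Type u} {B : Type v} [AddCommMonoid M] [AddCommGroup B] (f : M →+ B) (a : M) :
    lift f (of a) = f a :=
  DFunLike.congr_fun (lift.symm_apply_apply f) a

/-- Multiplication on the Grothendieck group of a commutative semiring, the biadditive extension
of the multiplication of the semiring. -/
noncomputable def grothendieckMul (S : Type u) [CommSemiring S] :
    Algebra.GrothendieckAddGroup S →+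
      Algebra.GrothendieckAddGroup S →+ Algebra.GrothendieckAddGroup S :=
  lift
    { toFun := fun a => lift (of.comp (AddMonoidHom.mulLeft a))
      map_zero' := by
        apply lift.symm.injective
        ext b
        simp only [lift_symm_apply, AddMonoidHom.comp_apply, lift_of]
        simp
      map_add' := fun a a' => by
        apply lift.symm.injective
        ext b
        simp only [lift_symm_apply, AddMonoidHom.comp_apply, AddMonoidHom.add_apply, lift_of]
        simp [add_mul] }

theorem grothendieckMul_of {S : Type u} [CommSemiring S] (a b : S) :
    grothendieckMul S (of a) (of b) = of (a * b) := by
  simp only [grothendieckMul]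
  rw [lift_of]
  exact lift_of _ _

theorem mk_eq {M : Type u} [AddCommMonoid M] (a : M) (b : (⊤ : AddSubmonoid M)) :
    (AddLocalization.mk a b : Algebra.GrothendieckAddGroup M) = of a - of b.1 := by
  rw [eq_sub_iff_add_eq]
  change AddLocalization.mk a b + AddLocalization.mk b.1 0 = AddLocalization.mk a 0
  rw [AddLocalization.mk_add, AddLocalization.mk_eq_mk_iff, AddLocalization.r_iff_exists]
  exact ⟨0, by simp [add_comm]⟩

theorem grothendieck_exists {M : Type u} [AddCommMonoid M] (x : Algebra.GrothendieckAddGroup M) :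
    ∃ a b : M, x = of a - of b := by
  induction x using AddLocalization.ind with
  | _ p => exact ⟨p.1, p.2.1, mk_eq p.1 p.2⟩

end Grothendieck

open Algebra.GrothendieckAddGroup (of lift)

/-- The Burnside ring of `G`: the Grothendieck ring of the semiring of isomorphism classes of
finite `G`-sets. -/
def BurnsideRing (G : Type u) [Group G] : Type (u + 1) :=
  Algebra.GrothendieckAddGroup (GSetClass G)

noncomputable instance (G : Type u) [Group G] : AddCommGroup (BurnsideRing G) :=
  inferInstanceAs (AddCommGroup (Algebra.GrothendieckAddGroup (GSetClass G)))

/-- The class `[X]` of a finite `G`-set in the Burnside ring. -/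
noncomputable def BurnsideRing.mk {G : Type u} [Group G] (X : FinGSet G) : BurnsideRing G :=
  of (cls X)

/-- The product in the Burnside ring, determined by `[X] * [Y] = [X × Y]`. -/
noncomputable def BurnsideRing.mulHom (G : Type u) [Group G] :
    BurnsideRing G →+ BurnsideRing G →+ BurnsideRing G :=
  grothendieckMul (GSetClass G)

theorem BurnsideRing.exists_of {G : Type u} [Group G] (x : BurnsideRing G) :
    ∃ a b : GSetClass G, x = (of a - of b : Algebra.GrothendieckAddGroup (GSetClass G)) :=
  grothendieck_exists x

noncomputable instance (G : Type u) [Group G] : CommRing (BurnsideRing G) :=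
  { (inferInstance : AddCommGroup (BurnsideRing G)) with
    mul := fun x y => BurnsideRing.mulHom G x y
    one := BurnsideRing.mk (point G)
    left_distrib := fun x y z => map_add (BurnsideRing.mulHom G x) y z
    right_distrib := fun x y z => by
      change BurnsideRing.mulHom G (x + y) z = _
      rw [map_add]
      rfl
    zero_mul := fun x => by
      change BurnsideRing.mulHom G 0 x = 0
      simp
    mul_zero := fun x => by
      change BurnsideRing.mulHom G x 0 = 0
      simp
    mul_assoc := fun x y z => by
      obtain ⟨a, a', rfl⟩ := x.exists_of
      obtain ⟨b, b', rfl⟩ := y.exists_of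
      obtain ⟨c, c', rfl⟩ := z.exists_of
      change grothendieckMul _ (grothendieckMul _ _ _) _ =
        grothendieckMul _ _ (grothendieckMul _ _ _)
      simp only [map_sub, AddMonoidHom.sub_apply, grothendieckMul_of, mul_assoc]
    mul_comm := fun x y => by
      obtain ⟨a, a', rfl⟩ := x.exists_of
      obtain ⟨b, b', rfl⟩ := y.exists_of
      change grothendieckMul _ _ _ = grothendieckMul _ _ _
      simp only [map_sub, AddMonoidHom.sub_apply, grothendieckMul_of, mul_comm]
      abel
    one_mul := fun x => by
      obtain ⟨a, a', rfl⟩ := x.exists_of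
      change grothendieckMul _ (of 1) _ = _
      simp only [map_sub, grothendieckMul_of, one_mul]
    mul_one := fun x => by
      obtain ⟨a, a', rfl⟩ := x.exists_of
      change grothendieckMul _ _ (of 1) = _
      simp only [map_sub, AddMonoidHom.sub_apply, grothendieckMul_of, mul_one] }

theorem BurnsideRing.mk_mul {G : Type u} [Group G] (X Y : FinGSet G) :
    BurnsideRing.mk X * BurnsideRing.mk Y = BurnsideRing.mk (X.prod Y) :=
  grothendieckMul_of (cls X) (cls Y)

theorem BurnsideRing.mk_add {G : Type u} [Group G] (X Y : FinGSet G) :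
    BurnsideRing.mk X + BurnsideRing.mk Y = BurnsideRing.mk (X.sum Y) :=
  (map_add of (cls X) (cls Y)).symm

theorem BurnsideRing.exists_mk_sub_mk {G : Type u} [Group G] (x : BurnsideRing G) :
    ∃ X Y : FinGSet G, x = BurnsideRing.mk X - BurnsideRing.mk Y := by
  obtain ⟨a, b, h⟩ := x.exists_of
  obtain ⟨X, rfl⟩ := exists_cls a
  obtain ⟨Y, rfl⟩ := exists_cls b
  exact ⟨X, Y, h⟩

/-! ### Restriction, transfer and norm -/

/-- Restriction `A(H) → A(L)` along `φ : L →* H`: the additive extension of `X ↦ X` with `L`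
acting through `φ`. -/
noncomputable def resMap {L H : Type u} [Group L] [Group H] (φ : L →* H) :
    BurnsideRing H →+ BurnsideRing L :=
  lift (of.comp
    { toFun := Quotient.map (FinGSet.res φ) (by
        rintro X Y ⟨e, he⟩
        exact ⟨e, fun l x => he (φ l) x⟩)
      map_zero' := cls_eq (Equiv.refl _) (by rintro _ ⟨⟩)
      map_add' := by
        rintro ⟨X⟩ ⟨Y⟩
        refine cls_eq (Equiv.refl _) ?_
        rintro l (x | y) <;> rfl })

theorem resMap_mk {L H : Type u} [Group L] [Group H] (φ : L →* H) (X : FinGSet H) :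
    resMap φ (BurnsideRing.mk X) = BurnsideRing.mk (X.res φ) :=
  lift_of _ _

/-- Transfer `A(L) → A(H)` along `φ : L →* H`: the additive extension of `X ↦ H ×_L X`. -/
noncomputable def trMap {L H : Type u} [Group L] [Group H] [Finite H] (φ : L →* H) :
    BurnsideRing L →+ BurnsideRing H :=
  lift (of.comp
    { toFun := Quotient.map (FinGSet.ind φ) (by
        rintro X Y ⟨e, he⟩
        refine ⟨Quotient.congr (Equiv.prodCongr (Equiv.refl H) e) ?_, ?_⟩
        · rintro ⟨h, x⟩ ⟨k, y⟩
          refine exists_congr fun l => and_congr Iff.rfl ?_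
          change l • x = y ↔ l • e x = e y
          rw [← he, e.apply_eq_iff_eq]
        · rintro h ⟨p⟩
          rfl)
      map_zero' := by
        refine cls_eq ⟨Quotient.lift (fun p => p.2.elim) (fun p => p.2.elim), fun x => x.elim,
          ?_, fun x => x.elim⟩ ?_
        · rintro ⟨h, x⟩
          exact x.elim
        · rintro _ ⟨h, x⟩
          exact x.elim
      map_add' := by
        rintro ⟨X⟩ ⟨Y⟩
        refine cls_eq (X := FinGSet.ind φ (X.sum Y)) (Y := (FinGSet.ind φ X).sum (FinGSet.ind φ Y))
          ⟨Quotient.lift (fun p => p.2.elim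
              (fun x => Sum.inl (Quotient.mk (indSetoid φ X) (p.1, x)))
              (fun y => Sum.inr (Quotient.mk (indSetoid φ Y) (p.1, y)))) ?_,
            Sum.elim
              (Quotient.map (fun p => (p.1, Sum.inl p.2)) ?_)
              (Quotient.map (fun p => (p.1, Sum.inr p.2)) ?_), ?_, ?_⟩ ?_
        · rintro ⟨h, (x | y)⟩ ⟨k, (x' | y')⟩ ⟨l, h1, h2⟩
          · exact congrArg Sum.inl (Quotient.sound ⟨l, h1, Sum.inl_injective h2⟩)
          · exact (Sum.inl_ne_inr h2).elim
          · exact (Sum.inr_ne_inl h2).elim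
          · exact congrArg Sum.inr (Quotient.sound ⟨l, h1, Sum.inr_injective h2⟩)
        · rintro p q ⟨l, h1, h2⟩
          exact ⟨l, h1, congrArg Sum.inl h2⟩
        · rintro p q ⟨l, h1, h2⟩
          exact ⟨l, h1, congrArg Sum.inr h2⟩
        · rintro ⟨h, (x | y)⟩ <;> rfl
        · rintro (⟨h, x⟩ | ⟨h, y⟩) <;> rfl
        · rintro g ⟨h, (x | y)⟩ <;> rfl })

theorem trMap_mk {L H : Type u} [Group L] [Group H] [Finite H] (φ : L →* H) (X : FinGSet L) :
    trMap φ (BurnsideRing.mk X) = BurnsideRing.mk (X.ind φ) :=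
  lift_of _ _

/-- The extension to formal differences of a map `F` of degree at most `n` from a commutative
monoid to an abelian group: translation by `y` is `1 + Δ_y` and `Δ_y ^ (n + 1) F = 0`, so that
`F (x - y) = ∑_{k ≤ n} (-1) ^ k (Δ_y ^ k F) x`. -/
def extendSub {M : Type u} {B : Type v} [AddCommMonoid M] [AddCommGroup B] (n : ℕ) (F : M → B)
    (x y : M) : B :=
  ∑ k ∈ Finset.range (n + 1), (-1 : ℤ) ^ k • (fwdDiff y)^[k] F x

section extendSub

open fwdDiff_aux

variable {M : Type u} {B : Type v} [AddCommMonoid M] [AddCommGroup B]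

theorem fwdDiffₗ_commute (y z : M) : Commute (fwdDiffₗ M B y) (fwdDiffₗ M B z) := by
  refine LinearMap.ext fun f => funext fun x => ?_
  simp only [Module.End.mul_apply, fwdDiffₗ_apply, fwdDiff]
  rw [add_right_comm x z y]
  abel

theorem extendSub_eq (n : ℕ) (F : M → B) (x y : M) :
    extendSub n F x y = (∑ k ∈ Finset.range (n + 1), (-fwdDiffₗ M B y) ^ k) F x := by
  simp only [extendSub, LinearMap.sum_apply, Finset.sum_apply]
  refine Finset.sum_congr rfl fun k _ => ?_
  rw [← coe_fwdDiffₗ_pow]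
  rcases Nat.even_or_odd k with h | h
  · simp [h.neg_pow]
  · simp [h.neg_pow]

theorem extendSub_add_add (n : ℕ) (F : M → B) (hF : ∀ y : M, (fwdDiff y)^[n + 1] F = 0)
    (x y z : M) : extendSub n F (x + z) (y + z) = extendSub n F x y := by
  set S : M → Module.End ℤ (M → B) := fun y => ∑ k ∈ Finset.range (n + 1), (-fwdDiffₗ M B y) ^ k
  have hT : ∀ w : M, S w * shiftₗ M B w = 1 - (-fwdDiffₗ M B w) ^ (n + 1) := fun w => by
    rw [← geom_sum_mul_neg, shiftₗ, sub_neg_eq_add, add_comm 1]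
  have hc : ∀ v w : M, Commute (fwdDiffₗ M B v) (S w) := fun v w =>
    Commute.sum_right _ _ _ fun k _ =>
      (Commute.neg_right (R := Module.End ℤ (M → B)) (fwdDiffₗ_commute v w)).pow_right k
  have hcs : ∀ v w : M, Commute (shiftₗ M B v) (S w) := fun v w =>
    (hc v w).add_left (Commute.one_left _)
  have hcf : ∀ v w : M, Commute (fwdDiffₗ M B v) (shiftₗ M B w) := fun v w =>
    (fwdDiffₗ_commute v w).add_right (Commute.one_right _)
  have h0 : ∀ w : M, ((-fwdDiffₗ M B w) ^ (n + 1)) F = 0 := fun w => by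
    have h1 : (fwdDiffₗ M B w ^ (n + 1)) F = 0 := by
      rw [← hF w, ← coe_fwdDiffₗ_pow]
    rw [neg_pow, Module.End.mul_apply, h1, map_zero]
  have hadd : shiftₗ M B (y + z) = shiftₗ M B y * shiftₗ M B z := by
    refine LinearMap.ext fun f => funext fun a => ?_
    simp only [Module.End.mul_apply, shiftₗ_apply]
    rw [add_assoc]
  have key : (shiftₗ M B z * S (y + z)) F = S y F := by
    set E := (shiftₗ M B z * S (y + z)) F with hE
    have h1 : shiftₗ M B y E = F := by
      have h2 : shiftₗ M B y * (shiftₗ M B z * S (y + z)) = S (y + z) * shiftₗ M B (y + z) := by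
        rw [← mul_assoc, ← hadd, (hcs _ _).eq]
      rw [hE, ← Module.End.mul_apply, h2, hT, LinearMap.sub_apply, h0]
      simp
    have h3 : S y (shiftₗ M B y E) = E := by
      have h4 : Commute ((-fwdDiffₗ M B y) ^ (n + 1)) (shiftₗ M B z * S (y + z)) :=
        (((hcf y z).mul_right (hc y (y + z))).neg_left).pow_left _
      have h5 : ((-fwdDiffₗ M B y) ^ (n + 1)) E = 0 := by
        rw [hE, ← Module.End.mul_apply, h4.eq, Module.End.mul_apply, h0, map_zero]
      rw [← Module.End.mul_apply, hT, LinearMap.sub_apply, h5]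
      simp
    rw [← h3, h1]
  rw [extendSub_eq, extendSub_eq]
  change S (y + z) F (x + z) = S y F x
  rw [← key, Module.End.mul_apply, shiftₗ_apply]

theorem extendSub_zero (n : ℕ) (F : M → B) (x : M) : extendSub n F x 0 = F x := by
  rw [extendSub, Finset.sum_range_succ', Finset.sum_eq_zero]
  · simp
  · intro k _
    have : fwdDiff (0 : M) F = 0 := funext fun a => by simp [fwdDiff]
    rw [Function.iterate_succ_apply, this]
    have h : ∀ k : ℕ, (fwdDiff (0 : M))^[k] (0 : M → B) = 0 := fun k =>
      Function.iterate_fixed (funext fun a => by simp [fwdDiff]) k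
    rw [h]
    simp

end extendSub

/-- The `H`-set of those `f ∈ Map_L(H, W)` that meet each of the subsets `P i` of `W`. -/
def meeting {L H : Type u} [Group L] [Group H] [Finite H] (φ : L →* H) (W : FinGSet L)
    {ι : Type} (P : ι → W → Prop) : FinGSet H :=
  { carrier := {f : FinGSet.coind φ W // ∀ i, ∃ h : H, P i (f.1 h)}
    action :=
      { smul := fun k f => ⟨k • f.1, fun i => by
          obtain ⟨h, hh⟩ := f.2 i
          refine ⟨h * k⁻¹, ?_⟩
          change P i (f.1.1 (h * k⁻¹ * k))
          simpa using hh⟩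
        one_smul := fun f => Subtype.ext (one_smul H f.1)
        mul_smul := fun a b f => Subtype.ext (mul_smul a b f.1) } }

/-- The class in `A(H)` of the coinduced set, as a function of the class of an `L`-set. -/
noncomputable def coindClass {L H : Type u} [Group L] [Group H] [Finite H] (φ : L →* H) :
    GSetClass L → BurnsideRing H :=
  fun x => of (Quotient.map (sb := FinGSet.setoid H) (FinGSet.coind φ) (by
    rintro X Y ⟨e, he⟩
    refine ⟨Equiv.subtypeEquiv (Equiv.arrowCongr (Equiv.refl H) e) ?_, ?_⟩
    · intro f
      refine forall_congr' fun l => forall_congr' fun h => ?_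
      change f (φ l * h) = l • f h ↔ e (f (φ l * h)) = l • e (f h)
      rw [← he, e.apply_eq_iff_eq]
    · intro h f
      rfl) x : GSetClass H)

theorem coindClass_cls {L H : Type u} [Group L] [Group H] [Finite H] (φ : L →* H)
    (X : FinGSet L) : coindClass φ (cls X) = BurnsideRing.mk (X.coind φ) := rfl

/-- `m` copies of `Y` next to `X`. -/
def withCopies {L : Type u} [Group L] (X Y : FinGSet L) (m : ℕ) : FinGSet L :=
  { carrier := X ⊕ (Fin m × Y)
    action :=
      { smul := fun l => Sum.map (l • ·) (fun p => (p.1, l • p.2))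
        one_smul := by rintro (x | ⟨i, y⟩) <;> simp [HSMul.hSMul] <;> exact one_smul L _
        mul_smul := by rintro a b (x | ⟨i, y⟩) <;> simp [HSMul.hSMul] <;> exact mul_smul a b _ } }

/-- The `i`-th copy of `Y` in `X ⊕ Fin m × Y`. -/
def inCopy {L : Type u} [Group L] (X Y : FinGSet L) (m : ℕ) (i : Fin m)
    (w : withCopies X Y m) : Prop :=
  ∃ y : Y, (w : X ⊕ (Fin m × Y)) = Sum.inr (i, y)

theorem cls_split {G : Type u} [Group G] (X A B : FinGSet G) (f : A → X) (g : B → X)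
    (hf : ∀ (s : G) (a : A), f (s • a) = s • f a) (hg : ∀ (s : G) (b : B), g (s • b) = s • g b)
    (hfi : Function.Injective f) (hgi : Function.Injective g) (hd : ∀ a b, f a ≠ g b)
    (hc : ∀ x, (∃ a, f a = x) ∨ ∃ b, g b = x) : cls X = cls A + cls B := by
  rw [← cls_sum]
  refine (cls_eq (Equiv.ofBijective (Sum.elim f g) ⟨?_, ?_⟩) ?_).symm
  · rintro (a | b) (a' | b') h
    · exact congrArg Sum.inl (hfi h)
    · exact (hd _ _ h).elim
    · exact (hd _ _ h.symm).elim
    · exact congrArg Sum.inr (hgi h)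
  · intro x
    rcases hc x with ⟨a, h⟩ | ⟨b, h⟩
    · exact ⟨Sum.inl a, h⟩
    · exact ⟨Sum.inr b, h⟩
  · rintro s (a | b)
    · exact hf s a
    · exact hg s b

/-- Postcomposition with an equivariant injection on sets of coinduced maps. -/
theorem exists_meeting_map {L H : Type u} [Group L] [Group H] [Finite H] (φ : L →* H)
    {V W : FinGSet L} (j : V → W) (hj : ∀ (l : L) (v : V), j (l • v) = l • j v)
    (hji : Function.Injective j) {ι κ : Type} (P : ι → V → Prop) (Q : κ → W → Prop)
    (hPQ : ∀ k, ∃ i, ∀ v, P i v → Q k (j v)) :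
    ∃ F : meeting φ V P → meeting φ W Q, (∀ f h, (F f).1.1 h = j (f.1.1 h)) ∧
      (∀ (s : H) f, F (s • f) = s • F f) ∧ Function.Injective F := by
  refine ⟨fun f => ⟨⟨fun h => j (f.1.1 h), fun l h => ?_⟩, fun k => ?_⟩, fun _ _ => rfl,
    fun _ _ => rfl, fun f g hfg => ?_⟩
  · exact (congrArg j (f.1.2 l h)).trans (hj l _)
  · obtain ⟨i, hi⟩ := hPQ k
    obtain ⟨h, hh⟩ := f.2 i
    exact ⟨h, hi _ hh⟩
  · refine Subtype.ext (Subtype.ext (funext fun h => hji ?_))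
    exact congrFun (congrArg (fun u : meeting φ W Q => u.1.1) hfg) h

theorem exists_meeting_lift {L H : Type u} [Group L] [Group H] [Finite H] (φ : L →* H)
    {V W : FinGSet L} (j : V → W) (hj : ∀ (l : L) (v : V), j (l • v) = l • j v)
    (hji : Function.Injective j) {ι κ : Type} (P : ι → V → Prop) (Q : κ → W → Prop)
    (f : meeting φ W Q) (hf : ∀ h, ∃ v, j v = f.1.1 h)
    (hP : ∀ i, ∃ h, ∀ v, j v = f.1.1 h → P i v) :
    ∃ g : meeting φ V P, ∀ h, j (g.1.1 h) = f.1.1 h := by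
  choose g hg using hf
  refine ⟨⟨⟨g, fun l h => hji ?_⟩, fun i => ?_⟩, hg⟩
  · rw [hg, f.1.2, hj, hg]
  · obtain ⟨h, hh⟩ := hP i
    exact ⟨h, hh _ (hg h)⟩

theorem cls_meeting_succ {L H : Type u} [Group L] [Group H] [Finite H] (φ : L →* H)
    (X Y : FinGSet L) (m : ℕ) :
    cls (meeting φ (withCopies (X.sum Y) Y m) (inCopy (X.sum Y) Y m)) =
      cls (meeting φ (withCopies X Y m) (inCopy X Y m)) +
        cls (meeting φ (withCopies X Y (m + 1)) (inCopy X Y (m + 1))) := by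
  let j₁ : withCopies X Y m → withCopies (X.sum Y) Y m :=
    Sum.map (fun x => (Sum.inl x : X ⊕ Y)) id
  let j₂ : withCopies X Y (m + 1) → withCopies (X.sum Y) Y m :=
    Sum.elim (fun x => Sum.inl (Sum.inl x : X ⊕ Y))
      (fun p => Fin.cases (motive := fun _ => (X ⊕ Y) ⊕ (Fin m × Y))
        (Sum.inl (Sum.inr p.2)) (fun i => Sum.inr (i, p.2)) p.1)
  have h1 : ∀ (l : L) v, j₁ (l • v) = l • j₁ v := by
    rintro l (x | ⟨i, y⟩) <;> rfl
  have h1i : Function.Injective j₁ := Function.Injective.sumMap Sum.inl_injective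
    Function.injective_id
  have h2 : ∀ (l : L) v, j₂ (l • v) = l • j₂ v := by
    rintro l (x | ⟨i, y⟩)
    · rfl
    · induction i using Fin.cases <;> rfl
  have h2i : Function.Injective j₂ := by
    rintro (x | ⟨i, y⟩) (x' | ⟨i', y'⟩) h
    · exact congrArg Sum.inl (Sum.inl_injective (Sum.inl_injective h))
    · induction i' using Fin.cases with
      | zero => exact (Sum.inl_ne_inr (Sum.inl_injective h)).elim
      | succ i' => exact (Sum.inl_ne_inr h).elim
    · induction i using Fin.cases with
      | zero => exact (Sum.inr_ne_inl (Sum.inl_injective h)).elim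
      | succ i => exact (Sum.inr_ne_inl h).elim
    · induction i using Fin.cases with
      | zero =>
        induction i' using Fin.cases with
        | zero => exact congrArg (fun y => Sum.inr (0, y)) (Sum.inr_injective (Sum.inl_injective h))
        | succ i' => exact (Sum.inl_ne_inr h).elim
      | succ i =>
        induction i' using Fin.cases with
        | zero => exact (Sum.inr_ne_inl h).elim
        | succ i' =>
          exact congrArg (fun p : Fin m × Y => Sum.inr (p.1.succ, p.2)) (Sum.inr_injective h)
  have hs : ∀ w, ∃ v, j₂ v = w := by
    rintro ((x | y) | ⟨i, y⟩)
    · exact ⟨Sum.inl x, rfl⟩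
    · exact ⟨Sum.inr (0, y), rfl⟩
    · exact ⟨Sum.inr (i.succ, y), rfl⟩
  obtain ⟨F₁, e₁, q₁, i₁⟩ := exists_meeting_map φ j₁ h1 h1i (inCopy X Y m) (inCopy (X.sum Y) Y m)
    (fun k => ⟨k, by rintro _ ⟨y, rfl⟩; exact ⟨y, rfl⟩⟩)
  obtain ⟨F₂, e₂, q₂, i₂⟩ := exists_meeting_map φ j₂ h2 h2i (inCopy X Y (m + 1))
    (inCopy (X.sum Y) Y m) (fun k => ⟨k.succ, by rintro _ ⟨y, rfl⟩; exact ⟨y, rfl⟩⟩)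
  refine cls_split _ _ _ F₁ F₂ q₁ q₂ i₁ i₂ ?_ ?_
  · intro f g hfg
    obtain ⟨h, y, hy⟩ := g.2 0
    have := (e₁ f h).symm.trans ((congrArg (fun u => u.1.1 h) hfg).trans (e₂ g h))
    rw [hy] at this
    rcases hv : (f.1.1 h : X ⊕ (Fin m × Y)) with x | ⟨i, z⟩
    · rw [hv] at this
      exact Sum.inl_ne_inr (Sum.inl_injective this)
    · rw [hv] at this
      exact Sum.inr_ne_inl this
  · intro f
    by_cases hf : ∃ h y, (f.1.1 h : (X ⊕ Y) ⊕ (Fin m × Y)) = Sum.inl (Sum.inr y)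
    · right
      obtain ⟨g, hg⟩ := exists_meeting_lift φ j₂ h2 h2i (inCopy X Y (m + 1)) _ f
        (fun h => hs _) (fun i => by
          induction i using Fin.cases with
          | zero =>
            obtain ⟨h, y, hy⟩ := hf
            refine ⟨h, fun v hv => ⟨y, h2i ?_⟩⟩
            rw [hv, hy]
            rfl
          | succ i =>
            obtain ⟨h, y, hy⟩ := f.2 i
            refine ⟨h, fun v hv => ⟨y, h2i ?_⟩⟩
            rw [hv, hy]
            rfl)
      exact ⟨g, Subtype.ext (Subtype.ext (funext fun h => (e₂ g h).trans (hg h)))⟩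
    · left
      push Not at hf
      obtain ⟨g, hg⟩ := exists_meeting_lift φ j₁ h1 h1i (inCopy X Y m) _ f
        (fun h => by
          rcases hv : (f.1.1 h : (X ⊕ Y) ⊕ (Fin m × Y)) with (x | y) | p
          · exact ⟨Sum.inl x, rfl⟩
          · exact (hf h y hv).elim
          · exact ⟨Sum.inr p, rfl⟩) (fun i => by
            obtain ⟨h, y, hy⟩ := f.2 i
            refine ⟨h, fun v hv => ⟨y, h1i ?_⟩⟩
            rw [hv, hy]
            rfl)
      exact ⟨g, Subtype.ext (Subtype.ext (funext fun h => (e₁ g h).trans (hg h)))⟩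

theorem iterate_fwdDiff_coindClass {L H : Type u} [Group L] [Group H] [Finite H] (φ : L →* H)
    (Y : FinGSet L) (m : ℕ) (X : FinGSet L) :
    (fwdDiff (cls Y))^[m] (coindClass φ) (cls X) =
      BurnsideRing.mk (meeting φ (withCopies X Y m) (inCopy X Y m)) := by
  induction m generalizing X with
  | zero =>
    rw [Function.iterate_zero, id, coindClass_cls]
    let j : withCopies X Y 0 → X := Sum.elim id (fun p => p.1.elim0)
    have hj : Function.Injective j := by
      rintro (x | ⟨i, y⟩) (x' | ⟨i', y'⟩) h
      · exact congrArg Sum.inl h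
      · exact i'.elim0
      · exact i.elim0
      · exact i.elim0
    have hjl : ∀ (l : L) (v : withCopies X Y 0), j (l • v) = l • j v := by
      rintro l (x | ⟨i, y⟩)
      · rfl
      · exact i.elim0
    refine congrArg of (cls_eq ⟨fun f => ⟨⟨fun h => (Sum.inl (f.1 h) : X ⊕ (Fin 0 × Y)), ?_⟩,
      fun i => i.elim0⟩, fun f => ⟨fun h => j (f.1.1 h), ?_⟩, ?_, ?_⟩ ?_)
    · intro l h
      exact congrArg Sum.inl (f.2 l h)
    · intro l h
      exact (congrArg j (f.1.2 l h)).trans (hjl l _)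
    · intro f
      rfl
    · intro f
      refine Subtype.ext (Subtype.ext (funext fun h => hj ?_))
      rfl
    · intro h f
      rfl
  | succ m ih =>
    rw [Function.iterate_succ_apply', fwdDiff, ← cls_sum, ih, ih]
    have := congrArg (of : GSetClass H →+ _) (cls_meeting_succ φ X Y m)
    rw [map_add] at this
    exact sub_eq_of_eq_add' this

theorem coindClass_degree {L H : Type u} [Group L] [Group H] [Finite H] (φ : L →* H)
    (y : GSetClass L) : (fwdDiff y)^[φ.range.index + 1] (coindClass φ) = 0 := by
  funext x
  obtain ⟨X, rfl⟩ := exists_cls x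
  obtain ⟨Y, rfl⟩ := exists_cls y
  rw [iterate_fwdDiff_coindClass]
  have he : IsEmpty (meeting φ (withCopies X Y (φ.range.index + 1))
      (inCopy X Y (φ.range.index + 1))) := by
    refine ⟨fun f => ?_⟩
    choose h y hy using f.2
    have hi : Function.Injective (fun i => (((h i)⁻¹ : H) : H ⧸ φ.range)) := by
      intro i j hij
      obtain ⟨l, hl⟩ := QuotientGroup.eq.mp hij
      have h1 : h i = φ l * h j := by
        rw [hl]
        simp
      have h2 := f.1.2 l (h j)
      rw [← h1, hy, hy] at h2
      exact congrArg Prod.fst (Sum.inr_injective h2)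
    have := Nat.card_le_card_of_injective _ hi
    rw [Nat.card_fin, ← Subgroup.index] at this
    omega
  refine Eq.trans ?_ (map_zero (of : GSetClass H →+ _))
  exact congrArg of (cls_eq ⟨fun f => he.elim f, fun z => z.elim, fun f => he.elim f,
    fun z => z.elim⟩ fun _ f => he.elim f)

/-- The norm `A(L) → A(H)` along `φ : L →* H`: the extension of `X ↦ Map_L(H, X)` to formal
differences. -/
noncomputable def normMap {L H : Type u} [Group L] [Group H] [Finite H] (φ : L →* H) :
    BurnsideRing L → BurnsideRing H :=
  fun z => AddLocalization.liftOn (S := (⊤ : AddSubmonoid (GSetClass L))) z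
    (fun x y => extendSub φ.range.index (coindClass φ) x y.1) (by
      intro a c b d hr
      obtain ⟨e, he⟩ := AddLocalization.r_iff_exists.mp hr
      have hd := coindClass_degree φ
      rw [← extendSub_add_add _ _ hd a b.1 (e.1 + d.1), ← extendSub_add_add _ _ hd c d.1 (e.1 + b.1)]
      congr 1
      · rw [add_left_comm, add_comm a, he]
        abel
      · abel)

/-- The norm of a formal difference. -/
theorem normMap_sub {L H : Type u} [Group L] [Group H] [Finite H] (φ : L →* H)
    (X Y : FinGSet L) :
    normMap φ (BurnsideRing.mk X - BurnsideRing.mk Y) =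
      extendSub φ.range.index (coindClass φ) (cls X) (cls Y) := by
  have : (BurnsideRing.mk X - BurnsideRing.mk Y : BurnsideRing L) =
      (AddLocalization.mk (cls X) ⟨cls Y, AddSubmonoid.mem_top _⟩ :
        Algebra.GrothendieckAddGroup (GSetClass L)) := (mk_eq (cls X) ⟨cls Y, _⟩).symm
  rw [this]
  rfl

/-- The norm of an actual `L`-set is the class of the coinduced set. -/
theorem normMap_mk {L H : Type u} [Group L] [Group H] [Finite H] (φ : L →* H)
    (X : FinGSet L) : normMap φ (BurnsideRing.mk X) = BurnsideRing.mk (X.coind φ) := by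
  have h0 : (BurnsideRing.mk (FinGSet.empty L) : BurnsideRing L) = 0 :=
    map_zero (of : GSetClass L →+ _)
  rw [← sub_zero (BurnsideRing.mk X), ← h0, normMap_sub]
  exact extendSub_zero _ _ _

/-! ### The Burnside Tambara functor of a finite group and its ideals

The value at `G ⧸ H` is `BurnsideRing H`. -/

section Tambara

variable {G : Type u} [Group G] [Finite G]

/-- Restriction from level `G ⧸ H` to level `G ⧸ L`, for `L ≤ H`. -/
noncomputable def tambaraRes {L H : Subgroup G} (h : L ≤ H) : BurnsideRing H →+ BurnsideRing L :=
  resMap (Subgroup.inclusion h)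

/-- Transfer from level `G ⧸ L` to level `G ⧸ H`, for `L ≤ H`. -/
noncomputable def tambaraTr {L H : Subgroup G} (h : L ≤ H) : BurnsideRing L →+ BurnsideRing H :=
  trMap (Subgroup.inclusion h)

/-- Norm from level `G ⧸ L` to level `G ⧸ H`, for `L ≤ H`. -/
noncomputable def tambaraNorm {L H : Subgroup G} (h : L ≤ H) : BurnsideRing L → BurnsideRing H :=
  normMap (Subgroup.inclusion h)

/-- Conjugation from level `G ⧸ H` to level `G ⧸ gHg⁻¹`: an element `k` of `gHg⁻¹` acts as
`g⁻¹kg`. -/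
noncomputable def tambaraConj (g : G) (H : Subgroup G) :
    BurnsideRing H →+ BurnsideRing (H.map (MulAut.conj g).toMonoidHom) :=
  resMap ((H.equivMapOfInjective _ (MulAut.conj g).injective).symm.toMonoidHom)

variable (G) in
/-- Ideals of the Burnside Tambara functor of `G`. -/
@[ext]
structure TambaraIdeal where
  /-- The ideal at level `G ⧸ H`. -/
  level : ∀ H : Subgroup G, Ideal (BurnsideRing H)
  res_mem : ∀ {L H : Subgroup G} (h : L ≤ H), ∀ x ∈ level H, tambaraRes h x ∈ level L
  tr_mem : ∀ {L H : Subgroup G} (h : L ≤ H), ∀ x ∈ level L, tambaraTr h x ∈ level H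
  /-- `N(I) ⊆ I + N(0)`. -/
  norm_mem : ∀ {L H : Subgroup G} (h : L ≤ H), ∀ x ∈ level L,
    tambaraNorm h x - tambaraNorm h 0 ∈ level H
  conj_mem : ∀ (g : G) (H : Subgroup G), ∀ x ∈ level H,
    tambaraConj g H x ∈ level (H.map (MulAut.conj g).toMonoidHom)

/-- The Tambara ideal generated by a set of elements of the various levels: the intersection of
all Tambara ideals containing them. -/
noncomputable def TambaraIdeal.span (S : Set (Σ H : Subgroup G, BurnsideRing H)) : TambaraIdeal G where
  level H := ⨅ I : {I : TambaraIdeal G // ∀ s ∈ S, s.2 ∈ I.level s.1}, I.1.level H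
  res_mem h x hx := by
    rw [Ideal.mem_iInf] at hx ⊢
    exact fun I => I.1.res_mem h x (hx I)
  tr_mem h x hx := by
    rw [Ideal.mem_iInf] at hx ⊢
    exact fun I => I.1.tr_mem h x (hx I)
  norm_mem h x hx := by
    rw [Ideal.mem_iInf] at hx ⊢
    exact fun I => I.1.norm_mem h x (hx I)
  conj_mem g H x hx := by
    rw [Ideal.mem_iInf] at hx ⊢
    exact fun I => I.1.conj_mem g H x (hx I)

/-- For subgroups `J ≤ H`, the class at level `G ⧸ H` of the transitive `H`-set `H ⧸ J`. -/
noncomputable def orbitClass (H J : Subgroup G) : BurnsideRing H :=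
  BurnsideRing.mk (FinGSet.coset (J.subgroupOf H))

end Tambara

end Burnside

/-! ## The Grothendieck–Witt group and the Dress map -/

namespace GrothendieckWitt

open Algebra.GrothendieckAddGroup (of lift)

/-- A regular quadratic form on a finite-dimensional vector space over a field of characteristic
different from `2`. -/
structure RegularForm (k : Type v) [Field k] where
  V : Type v
  [addCommGroup : AddCommGroup V]
  [module : Module k V]
  [finiteDimensional : FiniteDimensional k V]
  Q : QuadraticForm k V
  regular : ∀ x : V, (∀ y : V, QuadraticMap.polar Q x y = 0) → x = 0

attribute [instance] RegularForm.addCommGroup RegularForm.module RegularForm.finiteDimensional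

/-- Isometry. -/
instance RegularForm.setoid (k : Type v) [Field k] : Setoid (RegularForm k) where
  r A B := A.Q.Equivalent B.Q
  iseqv :=
    { refl := fun A => QuadraticMap.Equivalent.refl A.Q
      symm := fun h => h.symm
      trans := fun h h' => h.trans h' }

/-- Orthogonal sum. -/
def RegularForm.sum {k : Type v} [Field k] (A B : RegularForm k) : RegularForm k where
  V := A.V × B.V
  Q := A.Q.prod B.Q
  regular := by
    rintro ⟨x, y⟩ h
    refine Prod.ext (A.regular x fun z => ?_) (B.regular y fun z => ?_)
    · simpa [QuadraticMap.polar] using h (z, 0)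
    · simpa [QuadraticMap.polar] using h (0, z)

/-- The form of dimension `0`. -/
def RegularForm.zero (k : Type v) [Field k] : RegularForm k where
  V := PUnit.{v + 1}
  Q := 0
  regular := fun _ _ => rfl

/-- Isometry classes of regular quadratic forms over `k`. -/
def FormClass (k : Type v) [Field k] : Type (v + 1) := Quotient (RegularForm.setoid k)

/-- The isometry class of a regular quadratic form. -/
def formCls {k : Type v} [Field k] (A : RegularForm k) : FormClass k := Quotient.mk _ A

instance {k : Type v} [Field k] : Zero (FormClass k) := ⟨formCls (RegularForm.zero k)⟩

instance {k : Type v} [Field k] : Add (FormClass k) :=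
  ⟨Quotient.map₂ RegularForm.sum (by
    rintro A A' ⟨e⟩ B B' ⟨f⟩
    exact ⟨QuadraticMap.IsometryEquiv.prod e f⟩)⟩

theorem formCls_eq {k : Type v} [Field k] {A B : RegularForm k} (e : A.V ≃ₗ[k] B.V)
    (he : ∀ x, B.Q (e x) = A.Q x) : formCls A = formCls B :=
  Quotient.sound ⟨⟨e, he⟩⟩

/-- The monoid of isometry classes of regular quadratic forms under orthogonal sum. -/
instance {k : Type v} [Field k] : AddCommMonoid (FormClass k) where
  add_assoc := by
    rintro ⟨A⟩ ⟨B⟩ ⟨C⟩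
    refine Quotient.sound ⟨⟨LinearEquiv.prodAssoc k A.V B.V C.V, ?_⟩⟩
    rintro ⟨⟨a, b⟩, c⟩
    exact (add_assoc (A.Q a) (B.Q b) (C.Q c)).symm
  zero_add := by
    rintro ⟨A⟩
    refine Quotient.sound ⟨⟨LinearEquiv.uniqueProd (R := k) (M := A.V) (M₂ := PUnit.{v + 1}), ?_⟩⟩
    rintro ⟨_, a⟩
    exact (zero_add (A.Q a)).symm
  add_zero := by
    rintro ⟨A⟩
    refine Quotient.sound ⟨⟨LinearEquiv.prodUnique (R := k) (M := A.V) (M₂ := PUnit.{v + 1}), ?_⟩⟩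
    rintro ⟨a, _⟩
    exact (add_zero (A.Q a)).symm
  add_comm := by
    rintro ⟨A⟩ ⟨B⟩
    exact Quotient.sound ⟨QuadraticMap.IsometryEquiv.prodComm A.Q B.Q⟩
  nsmul := nsmulRec

/-- The additive group of the Grothendieck–Witt ring of `k`: formal differences of isometry
classes of regular quadratic forms. -/
abbrev GW (k : Type v) [Field k] : Type (v + 1) := Algebra.GrothendieckAddGroup (FormClass k)

/-- The trace form `x ↦ tr_{M/E}(x²)` of a finite separable extension `M/E`. -/
noncomputable def traceForm (E M : Type v) [Field E] [Field M] [Algebra E M]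
    [FiniteDimensional E M] [Algebra.IsSeparable E M] [NeZero (2 : E)] : RegularForm E where
  V := M
  Q := (Algebra.traceForm E M).toQuadraticMap
  regular := fun x h => by
    have hn := traceForm_nondegenerate E M
    have h2 : ∀ y, Algebra.traceForm E M x y = 0 := fun y => by
      have := h y
      rw [LinearMap.BilinMap.polar_toQuadraticMap, Algebra.traceForm_apply,
        Algebra.traceForm_apply, mul_comm y x, ← two_mul] at this
      exact (mul_eq_zero.mp this).resolve_left (NeZero.ne 2)
    exact hn.1 x h2

section Dress

open Burnside IntermediateField

variable {F : Type u} {K : Type v} [Field F] [Field K] [Algebra F K]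

instance (H : Subgroup Gal(K/F)) (L : Subgroup H) : SMulCommClass L (fixedField H) K where
  smul_comm l a x := by
    change (l : Gal(K/F)) (a.1 * x) = a.1 * (l : Gal(K/F)) x
    rw [map_mul]
    congr 1
    exact a.2 l.1

/-- For `L ≤ H`, the fixed field `K^L` as an extension of `K^H`. -/
def fixedExtension (H : Subgroup Gal(K/F)) (L : Subgroup H) :
    IntermediateField (fixedField H) K :=
  FixedPoints.intermediateField L

instance [NeZero (2 : F)] (E : IntermediateField F K) : NeZero (2 : E) :=
  ⟨fun h => NeZero.ne (2 : F) ((algebraMap F E).injective (by rw [map_ofNat, map_zero]; exact h))⟩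

variable [FiniteDimensional F K] [IsGalois F K] [NeZero (2 : F)]

instance (H : Subgroup Gal(K/F)) (L : Subgroup H) :
    Algebra.IsSeparable (fixedField H) (fixedExtension H L) :=
  Algebra.isSeparable_tower_bot_of_isSeparable (fixedField H) (fixedExtension H L) K

/-- The class of the trace form of `K^L / K^H`. -/
noncomputable def traceClass (H : Subgroup Gal(K/F)) (L : Subgroup H) :
    FormClass (fixedField H) :=
  formCls (traceForm (fixedField H) (fixedExtension H L))

/-- Conjugate subgroups give isometric trace forms. -/
theorem traceClass_conj (H : Subgroup Gal(K/F)) (L : Subgroup H) (g : H) :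
    traceClass H (L.map (MulAut.conj g).toMonoidHom) = traceClass H L := by
  let σ : K ≃ₐ[fixedField H] K :=
    AlgEquiv.ofRingEquiv (f := ((g : Gal(K/F)) : K ≃+* K)) fun x => x.2 g
  have hσ : ∀ x, σ x = g • x := fun x => rfl
  have hmap : (fixedExtension H L).map (σ : K →ₐ[fixedField H] K) =
      fixedExtension H (L.map (MulAut.conj g).toMonoidHom) := by
    ext x
    rw [IntermediateField.mem_map]
    constructor
    · rintro ⟨y, hy, rfl⟩ ⟨l, m, hm, rfl⟩
      have h1 : m • y = y := hy ⟨m, hm⟩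
      change (g * m * g⁻¹) • (g • y) = g • y
      rw [smul_smul, inv_mul_cancel_right, mul_smul, h1]
    · intro hx
      refine ⟨g⁻¹ • x, fun l => ?_, smul_inv_smul g x⟩
      have h1 : (g * l.1 * g⁻¹) • x = x := hx ⟨_, l.1, l.2, rfl⟩
      change l.1 • g⁻¹ • x = g⁻¹ • x
      rw [eq_inv_smul_iff, smul_smul, smul_smul, h1]
  let e : fixedExtension H L ≃ₐ[fixedField H]
      fixedExtension H (L.map (MulAut.conj g).toMonoidHom) :=
    ((fixedExtension H L).equivMap (σ : K →ₐ[fixedField H] K)).trans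
      (IntermediateField.equivOfEq hmap)
  refine (formCls_eq (A := traceForm (fixedField H) (fixedExtension H L))
    (B := traceForm (fixedField H) (fixedExtension H (L.map (MulAut.conj g).toMonoidHom)))
    e.toLinearEquiv fun (x : fixedExtension H L) => ?_).symm
  change Algebra.trace _ _ (e x * e x) = Algebra.trace _ _ (x * x)
  rw [← map_mul, Algebra.trace_eq_of_algEquiv]

/-- The class of the trace form of `K^{H_x} / K^H`, for the orbit of a point `x` with stabilizer
`H_x`. -/
noncomputable def orbitTraceClass (H : Subgroup Gal(K/F)) (X : FinGSet H) :
    MulAction.orbitRel.Quotient H X → FormClass (fixedField H) :=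
  Quotient.lift (fun x => traceClass H (MulAction.stabilizer H x)) (by
    rintro x y ⟨g, rfl⟩
    simp only [MulAction.stabilizer_smul_eq_stabilizer_map_conj]
    exact traceClass_conj H _ g)

/-- The trace form of a finite `H`-set: the orthogonal sum of the trace forms of its orbits. -/
noncomputable def dressFun (H : Subgroup Gal(K/F)) (X : FinGSet H) : FormClass (fixedField H) :=
  ∑ᶠ ω, orbitTraceClass H X ω

theorem dressFun_congr (H : Subgroup Gal(K/F)) {X Y : FinGSet H} (h : X ≈ Y) :
    dressFun H X = dressFun H Y := by
  obtain ⟨e, he⟩ := h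
  have hr : ∀ x y : X, MulAction.orbitRel H X x y ↔ MulAction.orbitRel H Y (e x) (e y) := by
    intro x y
    simp only [MulAction.orbitRel_apply, MulAction.mem_orbit_iff, ← he, e.apply_eq_iff_eq]
  refine finsum_eq_of_bijective _ (Quotient.congr e hr).bijective ?_
  rintro ⟨x⟩
  refine congrArg (traceClass H) ?_
  ext g
  change g • x = x ↔ g • e x = e x
  rw [← he, e.apply_eq_iff_eq]

theorem dressFun_sum (H : Subgroup Gal(K/F)) (X Y : FinGSet H) :
    dressFun H (X.sum Y) = dressFun H X + dressFun H Y := by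
  let e : MulAction.orbitRel.Quotient H X ⊕ MulAction.orbitRel.Quotient H Y →
      MulAction.orbitRel.Quotient H (X.sum Y) :=
    Sum.elim
      (Quotient.map (Sum.inl : X → X ⊕ Y) (by rintro x y ⟨g, rfl⟩; exact ⟨g, rfl⟩))
      (Quotient.map (Sum.inr : Y → X ⊕ Y) (by rintro x y ⟨g, rfl⟩; exact ⟨g, rfl⟩))
  have hq : ∀ w z : X.sum Y,
      (Quotient.mk (MulAction.orbitRel H (X.sum Y)) w) = Quotient.mk _ z → ∃ g : H, g • z = w :=
    fun w z h => Quotient.exact h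
  have he : Function.Bijective e := by
    constructor
    · rintro (p | p) (q | q) h <;> obtain ⟨x, rfl⟩ := Quotient.exists_rep p <;>
        obtain ⟨y, rfl⟩ := Quotient.exists_rep q
      · obtain ⟨g, hg⟩ := hq (Sum.inl x) (Sum.inl y) h
        exact congrArg Sum.inl (Quotient.sound ⟨g, Sum.inl_injective hg⟩)
      · obtain ⟨g, hg⟩ := hq (Sum.inl x) (Sum.inr y) h
        exact (Sum.inr_ne_inl hg).elim
      · obtain ⟨g, hg⟩ := hq (Sum.inr x) (Sum.inl y) h
        exact (Sum.inl_ne_inr hg).elim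
      · obtain ⟨g, hg⟩ := hq (Sum.inr x) (Sum.inr y) h
        exact congrArg Sum.inr (Quotient.sound ⟨g, Sum.inr_injective hg⟩)
    · rintro ⟨x | y⟩
      · exact ⟨Sum.inl (Quotient.mk _ x), rfl⟩
      · exact ⟨Sum.inr (Quotient.mk _ y), rfl⟩
  let f : MulAction.orbitRel.Quotient H X ⊕ MulAction.orbitRel.Quotient H Y →
      FormClass (fixedField H) := Sum.elim (orbitTraceClass H X) (orbitTraceClass H Y)
  have hf : ∀ w, f w = orbitTraceClass H (X.sum Y) (e w) := by
    rintro (p | p) <;> obtain ⟨x, rfl⟩ := Quotient.exists_rep p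
    · refine congrArg (traceClass H) (Subgroup.ext fun g => ?_ : MulAction.stabilizer H x =
        MulAction.stabilizer H (Sum.inl x : X ⊕ Y))
      exact Sum.inl_injective.eq_iff.symm
    · refine congrArg (traceClass H) (Subgroup.ext fun g => ?_ : MulAction.stabilizer H x =
        MulAction.stabilizer H (Sum.inr x : X ⊕ Y))
      exact Sum.inr_injective.eq_iff.symm
  have hX : Finite (MulAction.orbitRel.Quotient H X) := Quotient.finite _
  have hY : Finite (MulAction.orbitRel.Quotient H Y) := Quotient.finite _
  have := Fintype.ofFinite (MulAction.orbitRel.Quotient H X)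
  have := Fintype.ofFinite (MulAction.orbitRel.Quotient H Y)
  rw [dressFun, ← finsum_eq_of_bijective e he hf, dressFun, dressFun, finsum_eq_sum_of_fintype,
    finsum_eq_sum_of_fintype, finsum_eq_sum_of_fintype, Fintype.sum_sum_type]
  rfl

/-- The Dress map `A(H) → GW(K^H)`, the additive map with `[H ⧸ L] ↦ tr_{K^L / K^H} ⟨1⟩`. -/
noncomputable def dressMap (H : Subgroup Gal(K/F)) :
    BurnsideRing H →+ GW (fixedField H) :=
  lift (of.comp
    { toFun := Quotient.lift (dressFun H) fun _ _ => dressFun_congr H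
      map_zero' := by
        have : IsEmpty (MulAction.orbitRel.Quotient H (FinGSet.empty H)) :=
          ⟨by rintro ⟨x⟩; exact x.elim⟩
        exact finsum_of_isEmpty _
      map_add' := by
        rintro ⟨X⟩ ⟨Y⟩
        exact dressFun_sum H X Y })

theorem dressMap_mk (H : Subgroup Gal(K/F)) (X : FinGSet H) :
    dressMap H (BurnsideRing.mk X) = of (dressFun H X) :=
  lift_of _ _

/-- The value of the Dress map on a transitive `H`-set. -/
theorem dressMap_coset (H : Subgroup Gal(K/F)) (L : Subgroup H) :
    dressMap H (BurnsideRing.mk (FinGSet.coset L)) = of (traceClass H L) := by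
  rw [dressMap_mk]
  let u : Unique (MulAction.orbitRel.Quotient H (FinGSet.coset L)) :=
    { default := Quotient.mk _ ((1 : H) : H ⧸ L)
      uniq := by
        rintro ⟨x⟩
        exact Quotient.sound (MulAction.mem_orbit_iff.mpr
          (MulAction.exists_smul_eq H ((1 : H) : H ⧸ L) x)) }
  rw [dressFun, finsum_unique]
  change of (traceClass H (MulAction.stabilizer H ((1 : H) : H ⧸ L))) = _
  rw [MulAction.stabilizer_quotient]

variable (F K) in
/-- The trace ideal of `K/F` at level `G ⧸ H`: the kernel of the Dress map `A(H) → GW(K^H)`. -/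
noncomputable def traceIdeal (H : Subgroup Gal(K/F)) : AddSubgroup (BurnsideRing H) :=
  (dressMap H).ker

end Dress

/-! ## Sums of squares and embeddability -/

/-- `α` is a sum of `m` squares in `k`. -/
def IsSumOfSquares {k : Type v} [Field k] (m : ℕ) (α : k) : Prop :=
  ∃ f : Fin m → k, α = ∑ i, f i ^ 2

open Classical in
/-- The least power of `2` such that `α` is a sum of that many squares, and `0` if `α` is not a
sum of squares. -/
noncomputable def tau {k : Type v} [Field k] (α : k) : ℕ :=
  if h : ∃ n : ℕ, IsSumOfSquares (2 ^ n) α then 2 ^ Nat.find h else 0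

/-- `0`, `2`, `2` or `τ / 2` according to whether `τ = tau α` is `0`, `1`, `2` or at least `4`. -/
noncomputable def piLevel {k : Type v} [Field k] (α : k) : ℕ :=
  if tau α = 0 then 0 else if tau α ≤ 2 then 2 else tau α / 2

/-- `K/F` embeds into a cyclic Galois extension of `F` of degree `n`. -/
def EmbedsInCyclic (F : Type u) (K : Type v) [Field F] [Field K] [Algebra F K] (n : ℕ) : Prop :=
  ∃ (M : Type v) (_ : Field M) (_ : Algebra F M) (_ : Algebra K M) (_ : IsScalarTower F K M),
    FiniteDimensional F M ∧ IsGalois F M ∧ IsCyclic Gal(M/F) ∧ Module.finrank F M = n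

end GrothendieckWitt

/-! The Burnside rings involved have small rank: with `t = [G/C₂]` and `u = [G/e]`, `A(G)` is free
on `1, t, u`, `A(C₂)` is free on `1, [C₂/e]`, and `A(e) = ℤ`. Both sides of the theorem are
therefore described by congruences between integer coefficients, and the proof compares two such
descriptions.

Kernel side. The trace forms are `⟨1, Δ, x, x⟩` for `K/F`, `⟨2, 2Δ⟩` for `E/F` and `⟨2, 2δ⟩` for
`K/E`. Witt cancellation lets an equation in `GW` be read as a statement about represented values.
Since `2 ^ n • ⟨1⟩` is round, `⟨cα⟩ - ⟨c⟩` is annihilated exactly by the multiples of `τ(α)`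
(`zsmul_gw_sub_eq_zero_iff`). This settles level `G/C₂`. At level `G/G`, dimension and discriminant
reduce `m + q t + p u ↦ 0` to `m + 2q + 4p = 0`, `2 ∣ q + p` and `p • ω = 0`, where `ω = ⟨1, Δ, x,
x⟩ - ⟨2, 2Δ⟩ - 2⟨1⟩` is `defect`. From `2ω = 4(⟨x⟩ - ⟨1⟩)` it follows that a nonzero `ω` is
annihilated exactly by the multiples of `π_F(x)` (`zsmul_defect_eq_zero_iff`).

Embeddability. `K/F` embeds into a cyclic extension of degree `8` if and only if `-1` is a norm from
`K` (`embedsInCyclic_eight_iff`, by Hilbert 90), and this holds if and only if `ω = 0`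
(`defect_eq_zero_of_norm`, `exists_norm_of_defect_eq_zero`). The second equivalence computes the
quadratic form `w ↦ tr(w · σ²w)` in two bases, one being a multiple of the other by an element `β`
for which `β · σ²β` has norm minus a square (`transfer`).

Ideal side. Marks embed the Burnside rings in products of copies of `ℤ` and make restriction,
transfer and norm explicit. The congruences found above define a Tambara ideal (`markIdeal`), and
every Tambara ideal containing the given generators contains it (`mem_level_of_markCongruence`). The
compatibility needed is `π ∣ τ(δ) ∣ 2π` with `τ(δ)` even: for `ω ≠ 0` it comes from comparing sums
of squares in `F` and `E` (`piLevel_dvd_tau_and_tau_dvd`), and for `ω = 0` one has `π = 1` and `τ(δ)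
= 2`. -/

/-! ### Cyclic extensions of degree eight and the norm equation `N(β) = -1` -/

section Embedding

open GrothendieckWitt Polynomial

variable {F : Type*} {K : Type*} [Field F] [Field K] [Algebra F K]

/-- The norm of a cyclic extension of degree `4` is the product of the four conjugates. -/
theorem algebraMap_norm_eq_of_orderOf_eq_four [FiniteDimensional F K] [IsGalois F K]
    (hcard : Nat.card Gal(K/F) = 4) {σ : Gal(K/F)} (hσ : orderOf σ = 4) (y : K) :
    algebraMap F K (Algebra.norm F y) = y * σ y * σ (σ y) * σ (σ (σ y)) := by
  classical
  rw [Algebra.norm_eq_prod_automorphisms]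
  have hinj : Function.Injective (fun i : Fin 4 => σ ^ (i : ℕ)) := by
    intro i j hij
    exact Fin.ext (pow_injOn_Iio_orderOf (by rw [hσ]; exact i.2) (by rw [hσ]; exact j.2) hij)
  have hbij : Function.Bijective (fun i : Fin 4 => σ ^ (i : ℕ)) := by
    rw [Fintype.bijective_iff_injective_and_card]
    exact ⟨hinj, by rw [Fintype.card_fin, ← Nat.card_eq_fintype_card, hcard]⟩
  rw [← hbij.prod_comp]
  simp [Fin.prod_univ_four]

/-- Hilbert's Theorem 90 for an automorphism of order `4`. -/
theorem exists_eq_mul_of_orderOf_eq_four {σ : Gal(K/F)} (hσ : orderOf σ = 4) {u : K}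
    (hu : u * σ u * σ (σ u) * σ (σ (σ u)) = 1) : ∃ y : K, y ≠ 0 ∧ y = u * σ y := by
  -- The coefficients of the Lagrange resolvent are the partial norms of `u`. Applying `σ` and
  -- multiplying by `u` permutes the four terms cyclically because the full product is `1`;
  -- Dedekind's independence of characters supplies a nonzero value.
  let c : Fin 4 → K := ![1, u, u * σ u, u * σ u * σ (σ u)]
  let f : Fin 4 → (K →* K) := fun i => ((σ ^ (i : ℕ) : Gal(K/F)) : K →* K)
  have hf : Function.Injective f := by
    intro i j hij
    refine Fin.ext (pow_injOn_Iio_orderOf (x := σ) (by rw [hσ]; exact i.2)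
      (by rw [hσ]; exact j.2) ?_)
    exact AlgEquiv.ext fun y => DFunLike.congr_fun hij y
  have hli := (linearIndependent_monoidHom K K).comp f hf
  have hne : ∃ z : K, ∑ i, c i * f i z ≠ 0 := by
    by_contra! h
    have := Fintype.linearIndependent_iff.mp hli c (funext fun z => by
      simpa [Finset.sum_apply] using h z) 0
    simp [c] at this
  obtain ⟨z, hz⟩ := hne
  have hsum : ∑ i, c i * f i z =
      z + u * σ z + u * σ u * σ (σ z) + u * σ u * σ (σ u) * σ (σ (σ z)) := by
    simp [Fin.sum_univ_four, c, f]
  have h4 : σ (σ (σ (σ z))) = z := by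
    have : (σ ^ 4) z = z := by rw [← hσ, pow_orderOf_eq_one]; rfl
    simpa [pow_succ, AlgEquiv.mul_apply] using this
  refine ⟨_, hz, ?_⟩
  rw [hsum]
  simp only [map_add, map_mul, h4]
  linear_combination (-z) * hu

section Construction

variable {σ : Gal(K/F)} {θ β : K}

/-- The element `β√θ` is a square root of `σ θ = β²θ`, which is the condition for `σ` to extend to
`K(√θ)` by `√θ ↦ β√θ`. -/
theorem eval₂_conj_eq_zero (hθ : σ θ = β ^ 2 * θ) :
    (X ^ 2 - C θ : K[X]).eval₂ ((IsScalarTower.toAlgHom F K (AdjoinRoot (X ^ 2 - C θ))).comp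
      (σ : K →ₐ[F] K))
      (AdjoinRoot.of _ β * AdjoinRoot.root (X ^ 2 - C θ)) = 0 := by
  have h : (AdjoinRoot.root (X ^ 2 - C θ)) ^ 2 = AdjoinRoot.of (X ^ 2 - C θ) θ := by
    have := AdjoinRoot.eval₂_root (X ^ 2 - C θ)
    rw [eval₂_sub, eval₂_pow, eval₂_X, eval₂_C] at this
    exact sub_eq_zero.mp this
  rw [eval₂_sub, eval₂_pow, eval₂_X, eval₂_C, mul_pow, h]
  change _ - AdjoinRoot.of _ (σ θ) = 0
  rw [hθ, map_mul, map_pow, sub_self]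

/-- The extension of `σ` to `K(√θ)` that multiplies `√θ` by `β`. -/
noncomputable def conjAdjoinRoot (hθ : σ θ = β ^ 2 * θ) :
    AdjoinRoot (X ^ 2 - C θ) →ₐ[F] AdjoinRoot (X ^ 2 - C θ) :=
  AdjoinRoot.liftAlgHom _ _ _ (eval₂_conj_eq_zero hθ)

theorem conjAdjoinRoot_of (hθ : σ θ = β ^ 2 * θ) (y : K) :
    conjAdjoinRoot hθ (AdjoinRoot.of _ y) = AdjoinRoot.of _ (σ y) :=
  AdjoinRoot.liftAlgHom_of _ _ _ _ _

theorem conjAdjoinRoot_root (hθ : σ θ = β ^ 2 * θ) :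
    conjAdjoinRoot hθ (AdjoinRoot.root _) = AdjoinRoot.of _ β * AdjoinRoot.root _ :=
  AdjoinRoot.liftAlgHom_root _ _ _ _

end Construction

end Embedding

section EmbeddingCriterion

open GrothendieckWitt Polynomial

universe w₁ w₂

variable {F : Type w₁} {K : Type w₂} [Field F] [Field K] [Algebra F K] [FiniteDimensional F K]
  [IsGalois F K]

/-- Since `N(β²) = 1`, Hilbert 90 gives `θ` with `σ θ = β²θ`. The extension `τ` of `σ` with `τ√θ =
β√θ` satisfies `τ⁴√θ = N(β)√θ = -√θ`, so it has order `8`, which is the degree of `K(√θ)/F`. -/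
theorem embedsInCyclic_of_norm_eq_neg_one [NeZero (2 : F)] (hcard : Nat.card Gal(K/F) = 4) {σ : Gal(K/F)}
    (hσ : orderOf σ = 4) {β : K} (hβ : β * σ β * σ (σ β) * σ (σ (σ β)) = -1) :
    EmbedsInCyclic F K 8 := by
  have h2 : (2 : K) ≠ 0 := fun h => NeZero.ne (2 : F)
    ((algebraMap F K).injective (by rw [map_ofNat, map_zero, h]))
  have hβ0 : β ≠ 0 := by
    rintro rfl
    simp at hβ
  obtain ⟨θ, hθ0, hθ⟩ := exists_eq_mul_of_orderOf_eq_four hσ (u := (β ^ 2)⁻¹) (by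
    simp only [map_inv₀, map_pow]
    rw [← mul_inv, ← mul_inv, ← mul_inv, ← mul_pow, ← mul_pow, ← mul_pow, hβ]
    norm_num)
  have hσθ : σ θ = β ^ 2 * θ := by
    rw [inv_mul_eq_div, eq_div_iff (pow_ne_zero 2 hβ0)] at hθ
    rw [← hθ, mul_comm]
  have h4 : ∀ z, σ (σ (σ (σ z))) = z := fun z => by
    have : (σ ^ 4) z = z := by rw [← hσ, pow_orderOf_eq_one]; rfl
    simpa [pow_succ, AlgEquiv.mul_apply] using this
  have hns : ∀ c : K, c ^ 2 ≠ θ := by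
    rintro c rfl
    have hc : c ≠ 0 := by
      rintro rfl
      simp at hθ0
    rw [map_pow, ← mul_pow, sq_eq_sq_iff_eq_or_eq_neg] at hσθ
    -- If `θ = c²`, then `σ c = εβc` with `ε = ±1`, and four applications of `σ` give `c = ε⁴ N(β) c
    -- = -c`.
    have hN : ∀ ε : K, (σ ε = ε) → ε ^ 4 = 1 → σ c = ε * β * c → False := by
      intro ε hε hε4 h
      have h' := h4 c
      simp only [map_mul, hε, h] at h'
      have : ε ^ 4 * (β * σ β * σ (σ β) * σ (σ (σ β))) * c = c := by
        linear_combination h'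
      rw [hβ, hε4] at this
      have h3 : (2 : K) * c = 0 := by linear_combination (-1 : K) * this
      exact (mul_ne_zero h2 hc) h3
    rcases hσθ with h | h
    · exact hN 1 (map_one _) (one_pow _) (by rw [h, one_mul])
    · exact hN (-1) (by simp) (by norm_num) (by rw [h]; ring)
  have hirr : Irreducible (X ^ 2 - C θ : K[X]) :=
    (X_pow_sub_C_irreducible_iff_of_prime Nat.prime_two).mpr hns
  have : Fact (Irreducible (X ^ 2 - C θ : K[X])) := ⟨hirr⟩
  let M := AdjoinRoot (X ^ 2 - C θ : K[X])
  have hne : (X ^ 2 - C θ : K[X]) ≠ 0 := hirr.ne_zero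
  have : FiniteDimensional K M := (AdjoinRoot.powerBasis hne).finite
  have : FiniteDimensional F M := FiniteDimensional.trans F K M
  have hdeg : Module.finrank F M = 8 := by
    rw [← Module.finrank_mul_finrank F K M, ← IsGalois.card_aut_eq_finrank, hcard,
      (AdjoinRoot.powerBasis hne).finrank, AdjoinRoot.powerBasis_dim, natDegree_X_pow_sub_C]
  let τ : Gal(M/F) := AlgEquiv.ofBijective (conjAdjoinRoot hσθ) (AlgHom.bijective _)
  have hτo : ∀ y : K, τ (AdjoinRoot.of _ y) = AdjoinRoot.of _ (σ y) := conjAdjoinRoot_of hσθ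
  have hτr : τ (AdjoinRoot.root _) = AdjoinRoot.of _ β * AdjoinRoot.root _ :=
    conjAdjoinRoot_root hσθ
  have hr0 : (AdjoinRoot.root (X ^ 2 - C θ) : M) ≠ 0 := by
    intro h
    have := AdjoinRoot.eval₂_root (X ^ 2 - C θ)
    rw [h, eval₂_sub, eval₂_pow, eval₂_X, eval₂_C] at this
    refine hθ0 ((AdjoinRoot.of (X ^ 2 - C θ)).injective ?_)
    simpa using this
  have hτ4r : (τ ^ 4) (AdjoinRoot.root _) = -AdjoinRoot.root _ := by
    simp only [pow_succ, pow_zero, one_mul, AlgEquiv.mul_apply, hτr, map_mul, hτo]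
    have := congrArg (AdjoinRoot.of (X ^ 2 - C θ)) hβ
    simp only [map_mul, map_neg, map_one] at this
    linear_combination (AdjoinRoot.root (X ^ 2 - C θ)) * this
  have hτ4o : ∀ y, (τ ^ 4) (AdjoinRoot.of _ y) = AdjoinRoot.of _ y := by
    intro y
    simp only [pow_succ, pow_zero, one_mul, AlgEquiv.mul_apply, hτo, h4]
  have hM2 : (2 : M) ≠ 0 := fun h => h2 ((AdjoinRoot.of (X ^ 2 - C θ)).injective (by
    rw [map_ofNat, map_zero]; exact h))
  have hord : orderOf τ = 2 ^ (2 + 1) := by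
    refine orderOf_eq_prime_pow ?_ ?_
    · intro h
      have h' := hτ4r
      norm_num at h
      rw [h, AlgEquiv.one_apply] at h'
      have : (2 : M) * AdjoinRoot.root (X ^ 2 - C θ) = 0 := by linear_combination h'
      exact mul_ne_zero hM2 hr0 this
    · have h8 : τ ^ 2 ^ (2 + 1) = τ ^ 4 * τ ^ 4 := by
        rw [← pow_add]
        norm_num
      rw [h8]
      refine AlgEquiv.ext fun y => ?_
      obtain ⟨p, rfl⟩ := AdjoinRoot.mk_surjective y
      induction p using Polynomial.induction_on' with
      | add p q hp hq => simp only [map_add, hp, hq]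
      | monomial n c =>
        rw [← C_mul_X_pow_eq_monomial, map_mul, AdjoinRoot.mk_C, map_pow, AdjoinRoot.mk_X]
        simp only [AlgEquiv.mul_apply, map_mul, map_pow, hτ4o, hτ4r, map_neg,
          AlgEquiv.one_apply]
        rw [neg_neg (AdjoinRoot.root (X ^ 2 - C θ) : M)]
  have hcM : Nat.card Gal(M/F) = 8 := by
    refine le_antisymm ?_ ?_
    · rw [← hdeg, Nat.card_eq_fintype_card]
      exact AlgEquiv.card_le
    · have := orderOf_le_card (x := τ)
      rw [hord] at this
      exact this
  have hgal : IsGalois F M := IsGalois.of_card_aut_eq_finrank F M (by rw [hcM, hdeg])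
  exact ⟨M, inferInstance, inferInstance, inferInstance, inferInstance, inferInstance, hgal,
    isCyclic_of_orderOf_eq_card τ (by rw [hord, hcM]; norm_num), hdeg⟩

/-- For a generator `τ` of the larger group, an element `m ≠ 0` with `τ⁴ m = -m` gives `β = τ m /
m`. It is fixed by `τ⁴`, hence lies in `K`, and its norm telescopes to `τ⁴ m / m = -1`. -/
theorem exists_norm_eq_neg_one_of_embedsInCyclic (hcard : Nat.card Gal(K/F) = 4)
    (h : EmbedsInCyclic F K 8) : ∃ β : K, Algebra.norm F β = -1 := by
  obtain ⟨M, _, _, _, _, hfd, hgal, hcyc, hdeg⟩ := h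
  obtain ⟨τ, hτ⟩ := hcyc.exists_generator
  have hcM : Nat.card Gal(M/F) = 8 := by rw [IsGalois.card_aut_eq_finrank, hdeg]
  have hoτ : orderOf τ = 8 := by rw [orderOf_eq_card_of_forall_mem_zpowers hτ, hcM]
  let ρ : Gal(M/F) →* Gal(K/F) := AlgEquiv.restrictNormalHom K
  have hρ : Function.Surjective ρ := AlgEquiv.restrictNormalHom_surjective M
  have hρa : ∀ (φ : Gal(M/F)) (y : K), algebraMap K M (ρ φ y) = φ (algebraMap K M y) :=
    fun φ y => AlgEquiv.restrictNormal_commutes φ K y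
  have hgσ : ∀ g, g ∈ Subgroup.zpowers (ρ τ) := by
    intro g
    obtain ⟨φ, rfl⟩ := hρ g
    obtain ⟨i, rfl⟩ := Subgroup.mem_zpowers_iff.mp (hτ φ)
    rw [map_zpow]
    exact Subgroup.zpow_mem_zpowers _ _
  have hoσ : orderOf (ρ τ) = 4 := by rw [orderOf_eq_card_of_forall_mem_zpowers hgσ, hcard]
  have hFM : FiniteDimensional K M := FiniteDimensional.right F K M
  have hKM : IsGalois K M := IsGalois.tower_top_of_isGalois F K M
  have h4 : τ ^ 4 ≠ 1 := fun h => by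
    have := orderOf_dvd_of_pow_eq_one h
    rw [hoτ] at this
    norm_num at this
  have h8 : ∀ z, (τ ^ 4) ((τ ^ 4) z) = z := fun z => by
    rw [← AlgEquiv.mul_apply, ← pow_add, show 4 + 4 = orderOf τ from hoτ.symm,
      pow_orderOf_eq_one, AlgEquiv.one_apply]
  obtain ⟨y, hy⟩ : ∃ y, (τ ^ 4) y ≠ y := by
    by_contra! h
    exact h4 (AlgEquiv.ext h)
  set m := y - (τ ^ 4) y with hm
  have hm0 : m ≠ 0 := fun h => hy (sub_eq_zero.mp h).symm
  have hτm : (τ ^ 4) m = -m := by rw [hm, map_sub, h8]; ring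
  -- An automorphism over `K` is a power `τ ^ i` that restricts trivially to `K`; as `τ` restricts
  -- to an element of order `4`, it is a power of `τ⁴`.
  have hfix : ∀ z : M, (τ ^ 4) z = z → ∃ w : K, algebraMap K M w = z := by
    intro z hz
    refine (IsGalois.mem_range_algebraMap_iff_fixed (F := K) z).mpr fun f => ?_
    obtain ⟨i, hi⟩ := Subgroup.mem_zpowers_iff.mp (hτ (f.restrictScalars F))
    have h1 : ρ τ ^ i = 1 := by
      rw [← map_zpow, hi]
      refine AlgEquiv.ext fun w => (algebraMap K M).injective ?_
      rw [hρa]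
      simp
    obtain ⟨j, rfl⟩ := orderOf_dvd_iff_zpow_eq_one.mpr h1
    have h2 : f z = ((τ ^ 4) ^ j) z := by
      rw [← zpow_natCast, ← zpow_mul]
      rw [hoσ] at hi
      push_cast at hi ⊢
      rw [hi]
      rfl
    rw [h2]
    have h3 : τ ^ 4 ∈ MulAction.stabilizer Gal(M/F) z := hz
    exact (zpow_mem h3 j : _)
  obtain ⟨β, hβ⟩ := hfix (τ m / m) (by
    have h1 : (τ ^ 4) (τ m) = τ ((τ ^ 4) m) := by
      rw [← AlgEquiv.mul_apply, ← AlgEquiv.mul_apply, ← pow_succ, ← pow_succ']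
    rw [map_div₀, h1, hτm, map_neg, neg_div_neg_eq])
  refine ⟨β, (algebraMap F K).injective ?_⟩
  rw [algebraMap_norm_eq_of_orderOf_eq_four hcard hoσ]
  apply (algebraMap K M).injective
  simp only [map_mul, hρa, hβ, map_div₀, map_neg, map_one]
  have h5 : τ (τ (τ (τ m))) = -m := by
    simpa [pow_succ, AlgEquiv.mul_apply] using hτm
  have h6 : τ m ≠ 0 := by simpa using hm0
  have h7 : τ (τ m) ≠ 0 := by simpa using h6
  have h9 : τ (τ (τ m)) ≠ 0 := by simpa using h7
  rw [h5]
  field_simp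

/-- A cyclic extension of degree `4` embeds into a cyclic extension of degree `8` if and only if
`-1` is a norm. -/
theorem embedsInCyclic_eight_iff [NeZero (2 : F)] (hcard : Nat.card Gal(K/F) = 4) {σ : Gal(K/F)}
    (hσ : orderOf σ = 4) :
    EmbedsInCyclic F K 8 ↔ ∃ β : K, β * σ β * σ (σ β) * σ (σ (σ β)) = -1 := by
  refine ⟨fun h => ?_, fun ⟨β, hβ⟩ => embedsInCyclic_of_norm_eq_neg_one hcard hσ hβ⟩
  obtain ⟨β, hβ⟩ := exists_norm_eq_neg_one_of_embedsInCyclic hcard h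
  exact ⟨β, by rw [← algebraMap_norm_eq_of_orderOf_eq_four hcard hσ, hβ, map_neg, map_one]⟩

end EmbeddingCriterion


namespace GrothendieckWitt

open Algebra.GrothendieckAddGroup (of lift)

universe v₁

/-! ### Witt cancellation -/

section Witt

variable {k : Type*} [Field k] {V : Type*} [AddCommGroup V] [Module k V]

/-- The reflection in an anisotropic vector. -/
theorem exists_reflection (Q : QuadraticForm k V) {w : V} (hw : Q w ≠ 0) :
    ∃ ρ : V ≃ₗ[k] V, (∀ y, ρ y = y - (QuadraticMap.polar Q w y / Q w) • w) ∧
      ∀ y, Q (ρ y) = Q y := by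
  let f : Module.Dual k V := (Q w)⁻¹ • Q.polarBilin w
  have hf : ∀ y, f y = QuadraticMap.polar Q w y / Q w := fun y => by
    simp [f, div_eq_inv_mul]
  have h2 : f w = 2 := by
    rw [hf, QuadraticMap.polar_self, nsmul_eq_mul, Nat.cast_ofNat, mul_div_cancel_right₀ _ hw]
  refine ⟨Module.reflection h2, fun y => ?_, fun y => ?_⟩
  · rw [Module.reflection_apply, hf]
  · rw [Module.reflection_apply, hf, sub_eq_add_neg, ← neg_smul, QuadraticMap.map_add Q,
      QuadraticMap.map_smul, QuadraticMap.polar_smul_right, QuadraticMap.polar_comm Q y w]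
    simp only [smul_eq_mul]
    field_simp
    ring

/-- Two vectors of the same nonzero length are exchanged by an isometry. -/
theorem exists_isometry_apply_eq [NeZero (2 : k)] (Q : QuadraticForm k V) {u v : V}
    (huv : Q u = Q v) (hv : Q v ≠ 0) : ∃ ρ : V ≃ₗ[k] V, ρ u = v ∧ ∀ y, Q (ρ y) = Q y := by
  have hsub : Q (u - v) = 2 * Q v - QuadraticMap.polar Q u v := by
    rw [sub_eq_add_neg, QuadraticMap.map_add Q, QuadraticMap.map_neg, QuadraticMap.polar_neg_right,
      huv]
    ring
  have hadd : Q (u + v) = 2 * Q v + QuadraticMap.polar Q u v := by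
    rw [QuadraticMap.map_add Q, huv]
    ring
  have hself : QuadraticMap.polar Q u u = 2 * Q v := by
    rw [QuadraticMap.polar_self, nsmul_eq_mul, huv, Nat.cast_ofNat]
  by_cases h : Q (u - v) = 0
  -- By the parallelogram law `Q(u - v) + Q(u + v) = 4 Q(v) ≠ 0`, so when `u - v` is isotropic the
  -- reflection in `u + v`, which sends `u` to `-v`, is available.
  · have h' : Q (u + v) ≠ 0 := by
      intro h'
      have h4 : (2 : k) * 2 * Q v = 0 := by linear_combination h + h' - hsub - hadd
      exact mul_ne_zero (mul_ne_zero (NeZero.ne 2) (NeZero.ne 2)) hv h4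
    obtain ⟨ρ, hρ, hQ⟩ := exists_reflection Q h'
    refine ⟨ρ.trans (LinearEquiv.neg k), ?_, fun y => ?_⟩
    · rw [LinearEquiv.trans_apply, LinearEquiv.neg_apply, hρ, QuadraticMap.polar_add_left, hself,
        QuadraticMap.polar_comm Q v u, ← hadd, div_self h', one_smul]
      abel
    · rw [LinearEquiv.trans_apply, LinearEquiv.neg_apply, QuadraticMap.map_neg, hQ]
  · obtain ⟨ρ, hρ, hQ⟩ := exists_reflection Q h
    refine ⟨ρ, ?_, hQ⟩
    rw [hρ, QuadraticMap.polar_sub_left, hself, QuadraticMap.polar_comm Q v u, ← hsub, div_self h,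
      one_smul]
    abel

end Witt

variable {k : Type v₁} [Field k]

theorem RegularForm.injective_of_isometric (A : RegularForm k) {W : Type*} [AddCommGroup W]
    [Module k W] (Q : QuadraticForm k W) (f : A.V →ₗ[k] W) (hf : ∀ y, Q (f y) = A.Q y) :
    Function.Injective f := by
  rw [injective_iff_map_eq_zero]
  intro y hy
  refine A.regular y fun z => ?_
  have : QuadraticMap.polar A.Q y z = QuadraticMap.polar Q (f y) (f z) := by
    simp only [QuadraticMap.polar, ← map_add, hf]
  rw [this, hy]
  simp

theorem formCls_eq_of_linearMap {A B : RegularForm k} (f : A.V →ₗ[k] B.V)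
    (hf : ∀ y, B.Q (f y) = A.Q y) (hd : Module.finrank k A.V = Module.finrank k B.V) :
    formCls A = formCls B :=
  formCls_eq (LinearEquiv.ofInjectiveOfFinrankEq f (A.injective_of_isometric B.Q f hf) hd) hf

theorem formCls_sum (A B : RegularForm k) : formCls (A.sum B) = formCls A + formCls B := rfl

variable [NeZero (2 : k)]

/-- The form `y ↦ c y²`. -/
noncomputable def lineForm (c : k) (hc : c ≠ 0) : RegularForm k where
  V := k
  Q := c • QuadraticMap.sq
  regular := fun x h => by
    have h1 := h 1
    simp only [QuadraticMap.polar, smul_apply, QuadraticMap.sq_apply,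
      smul_eq_mul] at h1
    have h2 : 2 * c * x = 0 := by linear_combination h1
    exact (mul_eq_zero.mp h2).resolve_left (mul_ne_zero (NeZero.ne 2) hc)

theorem lineForm_apply (c : k) (hc : c ≠ 0) (y : k) : (lineForm c hc).Q y = c * y ^ 2 := by
  change c • (y * y) = _
  rw [smul_eq_mul, sq]

/-- Cancellation of a one-dimensional form. -/
theorem formCls_eq_of_lineForm_sum_eq {c : k} (hc : c ≠ 0) {A B : RegularForm k}
    (h : formCls ((lineForm c hc).sum A) = formCls ((lineForm c hc).sum B)) :
    formCls A = formCls B := by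
  obtain ⟨e⟩ : ((lineForm c hc).sum A).Q.Equivalent ((lineForm c hc).sum B).Q := Quotient.exact h
  let Q (C : RegularForm k) : QuadraticForm k (k × C.V) := ((lineForm c hc).sum C).Q
  have hQ : ∀ (C : RegularForm k) (p : k × C.V), Q C p = c * p.1 ^ 2 + C.Q p.2 := fun C p => by
    rw [← lineForm_apply c hc]
    rfl
  let e' : (k × A.V) ≃ₗ[k] (k × B.V) := e.toLinearEquiv
  have he : ∀ p, Q B (e' p) = Q A p := e.map_app'
  have h1 : Q B (e' (1, 0)) = Q B (1, 0) := by
    rw [he, hQ, hQ]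
    simp
  have h0 : Q B (1, 0) ≠ 0 := by
    rw [hQ]
    simpa using hc
  obtain ⟨ρ, hρ, hρQ⟩ := exists_isometry_apply_eq _ h1 h0
  let f : (k × A.V) ≃ₗ[k] (k × B.V) := e'.trans ρ
  have hf1 : f (1, 0) = (1, 0) := hρ
  have hfQ : ∀ p, c * (f p).1 ^ 2 + B.Q (f p).2 = c * p.1 ^ 2 + A.Q p.2 := fun p => by
    rw [← hQ, ← hQ]
    exact (hρQ _).trans (he p)
  -- An isometry fixing the first basis vector preserves its orthogonal complement: subtract the
  -- length of `(0, y)` from that of `(1, y)`.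
  have hfst : ∀ y, (f (0, y)).1 = 0 := by
    intro y
    have ha := hfQ (1, y)
    have hb := hfQ (0, y)
    have hadd : f (1, y) = (1, 0) + f (0, y) := by
      rw [← hf1, ← map_add]
      simp
    rw [hadd] at ha
    simp only [Prod.fst_add, Prod.snd_add, zero_add] at ha hb
    have h3 : 2 * c * (f (0, y)).1 = 0 := by linear_combination ha - hb
    exact (mul_eq_zero.mp h3).resolve_left (mul_ne_zero (NeZero.ne 2) hc)
  refine formCls_eq_of_linearMap
    ((LinearMap.snd k k B.V).comp (f.toLinearMap.comp (LinearMap.inr k k A.V))) (fun y => ?_) ?_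
  · have := hfQ (0, y)
    rw [hfst] at this
    simpa using this
  · have := f.finrank_eq
    rw [Module.finrank_prod, Module.finrank_prod] at this
    omega

/-- The class of the form `y ↦ c y²` for `c ≠ 0`. -/
noncomputable def lineCls (c : k) : FormClass k :=
  -- The value `0` at `c = 0` makes the function total, so that diagonal forms can be written as
  -- plain sums without proofs that the entries are nonzero.
  open Classical in if hc : c = 0 then 0 else formCls (lineForm c hc)

theorem lineCls_eq {c : k} (hc : c ≠ 0) : lineCls c = formCls (lineForm c hc) := dif_neg hc

/-- The diagonal form with nonzero entries `w i`. -/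
noncomputable def diagForm {n : ℕ} (w : Fin n → k) (hw : ∀ i, w i ≠ 0) : RegularForm k where
  V := ULift.{v₁} (Fin n) → k
  Q := QuadraticMap.weightedSumSquares k (fun i => w i.down)
  regular := fun x h => by
    classical
    funext i
    have h1 := h (Pi.single i 1)
    have h2 := QuadraticMap.weightedSumSquares_apply (R := k) (fun i : ULift.{v₁} (Fin n) => w i.down)
    simp only [QuadraticMap.polar, h2, ← Finset.sum_sub_distrib] at h1
    rw [Finset.sum_eq_single i] at h1
    · simp only [Pi.add_apply, Pi.single_eq_same, smul_eq_mul] at h1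
      have h3 : 2 * w i.down * x i = 0 := by linear_combination h1
      exact (mul_eq_zero.mp h3).resolve_left (mul_ne_zero (NeZero.ne 2) (hw _))
    · intro j _ hj
      simp [Pi.single_eq_of_ne hj]
    · simp

theorem diagForm_apply {n : ℕ} (w : Fin n → k) (hw : ∀ i, w i ≠ 0)
    (y : ULift.{v₁} (Fin n) → k) : (diagForm w hw).Q y = ∑ i, w i * y ⟨i⟩ ^ 2 := by
  change QuadraticMap.weightedSumSquares k _ y = _
  rw [QuadraticMap.weightedSumSquares_apply, ← Equiv.ulift.symm.sum_comp]
  refine Finset.sum_congr rfl fun i _ => ?_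
  simp [sq]

theorem formCls_diagForm {n : ℕ} (w : Fin n → k) (hw : ∀ i, w i ≠ 0) :
    formCls (diagForm w hw) = ∑ i, lineCls (w i) := by
  induction n with
  | zero =>
    rw [Finset.univ_eq_empty, Finset.sum_empty]
    refine formCls_eq_of_linearMap (A := diagForm w hw) (B := RegularForm.zero k) 0
      (fun y => ?_) ?_
    · refine Eq.trans ?_ (diagForm_apply w hw y).symm
      rw [Finset.univ_eq_empty, Finset.sum_empty]
      rfl
    · change Module.finrank k (ULift.{v₁} (Fin 0) → k) = Module.finrank k PUnit.{v₁ + 1}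
      rw [Module.finrank_zero_of_subsingleton, Module.finrank_zero_of_subsingleton]
  | succ n ih =>
    rw [Fin.sum_univ_succ, ← ih _ fun i => hw _, lineCls_eq (hw 0), ← formCls_sum]
    let B := (lineForm (w 0) (hw 0)).sum (diagForm (fun i : Fin n => w i.succ) fun i => hw _)
    let f : (ULift.{v₁} (Fin (n + 1)) → k) →ₗ[k] k × (ULift.{v₁} (Fin n) → k) :=
      LinearMap.prod (LinearMap.proj ⟨0⟩)
        (LinearMap.pi fun i => LinearMap.proj ⟨i.down.succ⟩)
    refine formCls_eq_of_linearMap (A := diagForm w hw) (B := B) f (fun y => ?_) ?_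
    · refine Eq.trans ?_ (diagForm_apply w hw y).symm
      rw [Fin.sum_univ_succ]
      change (lineForm (w 0) (hw 0)).Q (y ⟨0⟩) +
        (diagForm (fun i : Fin n => w i.succ) fun i => hw _).Q (fun i => y ⟨i.down.succ⟩) = _
      rw [lineForm_apply, diagForm_apply]
    · change Module.finrank k (ULift.{v₁} (Fin (n + 1)) → k) =
        Module.finrank k (k × (ULift.{v₁} (Fin n) → k))
      simp [add_comm]

/-- A form with an orthogonal basis is the orthogonal sum of the corresponding lines. -/
theorem formCls_eq_sum_of_orthogonal (A : RegularForm k) {n : ℕ}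
    (hn : Module.finrank k A.V = n) (e : Fin n → A.V) (w : Fin n → k) (hw : ∀ i, w i ≠ 0)
    (hQ : ∀ i, A.Q (e i) = w i) (ho : ∀ i j, i ≠ j → QuadraticMap.polar A.Q (e i) (e j) = 0) :
    formCls A = ∑ i, lineCls (w i) := by
  classical
  rw [← formCls_diagForm w hw]
  let f : (ULift.{v₁} (Fin n) → k) →ₗ[k] A.V :=
    ∑ i : Fin n, (LinearMap.toSpanSingleton k A.V (e i)).comp (LinearMap.proj ⟨i⟩)
  have hf : ∀ y, f y = ∑ i, y ⟨i⟩ • e i := fun y => by simp [f]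
  refine (formCls_eq_of_linearMap (A := diagForm w hw) (B := A) f (fun y => ?_) ?_).symm
  · refine Eq.trans ?_ (diagForm_apply w hw y).symm
    refine (congrArg A.Q (hf y)).trans ?_
    have key : ∀ s : Finset (Fin n), A.Q (∑ i ∈ s, y ⟨i⟩ • e i) = ∑ i ∈ s, w i * y ⟨i⟩ ^ 2 := by
      intro s
      induction s using Finset.induction_on with
      | empty => simp
      | insert a s ha ih =>
        rw [Finset.sum_insert ha, Finset.sum_insert ha, QuadraticMap.map_add A.Q, ih,
          QuadraticMap.map_smul, hQ, smul_eq_mul]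
        have : QuadraticMap.polar A.Q (y ⟨a⟩ • e a) (∑ i ∈ s, y ⟨i⟩ • e i) = 0 := by
          change A.Q.polarBilin _ _ = 0
          rw [map_sum]
          refine Finset.sum_eq_zero fun i hi => ?_
          rw [map_smul, map_smul, LinearMap.smul_apply]
          have : A.Q.polarBilin (e a) (e i) = 0 := ho a i (by rintro rfl; exact ha hi)
          rw [this]
          simp
        rw [this]
        ring
    exact key _
  · rw [hn]
    change Module.finrank k (ULift.{v₁} (Fin n) → k) = n
    simp

/-- Diagonalisation reduces Witt cancellation to removing one line at a time. -/
theorem exists_eq_sum_lineCls (C : FormClass k) :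
    ∃ (n : ℕ) (w : Fin n → k), (∀ i, w i ≠ 0) ∧ C = ∑ i, lineCls (w i) := by
  obtain ⟨A, rfl⟩ : ∃ A, formCls A = C := Quotient.exists_rep C
  have : Invertible (2 : k) := invertibleOfNonzero (NeZero.ne 2)
  have hs : LinearMap.SeparatingLeft (QuadraticMap.associated (R := k) A.Q) := by
    intro x h
    refine A.regular x fun y => ?_
    have := QuadraticMap.two_nsmul_associated k A.Q
    have h2 := DFunLike.congr_fun (DFunLike.congr_fun this x) y
    have h3 := h y
    simp only [QuadraticMap.polarBilin_apply_apply, LinearMap.smul_apply] at h2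
    rw [← h2, h3, smul_zero]
  obtain ⟨w, ⟨e⟩⟩ := QuadraticForm.equivalent_weightedSumSquares_units_of_nondegenerate' A.Q hs
  refine ⟨_, fun i => w i, fun i => (w i).ne_zero, ?_⟩
  rw [← formCls_diagForm _ fun i => (w i).ne_zero]
  symm
  let f : (ULift.{v₁} (Fin (Module.finrank k A.V)) → k) ≃ₗ[k] A.V :=
    (LinearEquiv.funCongrLeft k k Equiv.ulift.symm).trans e.symm.toLinearEquiv
  refine formCls_eq (A := diagForm _ _) (B := A) f fun y => ?_
  refine Eq.trans ?_ (diagForm_apply _ _ y).symm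
  refine (e.symm.map_app' _).trans ?_
  rw [QuadraticMap.weightedSumSquares_apply]
  refine Finset.sum_congr rfl fun i _ => ?_
  simp [sq, Units.smul_def, LinearEquiv.funCongrLeft, LinearMap.funLeft]
  rfl

theorem lineCls_add_cancel {c : k} (hc : c ≠ 0) {A B : FormClass k}
    (h : lineCls c + A = lineCls c + B) : A = B := by
  obtain ⟨A, rfl⟩ : ∃ A', formCls A' = A := Quotient.exists_rep A
  obtain ⟨B, rfl⟩ : ∃ B', formCls B' = B := Quotient.exists_rep B
  rw [lineCls_eq hc, ← formCls_sum, ← formCls_sum] at h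
  exact formCls_eq_of_lineForm_sum_eq hc h

/-- Witt's cancellation theorem. -/
theorem FormClass.add_left_cancel {A B C : FormClass k} (h : C + A = C + B) : A = B := by
  obtain ⟨n, w, hw, rfl⟩ := exists_eq_sum_lineCls C
  induction n with
  | zero => simpa using h
  | succ n ih =>
    rw [Fin.sum_univ_succ, add_assoc, add_assoc] at h
    exact ih _ (fun i => hw _) (lineCls_add_cancel (hw 0) h)

/-- Equality in the Grothendieck group means equality after adding a common form, which Witt
cancellation removes. Identities computed in `GW` thus become isometries. -/
theorem of_injective : Function.Injective (of : FormClass k →+ GW k) := by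
  intro A B h
  change AddLocalization.mk A 0 = AddLocalization.mk B 0 at h
  rw [AddLocalization.mk_eq_mk_iff, AddLocalization.r_iff_exists] at h
  obtain ⟨C, hC⟩ := h
  refine FormClass.add_left_cancel (C := C.1) ?_
  simpa using hC

end GrothendieckWitt


namespace GrothendieckWitt

open Algebra.GrothendieckAddGroup (of lift)

universe v₁

variable {k : Type v₁} [Field k]

/-! ### Represented elements -/

/-- The value `c` is taken by the forms of a class. -/
def FormClass.Represents (C : FormClass k) (c : k) : Prop :=
  Quotient.lift (fun A : RegularForm k => ∃ y, A.Q y = c) (by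
    rintro A B ⟨e⟩
    refine propext ⟨fun ⟨y, hy⟩ => ⟨e y, (e.map_app y).trans hy⟩, fun ⟨y, hy⟩ => ⟨e.symm y, ?_⟩⟩
    exact (e.symm.map_app y).trans hy) C

theorem FormClass.represents_add {C D : FormClass k} {c : k} :
    (C + D).Represents c ↔ ∃ y z, C.Represents y ∧ D.Represents z ∧ c = y + z := by
  obtain ⟨A, rfl⟩ : ∃ A, formCls A = C := Quotient.exists_rep C
  obtain ⟨B, rfl⟩ : ∃ B, formCls B = D := Quotient.exists_rep D
  constructor
  · rintro ⟨⟨y, z⟩, h⟩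
    exact ⟨_, _, ⟨y, rfl⟩, ⟨z, rfl⟩, h.symm⟩
  · rintro ⟨_, _, ⟨y, rfl⟩, ⟨z, rfl⟩, rfl⟩
    exact ⟨(y, z), rfl⟩

theorem FormClass.represents_zero_iff {c : k} : (0 : FormClass k).Represents c ↔ c = 0 :=
  ⟨fun ⟨_, h⟩ => h.symm, fun h => ⟨PUnit.unit, h.symm⟩⟩

/-! ### Gram determinants -/

variable (k) in
/-- The group of square classes. -/
abbrev SquareClass : Type v₁ := kˣ ⧸ (powMonoidHom 2 : kˣ →* kˣ).range

/-- The Gram determinant of the polar form in a basis. -/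
noncomputable def RegularForm.gram (A : RegularForm k) {ι : Type*} [Fintype ι] [DecidableEq ι]
    (b : Module.Basis ι k A.V) : k :=
  (LinearMap.BilinForm.toMatrix b A.Q.polarBilin).det

theorem RegularForm.gram_ne_zero (A : RegularForm k) {ι : Type*} [Fintype ι] [DecidableEq ι]
    (b : Module.Basis ι k A.V) : A.gram b ≠ 0 := by
  rw [RegularForm.gram, ← LinearMap.BilinForm.nondegenerate_iff_det_ne_zero]
  refine ⟨A.regular, fun y h => A.regular y fun z => ?_⟩
  rw [QuadraticMap.polar_comm]
  exact h z

/-- The square class of the Gram determinant. -/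
noncomputable def RegularForm.disc (A : RegularForm k) {ι : Type*} [Fintype ι] [DecidableEq ι]
    (b : Module.Basis ι k A.V) : SquareClass k :=
  QuotientGroup.mk (Units.mk0 _ (A.gram_ne_zero b))

theorem squareClass_mk_eq {u v : kˣ} {w : k} (h : (u : k) = w ^ 2 * v) :
    (QuotientGroup.mk u : SquareClass k) = QuotientGroup.mk v := by
  have hw : w ≠ 0 := by
    rintro rfl
    exact u.ne_zero (by rw [h]; ring)
  rw [eq_comm, QuotientGroup.eq]
  refine ⟨Units.mk0 w hw, Units.ext ?_⟩
  change w ^ 2 = ((v⁻¹ : kˣ) : k) * u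
  rw [h, mul_left_comm, ← Units.val_mul, inv_mul_cancel, Units.val_one, mul_one]

/-- Transporting the basis along the isometry leaves the Gram matrix unchanged, and a change of
basis multiplies its determinant by the square of the transition determinant. -/
theorem RegularForm.disc_eq_of_isometry (A B : RegularForm k) {ι ι' : Type*} [Fintype ι]
    [DecidableEq ι] [Fintype ι'] [DecidableEq ι'] (b : Module.Basis ι k A.V)
    (b' : Module.Basis ι' k B.V) (e : A.V ≃ₗ[k] B.V) (he : ∀ y, B.Q (e y) = A.Q y) :
    A.disc b = B.disc b' := by
  let c : Module.Basis ι k B.V := b'.reindex (b'.indexEquiv (b.map e))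
  have h1 : A.gram b = B.gram (b.map e) := by
    refine congrArg Matrix.det (Matrix.ext fun i j => ?_)
    rw [LinearMap.BilinForm.toMatrix_apply, LinearMap.BilinForm.toMatrix_apply]
    simp only [QuadraticMap.polarBilin_apply_apply, QuadraticMap.polar, Module.Basis.map_apply,
      ← map_add, he]
  have h2 : B.gram c = B.gram b' := by
    rw [RegularForm.gram, RegularForm.gram,
      ← Matrix.det_submatrix_equiv_self (b'.indexEquiv (b.map e)).symm
        (LinearMap.BilinForm.toMatrix b' _)]
    refine congrArg Matrix.det (Matrix.ext fun i j => ?_)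
    simp [LinearMap.BilinForm.toMatrix_apply, c]
  have h3 := congrArg Matrix.det
    (LinearMap.BilinForm.toMatrix_mul_basis_toMatrix c (b.map e) B.Q.polarBilin)
  rw [Matrix.det_mul, Matrix.det_mul, Matrix.det_transpose] at h3
  refine squareClass_mk_eq (w := (c.toMatrix (b.map e)).det) ?_
  rw [Units.val_mk0, Units.val_mk0, h1, ← h2]
  change (LinearMap.BilinForm.toMatrix (b.map e) B.Q.polarBilin).det = _
  rw [← h3, RegularForm.gram]
  ring

variable [NeZero (2 : k)]

theorem represents_lineCls {c e : k} (hc : c ≠ 0) :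
    (lineCls c).Represents e ↔ ∃ y, e = c * y ^ 2 := by
  rw [lineCls_eq hc]
  constructor
  · rintro ⟨y, h⟩
    exact ⟨y, by rw [← h]; exact lineForm_apply c hc y⟩
  · rintro ⟨y, rfl⟩
    exact ⟨y, lineForm_apply c hc y⟩

theorem represents_nsmul_lineCls {c e : k} (hc : c ≠ 0) {n : ℕ}
    (h : (n • lineCls c).Represents e) : ∃ y : Fin n → k, e = c * ∑ i, y i ^ 2 := by
  induction n generalizing e with
  | zero =>
    rw [zero_smul, FormClass.represents_zero_iff] at h
    exact ⟨0, by simp [h]⟩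
  | succ n ih =>
    rw [succ_nsmul', FormClass.represents_add] at h
    obtain ⟨_, _, h1, h2, rfl⟩ := h
    obtain ⟨y, rfl⟩ := (represents_lineCls hc).mp h1
    obtain ⟨z, rfl⟩ := ih h2
    exact ⟨Fin.cons y z, by rw [Fin.sum_univ_succ]; simp [mul_add]⟩

/-- The class of the form `y ↦ c y²` in the Grothendieck–Witt ring, for `c ≠ 0`. -/
noncomputable def gw (c : k) : GW k := of (lineCls c)

theorem gw_mul_sq {c u : k} (hu : u ≠ 0) : gw (c * u ^ 2) = gw c := by
  by_cases hc : c = 0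
  · rw [hc, zero_mul]
  · have h : c * u ^ 2 ≠ 0 := mul_ne_zero hc (pow_ne_zero 2 hu)
    refine congrArg of ?_
    rw [lineCls_eq hc, lineCls_eq h]
    refine formCls_eq_of_linearMap (A := lineForm _ h) (B := lineForm c hc)
      (LinearMap.toSpanSingleton k k u) (fun y : k => ?_) rfl
    refine Eq.trans (lineForm_apply c hc _) (Eq.trans ?_ (lineForm_apply _ h y).symm)
    change c * (y * u) ^ 2 = c * u ^ 2 * y ^ 2
    ring

theorem gw_congr {c e u : k} (hu : u ≠ 0) (h : e = c * u ^ 2) : gw e = gw c := by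
  rw [h, gw_mul_sq hu]

/-- In the plane `⟨c, e⟩` the vector `(1, 1)` has length `c + e`, and `(e, -c)` is orthogonal to it
with length `ce(c + e)`. -/
theorem gw_add {c e : k} (hc : c ≠ 0) (he : e ≠ 0) (hce : c + e ≠ 0) :
    gw c + gw e = gw (c + e) + gw (c * e * (c + e)) := by
  simp only [gw, ← map_add]
  refine congrArg of ?_
  have h : c * e * (c + e) ≠ 0 := mul_ne_zero (mul_ne_zero hc he) hce
  rw [lineCls_eq hc, lineCls_eq he, ← formCls_sum]
  let A := (lineForm c hc).sum (lineForm e he)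
  have hA : ∀ p : k × k, A.Q p = c * p.1 ^ 2 + e * p.2 ^ 2 := fun p => by
    rw [← lineForm_apply c hc, ← lineForm_apply e he]
    rfl
  let b : Fin 2 → k × k := ![(1, 1), (e, -c)]
  have := formCls_eq_sum_of_orthogonal A (n := 2) (by
      change Module.finrank k (k × k) = 2
      simp) b
    ![c + e, c * e * (c + e)] (by
      intro i
      fin_cases i
      · exact hce
      · exact h) (by
      intro i
      fin_cases i
      · refine (hA _).trans ?_
        simp [b]
      · refine (hA _).trans ?_
        simp [b]
        ring) (by
      have h01 : QuadraticMap.polar A.Q (b 0) (b 1) = 0 := by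
        change A.Q (b 0 + b 1) - A.Q (b 0) - A.Q (b 1) = 0
        refine (congrArg₂ (· - ·) (congrArg₂ (· - ·) (hA _) (hA _)) (hA _)).trans ?_
        change c * (1 + e) ^ 2 + e * (1 + -c) ^ 2 - (c * 1 ^ 2 + e * 1 ^ 2) -
          (c * e ^ 2 + e * (-c) ^ 2) = 0
        ring
      intro i j hij
      fin_cases i <;> fin_cases j
      · exact (hij rfl).elim
      · exact h01
      · exact (QuadraticMap.polar_comm _ _ _).trans h01
      · exact (hij rfl).elim)
  rw [this, Fin.sum_univ_two]
  rfl

/-- A binary form that represents `c ≠ 0` splits off the line of `c`. -/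
theorem gw_add_gw_eq {u v y z c : k} (hu : u ≠ 0) (hv : v ≠ 0) (hc : c ≠ 0)
    (h : c = u * y ^ 2 + v * z ^ 2) : gw u + gw v = gw c + gw (u * v * c) := by
  by_cases hy : y = 0
  · have hz : z ≠ 0 := by
      rintro rfl
      exact hc (by rw [h, hy]; ring)
    have h' : c = v * z ^ 2 := by rw [h, hy]; ring
    rw [gw_congr hz h', add_comm]
    congr 1
    exact (gw_congr (u := v * z) (mul_ne_zero hv hz) (by rw [h']; ring)).symm
  by_cases hz : z = 0
  · have h' : c = u * y ^ 2 := by rw [h, hz]; ring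
    rw [gw_congr hy h']
    congr 1
    exact (gw_congr (u := u * y) (mul_ne_zero hu hy) (by rw [h']; ring)).symm
  rw [← gw_mul_sq (c := u) hy, ← gw_mul_sq (c := v) hz,
    gw_add (mul_ne_zero hu (pow_ne_zero 2 hy)) (mul_ne_zero hv (pow_ne_zero 2 hz)) (h ▸ hc), ← h]
  congr 1
  exact gw_congr (u := y * z) (mul_ne_zero hy hz) (by ring)

/-- A hyperbolic plane represents every element, in particular `1`: here `y` and `z` solve `c(y -
z)(y + z) = 1` with `y - z = 1` and `y + z = 1/c`. The complementary entry is `-c²`. -/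
theorem gw_add_gw_neg {c : k} (hc : c ≠ 0) : gw c + gw (-c) = gw 1 + gw (-1) := by
  have h2 : (2 : k) ≠ 0 := NeZero.ne 2
  rw [gw_add_gw_eq (y := (1 + c) / (2 * c)) (z := (1 - c) / (2 * c)) (c := (1 : k)) hc
    (neg_ne_zero.mpr hc) one_ne_zero (by field_simp; ring)]
  congr 1
  exact gw_congr hc (by ring)

/-- This is the passage from `GW` to arithmetic: by `of_injective` the equation is an isometry, and
the line of `c` takes the value `c` at `1`. -/
theorem represents_of_gw {C D : FormClass k} {c : k} (hc : c ≠ 0) (h : of C = gw c + of D) :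
    C.Represents c := by
  rw [gw, ← map_add] at h
  rw [of_injective h]
  exact FormClass.represents_add.mpr ⟨c, 0, (represents_lineCls hc).mpr ⟨1, by ring⟩, by
    obtain ⟨A, rfl⟩ : ∃ A, formCls A = D := Quotient.exists_rep D
    exact ⟨0, map_zero A.Q⟩, by ring⟩

/-! ### Sums of `2 ^ n` squares -/

theorem IsSumOfSquares.add {K : Type*} [Field K] {m n : ℕ} {α β : K}
    (h : IsSumOfSquares m α) (h' : IsSumOfSquares n β) : IsSumOfSquares (m + n) (α + β) := by
  obtain ⟨f, rfl⟩ := h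
  obtain ⟨g, rfl⟩ := h'
  exact ⟨Fin.append f g, by simp [Fin.sum_univ_add]⟩

theorem isSumOfSquares_add_iff {K : Type*} [Field K] {m n : ℕ} {α : K} :
    IsSumOfSquares (m + n) α ↔
      ∃ β γ : K, IsSumOfSquares m β ∧ IsSumOfSquares n γ ∧ α = β + γ := by
  constructor
  · rintro ⟨f, rfl⟩
    exact ⟨_, _, ⟨_, rfl⟩, ⟨_, rfl⟩, Fin.sum_univ_add _⟩
  · rintro ⟨β, γ, hβ, hγ, rfl⟩
    exact hβ.add hγ

theorem isSumOfSquares_zero {K : Type*} [Field K] (n : ℕ) : IsSumOfSquares n (0 : K) :=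
  ⟨0, by simp⟩

theorem IsSumOfSquares.mono {K : Type*} [Field K] {m n : ℕ} (hmn : m ≤ n) {α : K}
    (h : IsSumOfSquares m α) : IsSumOfSquares n α := by
  obtain ⟨d, rfl⟩ := Nat.exists_eq_add_of_le hmn
  simpa using h.add (isSumOfSquares_zero d)

theorem IsSumOfSquares.map {K L : Type*} [Field K] [Field L] (f : K →+* L) {n : ℕ} {α : K}
    (h : IsSumOfSquares n α) : IsSumOfSquares n (f α) := by
  obtain ⟨g, rfl⟩ := h
  exact ⟨fun i => f (g i), by simp⟩

theorem isSumOfSquares_one_iff {K : Type*} [Field K] {α : K} :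
    IsSumOfSquares 1 α ↔ ∃ y, α = y ^ 2 :=
  ⟨fun ⟨f, h⟩ => ⟨f 0, by simpa using h⟩, fun ⟨y, h⟩ => ⟨fun _ => y, by simpa using h⟩⟩

theorem isSumOfSquares_two_iff {K : Type*} [Field K] {α : K} :
    IsSumOfSquares 2 α ↔ ∃ y z, α = y ^ 2 + z ^ 2 :=
  ⟨fun ⟨f, h⟩ => ⟨f 0, f 1, by rw [h, Fin.sum_univ_two]⟩,
    fun ⟨y, z, h⟩ => ⟨![y, z], by simpa [Fin.sum_univ_two] using h⟩⟩

/-- The `2 ^ n`-fold multiple of `⟨1⟩` is a round form. -/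
theorem nsmul_gw_mul {n : ℕ} {α : k} (hα : α ≠ 0) (h : IsSumOfSquares (2 ^ n) α) {β : k}
    (hβ : β ≠ 0) : 2 ^ n • gw (α * β) = 2 ^ n • gw β := by
  induction n generalizing α β with
  | zero =>
    obtain ⟨y, rfl⟩ := isSumOfSquares_one_iff.mp h
    have hy : y ≠ 0 := by
      rintro rfl
      simp at hα
    rw [gw_congr (c := β) hy (by ring)]
  | succ n ih =>
    rw [pow_succ, mul_two, isSumOfSquares_add_iff] at h
    obtain ⟨A, B, hA, hB, rfl⟩ := h
    rw [pow_succ, mul_two, add_smul, add_smul]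
    by_cases hA0 : A = 0
    · subst hA0
      rw [zero_add] at hα ⊢
      rw [ih hα hB hβ]
    by_cases hB0 : B = 0
    · subst hB0
      rw [add_zero] at hα ⊢
      rw [ih hα hA hβ]
    have hαβ := mul_ne_zero hα hβ
    -- This is `gw_add` up to the square `β²`. After multiplication by `2 ^ n` the induction
    -- hypothesis strips the factors `A` and `B` from every term.
    have h1 : gw (A * β) + gw (B * β) = gw ((A + B) * β) + gw (A * (B * ((A + B) * β))) := by
      rw [gw_add (mul_ne_zero hA0 hβ) (mul_ne_zero hB0 hβ) (by rwa [← add_mul]), ← add_mul]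
      congr 1
      exact gw_congr hβ (by ring)
    have h2 := congrArg (2 ^ n • ·) h1
    simp only [smul_add] at h2
    rw [ih hA0 hA hβ, ih hB0 hB hβ, ih hA0 hA (mul_ne_zero hB0 hαβ), ih hB0 hB hαβ] at h2
    exact h2.symm

theorem nsmul_gw_eq_of_isSumOfSquares {n : ℕ} {α : k} (hα : α ≠ 0)
    (h : IsSumOfSquares (2 ^ n) α) : 2 ^ n • gw α = 2 ^ n • gw (1 : k) := by
  simpa using nsmul_gw_mul hα h one_ne_zero

/-- The left-hand form represents `cα`, hence so does `n • ⟨c⟩`, whose values are `c` times sums of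
`n` squares. -/
theorem isSumOfSquares_of_nsmul_gw_eq {n : ℕ} (hn : n ≠ 0) {α c : k} (hα : α ≠ 0) (hc : c ≠ 0)
    (h : n • gw (c * α) = n • gw c) : IsSumOfSquares n α := by
  obtain ⟨m, rfl⟩ := Nat.exists_eq_succ_of_ne_zero hn
  have h1 : of ((m + 1) • lineCls c) = gw (c * α) + of (m • lineCls (c * α)) := by
    rw [map_nsmul, map_nsmul]
    change (m + 1) • gw c = _
    rw [← h, succ_nsmul', gw]
  obtain ⟨y, hy⟩ := represents_nsmul_lineCls hc (represents_of_gw (mul_ne_zero hc hα) h1)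
  exact ⟨y, mul_left_cancel₀ hc hy⟩

/-- Pfister's theorem: by roundness, multiplication by `α` and by `β` does not change `2 ^ n • ⟨1⟩`,
so this form represents `αβ`. -/
theorem IsSumOfSquares.mul {n : ℕ} {α β : k} (hα : IsSumOfSquares (2 ^ n) α)
    (hβ : IsSumOfSquares (2 ^ n) β) : IsSumOfSquares (2 ^ n) (α * β) := by
  by_cases hα0 : α = 0
  · rw [hα0, zero_mul]
    exact isSumOfSquares_zero _
  by_cases hβ0 : β = 0
  · rw [hβ0, mul_zero]
    exact isSumOfSquares_zero _
  refine isSumOfSquares_of_nsmul_gw_eq (pow_ne_zero n two_ne_zero) (mul_ne_zero hα0 hβ0)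
    one_ne_zero ?_
  rw [one_mul, nsmul_gw_mul hα0 hα hβ0, nsmul_gw_eq_of_isSumOfSquares hβ0 hβ]

theorem tau_dvd_of_isSumOfSquares {K : Type*} [Field K] {α : K} {n : ℕ}
    (h : IsSumOfSquares (2 ^ n) α) : tau α ∣ 2 ^ n := by
  classical
  have h' : ∃ n : ℕ, IsSumOfSquares (2 ^ n) α := ⟨n, h⟩
  rw [tau, dif_pos h']
  exact pow_dvd_pow _ (Nat.find_min' h' h)

theorem tau_eq_zero_or {K : Type*} [Field K] (α : K) :
    (tau α = 0 ∧ ∀ n, ¬ IsSumOfSquares (2 ^ n) α) ∨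
      ∃ n, tau α = 2 ^ n ∧ IsSumOfSquares (2 ^ n) α := by
  classical
  by_cases h : ∃ n : ℕ, IsSumOfSquares (2 ^ n) α
  · right
    rw [tau, dif_pos h]
    exact ⟨_, rfl, Nat.find_spec h⟩
  · left
    rw [tau, dif_neg h]
    exact ⟨rfl, not_exists.mp h⟩

/-- The order of `⟨cα⟩ - ⟨c⟩` is the least power of `2` such that `α` is a sum of that many
squares. -/
theorem zsmul_gw_sub_eq_zero_iff {α c : k} (hα : α ≠ 0) (hc : c ≠ 0) (n : ℤ) :
    n • (gw (c * α) - gw c) = 0 ↔ (tau α : ℤ) ∣ n := by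
  have key : ∀ m : ℕ, IsSumOfSquares (2 ^ m) α → (2 ^ m : ℕ) • (gw (c * α) - gw c) = 0 := by
    intro m hm
    rw [smul_sub, mul_comm, nsmul_gw_mul hα hm hc, sub_self]
  constructor
  · intro h
    by_cases hn : n = 0
    · rw [hn]
      exact dvd_zero _
    have h1 : n.natAbs • (gw (c * α) - gw c) = 0 := by
      rw [← natCast_zsmul]
      rcases Int.natAbs_eq n with h' | h'
      · rw [← h', h]
      · rw [← neg_eq_zero, ← neg_smul, ← h', h]
    have h2 : IsSumOfSquares (2 ^ n.natAbs) α := by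
      refine IsSumOfSquares.mono n.natAbs.lt_two_pow_self.le
        (isSumOfSquares_of_nsmul_gw_eq (Int.natAbs_ne_zero.mpr hn) hα hc ?_)
      rwa [smul_sub, sub_eq_zero] at h1
    rcases tau_eq_zero_or α with ⟨-, h0⟩ | ⟨m, hm, hs⟩
    · exact (h0 _ h2).elim
    -- Both `|n|` and `2 ^ m` kill the element, hence so does their greatest common divisor `2 ^ j`.
    -- Then `α` is a sum of `2 ^ j` squares and `τ(α)` divides `2 ^ j`, which divides `n`.
    have h3 : (Nat.gcd n.natAbs (2 ^ m)) • (gw (c * α) - gw c) = 0 := by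
      rw [← addOrderOf_dvd_iff_nsmul_eq_zero] at h1 ⊢
      exact Nat.dvd_gcd h1 (addOrderOf_dvd_iff_nsmul_eq_zero.mpr (key m hs))
    obtain ⟨j, hj, hg⟩ := (Nat.dvd_prime_pow Nat.prime_two).mp (Nat.gcd_dvd_right n.natAbs (2 ^ m))
    rw [hg, smul_sub, sub_eq_zero] at h3
    have h4 := tau_dvd_of_isSumOfSquares
      (isSumOfSquares_of_nsmul_gw_eq (pow_ne_zero j two_ne_zero) hα hc h3)
    rw [← Int.dvd_natAbs, Int.natCast_dvd_natCast]
    exact h4.trans (hg ▸ Nat.gcd_dvd_left _ _)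
  · rintro ⟨j, rfl⟩
    rcases tau_eq_zero_or α with ⟨h0, -⟩ | ⟨m, hm, hs⟩
    · simp [h0]
    · rw [mul_comm, mul_smul, hm, natCast_zsmul, key m hs, smul_zero]

/-! ### Dimension and discriminant -/

/-- The dimension, as a map on the Grothendieck–Witt ring. -/
noncomputable def dimHom : GW k →+ ℤ :=
  lift
    { toFun := Quotient.lift (fun A : RegularForm k => (Module.finrank k A.V : ℤ)) (by
        rintro A B ⟨e⟩
        exact congrArg _ e.toLinearEquiv.finrank_eq)
      map_zero' := by
        change ((Module.finrank k PUnit.{v₁ + 1} : ℕ) : ℤ) = 0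
        rw [Module.finrank_zero_of_subsingleton, Nat.cast_zero]
      map_add' := by
        rintro ⟨A⟩ ⟨B⟩
        change ((Module.finrank k (A.V × B.V) : ℕ) : ℤ) = _
        rw [Module.finrank_prod, Nat.cast_add] }

theorem dimHom_gw {c : k} (hc : c ≠ 0) : dimHom (gw c) = 1 := by
  rw [gw, dimHom, Burnside.lift_of, lineCls_eq hc]
  change ((Module.finrank k k : ℕ) : ℤ) = 1
  simp

/-- The discriminant, as a map on the Grothendieck–Witt ring. -/
noncomputable def discHom : GW k →+ Additive (SquareClass k) :=
  lift (M := FormClass k)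
    { toFun := Quotient.lift
        (fun A : RegularForm k => Additive.ofMul (A.disc (Module.finBasis k A.V))) (by
        rintro A B ⟨e⟩
        exact congrArg _ (A.disc_eq_of_isometry B _ _ e.toLinearEquiv e.map_app))
      map_zero' := by
        change Additive.ofMul ((RegularForm.zero k).disc _) = 0
        have : IsEmpty (Fin (Module.finrank k (RegularForm.zero k).V)) := by
          have h : Module.finrank k (RegularForm.zero k).V = 0 :=
            Module.finrank_zero_of_subsingleton (M := PUnit.{v₁ + 1})
          rw [h]
          exact Fin.isEmpty
        refine congrArg Additive.ofMul (congrArg QuotientGroup.mk (Units.ext ?_))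
        exact Matrix.det_isEmpty
      map_add' := by
        rintro ⟨A⟩ ⟨B⟩
        change Additive.ofMul ((A.sum B).disc _) = Additive.ofMul (A.disc _) + Additive.ofMul _
        rw [← ofMul_mul]
        refine congrArg Additive.ofMul ?_
        let bA := Module.finBasis k A.V
        let bB := Module.finBasis k B.V
        rw [(A.sum B).disc_eq_of_isometry (A.sum B) _ (bA.prod bB) (LinearEquiv.refl k _)
          fun _ => rfl]
        refine congrArg QuotientGroup.mk (Units.ext ?_)
        let P : LinearMap.BilinForm k (A.V × B.V) := (A.sum B).Q.polarBilin
        have hP : ∀ p q, P p q = QuadraticMap.polar A.Q p.1 q.1 + QuadraticMap.polar B.Q p.2 q.2 :=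
          fun p q => QuadraticMap.polar_prod A.Q B.Q p q
        have : LinearMap.BilinForm.toMatrix (bA.prod bB) P =
            Matrix.fromBlocks (LinearMap.BilinForm.toMatrix bA A.Q.polarBilin) 0 0
              (LinearMap.BilinForm.toMatrix bB B.Q.polarBilin) := by
          refine Matrix.ext ?_
          rintro (i | i) (j | j) <;> rw [LinearMap.BilinForm.toMatrix_apply]
          all_goals
            simp [LinearMap.BilinForm.toMatrix_apply, hP]
        change (LinearMap.BilinForm.toMatrix (bA.prod bB) P).det = _
        rw [this, Matrix.det_fromBlocks_zero₂₁]
        rfl }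

/-- The discriminant is formed with the polar form, whose entry on the basis vector `1` is twice the
value `c`. -/
theorem discHom_gw {c : k} (hc : c ≠ 0) :
    discHom (gw c) = Additive.ofMul (QuotientGroup.mk (Units.mk0 (2 * c)
      (mul_ne_zero (NeZero.ne 2) hc)) : SquareClass k) := by
  rw [gw, discHom, Burnside.lift_of, lineCls_eq hc]
  change Additive.ofMul ((lineForm c hc).disc _) = _
  refine congrArg Additive.ofMul ?_
  let b : Module.Basis (Fin 1) k k := Module.Basis.singleton (Fin 1) k
  rw [(lineForm c hc).disc_eq_of_isometry (lineForm c hc) _ b (LinearEquiv.refl k _) fun _ => rfl]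
  refine congrArg QuotientGroup.mk (Units.ext ?_)
  change (LinearMap.BilinForm.toMatrix b (lineForm c hc).Q.polarBilin).det = 2 * c
  rw [Matrix.det_fin_one]
  refine (LinearMap.BilinForm.toMatrix_apply (M₁ := k) b (lineForm c hc).Q.polarBilin 0 0).trans ?_
  change (lineForm c hc).Q (b 0 + b 0) - (lineForm c hc).Q (b 0) - (lineForm c hc).Q (b 0) = _
  have h := lineForm_apply c hc
  refine (congrArg₂ (· - ·) (congrArg₂ (· - ·) (h _) (h _)) (h _)).trans ?_
  simp only [b, Module.Basis.singleton_apply]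
  ring

end GrothendieckWitt


/-! ### Diagonalisation by explicit vectors, and the shape of a cyclic quartic extension -/

namespace GrothendieckWitt

open Algebra.GrothendieckAddGroup (of lift)

universe v₁

section OrthogonalBases

variable {k : Type v₁} [Field k] [NeZero (2 : k)]

theorem of_formCls_eq_four (A : RegularForm k) (hn : Module.finrank k A.V = 4)
    {e₀ e₁ e₂ e₃ : A.V} {w₀ w₁ w₂ w₃ : k} (h₀ : w₀ ≠ 0) (h₁ : w₁ ≠ 0) (h₂ : w₂ ≠ 0) (h₃ : w₃ ≠ 0)
    (q₀ : A.Q e₀ = w₀) (q₁ : A.Q e₁ = w₁) (q₂ : A.Q e₂ = w₂) (q₃ : A.Q e₃ = w₃)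
    (h01 : QuadraticMap.polar A.Q e₀ e₁ = 0) (h02 : QuadraticMap.polar A.Q e₀ e₂ = 0)
    (h03 : QuadraticMap.polar A.Q e₀ e₃ = 0) (h12 : QuadraticMap.polar A.Q e₁ e₂ = 0)
    (h13 : QuadraticMap.polar A.Q e₁ e₃ = 0) (h23 : QuadraticMap.polar A.Q e₂ e₃ = 0) :
    of (formCls A) = gw w₀ + gw w₁ + gw w₂ + gw w₃ := by
  have hw : ∀ i, (![w₀, w₁, w₂, w₃] : Fin 4 → k) i ≠ 0 := by
    intro i
    fin_cases i <;> assumption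
  have hq : ∀ i, A.Q ((![e₀, e₁, e₂, e₃] : Fin 4 → A.V) i) =
      (![w₀, w₁, w₂, w₃] : Fin 4 → k) i := by
    intro i
    fin_cases i <;> assumption
  have ho : ∀ i j : Fin 4, i ≠ j → QuadraticMap.polar A.Q ((![e₀, e₁, e₂, e₃] : Fin 4 → A.V) i)
      ((![e₀, e₁, e₂, e₃] : Fin 4 → A.V) j) = 0 := by
    intro i j hij
    fin_cases i <;> fin_cases j <;>
      first
      | exact (hij rfl).elim
      | assumption
      | (rw [QuadraticMap.polar_comm]; assumption)
  rw [formCls_eq_sum_of_orthogonal A hn _ _ hw hq ho, map_sum, Fin.sum_univ_four]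
  rfl

theorem of_formCls_eq_two (A : RegularForm k) (hn : Module.finrank k A.V = 2)
    {e₀ e₁ : A.V} {w₀ w₁ : k} (h₀ : w₀ ≠ 0) (h₁ : w₁ ≠ 0)
    (q₀ : A.Q e₀ = w₀) (q₁ : A.Q e₁ = w₁) (h01 : QuadraticMap.polar A.Q e₀ e₁ = 0) :
    of (formCls A) = gw w₀ + gw w₁ := by
  have hw : ∀ i, (![w₀, w₁] : Fin 2 → k) i ≠ 0 := by
    intro i
    fin_cases i <;> assumption
  have hq : ∀ i, A.Q ((![e₀, e₁] : Fin 2 → A.V) i) = (![w₀, w₁] : Fin 2 → k) i := by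
    intro i
    fin_cases i <;> assumption
  have ho : ∀ i j : Fin 2, i ≠ j → QuadraticMap.polar A.Q ((![e₀, e₁] : Fin 2 → A.V) i)
      ((![e₀, e₁] : Fin 2 → A.V) j) = 0 := by
    intro i j hij
    fin_cases i <;> fin_cases j <;>
      first
      | exact (hij rfl).elim
      | assumption
      | (rw [QuadraticMap.polar_comm]; assumption)
  rw [formCls_eq_sum_of_orthogonal A hn _ _ hw hq ho, map_sum, Fin.sum_univ_two]
  rfl

theorem of_formCls_eq_one (A : RegularForm k) (hn : Module.finrank k A.V = 1)
    {e₀ : A.V} {w₀ : k} (h₀ : w₀ ≠ 0) (q₀ : A.Q e₀ = w₀) : of (formCls A) = gw w₀ := by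
  rw [formCls_eq_sum_of_orthogonal A hn (fun _ => e₀) (fun _ => w₀) (fun _ => h₀) (fun _ => q₀)
    fun i j hij => (hij (Subsingleton.elim i j)).elim, map_sum, Fin.sum_univ_one]
  rfl

end OrthogonalBases

/-- The trace is invariant under automorphisms, so here it equals its own negative. All
orthogonality relations below rest on this or on `trace_add_mul`. -/
theorem trace_eq_zero_of_map_eq_neg {k K : Type*} [Field k] [Field K] [Algebra k K]
    [NeZero (2 : k)] (φ : K ≃ₐ[k] K) {y : K} (h : φ y = -y) : Algebra.trace k K y = 0 := by
  have h1 := Algebra.trace_eq_of_algEquiv φ y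
  rw [h, map_neg] at h1
  have h2 : (2 : k) * Algebra.trace k K y = 0 := by linear_combination (-1 : k) * h1
  exact (mul_eq_zero.mp h2).resolve_left (NeZero.ne 2)

/-- A cyclic extension of degree `4` with a chosen generator, written as
`k(√Δ, √(x(Δ - a√Δ)))` with `Δ = a² + b²`. -/
structure CyclicQuartic (k K : Type v₁) [Field k] [Field K] [Algebra k K] where
  σ : K ≃ₐ[k] K
  s : K
  d : K
  Δ : k
  a : k
  b : k
  x : k
  a_ne : a ≠ 0
  b_ne : b ≠ 0
  x_ne : x ≠ 0
  s_ne : s ≠ 0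
  d_ne : d ≠ 0
  Δ_eq : Δ = a ^ 2 + b ^ 2
  s_sq : s ^ 2 = algebraMap k K Δ
  d_sq : d ^ 2 = algebraMap k K x * (algebraMap k K Δ - algebraMap k K a * s)
  σ_s : σ s = -s
  σ_σ_d : σ (σ d) = -d
  σ_pow_four : ∀ y, σ (σ (σ (σ y))) = y
  mem_of_fixed : ∀ y, σ y = y → ∃ c, algebraMap k K c = y
  finrank_eq : Module.finrank k K = 4

theorem two_ne_zero_of_algebra (k K : Type*) [Field k] [Field K] [Algebra k K] [NeZero (2 : k)] :
    (2 : K) ≠ 0 := fun h => NeZero.ne (2 : k)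
  ((algebraMap k K).injective (by rw [map_ofNat, map_zero, h]))

/-! ### The norm form of a cyclic quartic extension: the defect vanishes if and only if `-1` is a
norm -/

namespace CyclicQuartic

variable {k K : Type v₁} [Field k] [Field K] [Algebra k K] (D : CyclicQuartic k K)

theorem algebraMap_Δ : algebraMap k K D.Δ = algebraMap k K D.a ^ 2 + algebraMap k K D.b ^ 2 := by
  rw [D.Δ_eq, map_add, map_pow, map_pow]

theorem Δ_ne : D.Δ ≠ 0 := by
  intro h
  have := D.s_sq
  rw [h, map_zero] at this
  exact D.s_ne (pow_eq_zero_iff two_ne_zero |>.mp this)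

theorem Δ_ne_sq [NeZero (2 : k)] (c : k) : D.Δ ≠ c ^ 2 := by
  intro h
  have h1 := D.s_sq
  rw [h, map_pow, sq_eq_sq_iff_eq_or_eq_neg] at h1
  have h2 : D.σ D.s = D.s := by
    rcases h1 with h1 | h1 <;> simp [h1]
  rw [D.σ_s] at h2
  have h3 : 2 * D.s = 0 := by linear_combination (-1 : K) * h2
  exact (mul_ne_zero (two_ne_zero_of_algebra k K) D.s_ne) h3

theorem σ_σ_s : D.σ (D.σ D.s) = D.s := by rw [D.σ_s, map_neg, D.σ_s, neg_neg]

/-- The fixed points of `σ²` form `k(√Δ)`. -/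
theorem exists_eq_add_of_fixed [NeZero (2 : k)] {y : K} (hy : D.σ (D.σ y) = y) :
    ∃ p q : k, y = algebraMap k K p + algebraMap k K q * D.s := by
  have h2 : (2 : K) ≠ 0 := two_ne_zero_of_algebra k K
  have hs := D.s_ne
  obtain ⟨p, hp⟩ := D.mem_of_fixed ((y + D.σ y) / 2) (by
    rw [map_div₀, map_add, hy, map_ofNat, add_comm])
  obtain ⟨q, hq⟩ := D.mem_of_fixed ((y - D.σ y) / (2 * D.s)) (by
    rw [map_div₀, map_sub, hy, map_mul, map_ofNat, D.σ_s]
    field_simp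
    ring)
  refine ⟨p, q, ?_⟩
  rw [hp, hq]
  field_simp
  ring

theorem σ_add_mul (p q : k) : D.σ (algebraMap k K p + algebraMap k K q * D.s) =
    algebraMap k K p - algebraMap k K q * D.s := by
  rw [map_add, map_mul, AlgEquiv.commutes, AlgEquiv.commutes, D.σ_s]
  ring

theorem σ_σ_add_mul (p q : k) : D.σ (D.σ (algebraMap k K p + algebraMap k K q * D.s)) =
    algebraMap k K p + algebraMap k K q * D.s := by
  rw [σ_add_mul, map_sub, map_mul, AlgEquiv.commutes, AlgEquiv.commutes, D.σ_s]
  ring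

theorem σ_d_sq : D.σ D.d ^ 2 =
    algebraMap k K D.x * (algebraMap k K D.Δ + algebraMap k K D.a * D.s) := by
  rw [← map_pow, D.d_sq]
  simp only [map_mul, map_sub, AlgEquiv.commutes, D.σ_s]
  ring

theorem trace_add_mul [NeZero (2 : k)] (p q : k) :
    Algebra.trace k K (algebraMap k K p + algebraMap k K q * D.s) = 4 * p := by
  rw [map_add, Algebra.trace_algebraMap, D.finrank_eq, nsmul_eq_mul, Nat.cast_ofNat,
    trace_eq_zero_of_map_eq_neg D.σ (by
    rw [map_mul, AlgEquiv.commutes, D.σ_s, mul_neg]), add_zero]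

theorem trace_eq [NeZero (2 : k)] {y : K} (p q : k)
    (h : y = algebraMap k K p + algebraMap k K q * D.s) : Algebra.trace k K y = 4 * p := by
  rw [h, D.trace_add_mul]

/-- For `γ = p + q√Δ` with conjugate `γ'`, the product `γ · γ'√Δ = N(γ)√Δ` has trace `0`. So `1` and
`γ'√Δ` are orthogonal for `u ↦ tr(γu²)` on `k(√Δ)`; the next lemma gives the length of the second
vector. -/
theorem trace_mul_conj_mul [NeZero (2 : k)] (p q : k) :
    Algebra.trace k K ((algebraMap k K p + algebraMap k K q * D.s) *
      ((algebraMap k K p - algebraMap k K q * D.s) * D.s)) = 0 := by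
  rw [D.trace_eq 0 (p ^ 2 - D.Δ * q ^ 2), mul_zero]
  simp only [map_zero, map_sub, map_mul, map_pow, ← D.s_sq]
  ring

theorem trace_mul_conj_mul_sq [NeZero (2 : k)] (p q : k) :
    Algebra.trace k K ((algebraMap k K p + algebraMap k K q * D.s) *
      ((algebraMap k K p - algebraMap k K q * D.s) * D.s) ^ 2) =
      4 * (p * (D.Δ * (p ^ 2 - D.Δ * q ^ 2))) := by
  refine D.trace_eq _ (-(q * (D.Δ * (p ^ 2 - D.Δ * q ^ 2)))) ?_
  simp only [map_neg, map_sub, map_mul, map_pow, ← D.s_sq]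
  ring

/-- The elements of `k(√Δ) · d` have trace `0`. -/
theorem trace_eq_zero_of_anti [NeZero (2 : k)] {y : K} (h : D.σ (D.σ y) = -y) :
    Algebra.trace k K y = 0 :=
  trace_eq_zero_of_map_eq_neg (D.σ.trans D.σ) h

variable [NeZero (2 : k)]

/-- The difference of the trace forms of `[G/e]` and `[G/C₂] + 2`. -/
noncomputable def defect : GW k :=
  gw 1 + gw D.Δ + (gw D.x + gw D.x) - (gw 2 + gw (2 * D.Δ)) - (gw 1 + gw 1)

/-- Each of `2` and `Δ` is a sum of two squares, so the round form `2⟨1⟩` absorbs it. This identity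
and the next two carry all the `GW` arithmetic with the defect. -/
theorem gw_two_add : gw (2 : k) + gw 2 = gw 1 + gw 1 := by
  have h2 : (2 : k) ≠ 0 := NeZero.ne 2
  have := nsmul_gw_mul (n := 1) h2 (isSumOfSquares_two_iff.mpr ⟨1, 1, by norm_num⟩) one_ne_zero
  simpa [two_nsmul] using this

theorem gw_Δ_add : gw D.Δ + gw D.Δ = gw 1 + gw 1 := by
  have := nsmul_gw_mul (n := 1) D.Δ_ne (isSumOfSquares_two_iff.mpr ⟨_, _, D.Δ_eq⟩) one_ne_zero
  simpa [two_nsmul] using this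

theorem gw_two_mul_Δ_add : gw (2 * D.Δ) + gw (2 * D.Δ) = gw 1 + gw 1 := by
  have := nsmul_gw_mul (n := 1) D.Δ_ne (isSumOfSquares_two_iff.mpr ⟨_, _, D.Δ_eq⟩)
    (NeZero.ne (2 : k))
  rw [pow_one, two_nsmul, two_nsmul, gw_two_add, mul_comm] at this
  exact this

/-- Adding hyperbolic planes turns `defect = 0` into `⟨x, x, -Δ⟩ = ⟨1, 2Δ, -2⟩`, so the left-hand
form represents `1`. -/
theorem exists_one_add_eq_of_defect_eq_zero (h : D.defect = 0) :
    ∃ g h l : k, 1 + D.Δ * l ^ 2 = D.x * (g ^ 2 + h ^ 2) := by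
  have hΔ := D.Δ_ne
  have hx := D.x_ne
  have e1 := gw_two_add (k := k)
  have e2 := D.gw_Δ_add
  have e5 := gw_add_gw_neg (NeZero.ne (2 : k))
  have e6 := gw_add_gw_neg hΔ
  rw [defect] at h
  have h1 : of (lineCls D.x + lineCls D.x + lineCls (-D.Δ)) =
      gw 1 + of (lineCls (2 * D.Δ) + lineCls (-2)) := by
    simp only [map_add]
    change gw D.x + gw D.x + gw (-D.Δ) = gw 1 + (gw (2 * D.Δ) + gw (-2))
    linear_combination (norm := abel) h + e1 - e2 - e5 + e6
  have h3 := represents_of_gw one_ne_zero h1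
  simp only [FormClass.represents_add] at h3
  obtain ⟨_, _, ⟨_, _, hy1, hy2, rfl⟩, hy3, hy⟩ := h3
  obtain ⟨g, rfl⟩ := (represents_lineCls hx).mp hy1
  obtain ⟨h', rfl⟩ := (represents_lineCls hx).mp hy2
  obtain ⟨l, rfl⟩ := (represents_lineCls (neg_ne_zero.mpr hΔ)).mp hy3
  exact ⟨g, h', l, by linear_combination hy⟩

variable [FiniteDimensional k K] [Algebra.IsSeparable k K]

/-- The form `w ↦ tr(w · σ²w)`, the trace of the norm to `k(√Δ)` up to a factor. -/
noncomputable def normForm : RegularForm k where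
  V := K
  Q := LinearMap.BilinMap.toQuadraticMap
    ((Algebra.traceForm k K).compl₂ (D.σ.trans D.σ).toLinearMap)
  regular := fun y h => by
    refine (traceForm_nondegenerate k K).1 y fun z => ?_
    have h1 := h (D.σ.symm (D.σ.symm z))
    rw [LinearMap.BilinMap.polar_toQuadraticMap] at h1
    simp only [LinearMap.compl₂_apply, Algebra.traceForm_apply, AlgEquiv.toLinearMap_apply,
      AlgEquiv.trans_apply, AlgEquiv.apply_symm_apply] at h1
    have h2 : Algebra.trace k K (D.σ.symm (D.σ.symm z) * D.σ (D.σ y)) =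
        Algebra.trace k K (z * y) := by
      rw [← Algebra.trace_eq_of_algEquiv (D.σ.trans D.σ)]
      simp [D.σ_pow_four]
    rw [h2, mul_comm z y, ← two_mul] at h1
    exact (mul_eq_zero.mp h1).resolve_left (NeZero.ne 2)

theorem normForm_apply (y : K) :
    D.normForm.Q y = Algebra.trace k K (y * D.σ (D.σ y)) := rfl

theorem normForm_polar_eq_zero {y z : K} (h : Algebra.trace k K (y * D.σ (D.σ z)) = 0) :
    QuadraticMap.polar D.normForm.Q y z = 0 := by
  refine (LinearMap.BilinMap.polar_toQuadraticMap (x := y) (y := z)).trans ?_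
  change Algebra.trace k K (y * D.σ (D.σ z)) + Algebra.trace k K (z * D.σ (D.σ y)) = 0
  have h2 : Algebra.trace k K (z * D.σ (D.σ y)) = Algebra.trace k K (y * D.σ (D.σ z)) := by
    rw [← Algebra.trace_eq_of_algEquiv (D.σ.trans D.σ)]
    simp [D.σ_pow_four, mul_comm]
  rw [h2, h, add_zero]

/-- The basis `1, √Δ, d, σd` is orthogonal. As `σ²d = -d`, the last two entries are `-xΔ` up to
squares, and the factor `Δ`, a sum of two squares, disappears from the pair. -/
theorem of_normForm :
    of (formCls D.normForm) = gw 1 + gw D.Δ + gw (-D.x) + gw (-D.x) := by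
  have h2 : (2 : k) ≠ 0 := NeZero.ne 2
  have h4 : (4 : k) ≠ 0 := by
    rw [show (4 : k) = 2 * 2 by norm_num]
    exact mul_ne_zero h2 h2
  have hΔ := D.Δ_ne
  have hx := D.x_ne
  have hss := D.s_sq
  have hdd := D.d_sq
  have hσd3 : D.σ (D.σ (D.σ D.d)) = -D.σ D.d := by rw [D.σ_σ_d, map_neg]
  rw [of_formCls_eq_four D.normForm D.finrank_eq (e₀ := (1 : K)) (e₁ := D.s) (e₂ := D.d)
    (e₃ := D.σ D.d) (w₀ := 4) (w₁ := 4 * D.Δ) (w₂ := 4 * -(D.x * D.Δ)) (w₃ := 4 * -(D.x * D.Δ))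
    h4 (mul_ne_zero h4 hΔ) (mul_ne_zero h4 (neg_ne_zero.mpr (mul_ne_zero hx hΔ)))
    (mul_ne_zero h4 (neg_ne_zero.mpr (mul_ne_zero hx hΔ)))
    ((D.normForm_apply _).trans ((D.trace_eq 1 0 (by simp)).trans (by ring)))
    ((D.normForm_apply _).trans (D.trace_eq D.Δ 0 (by
      rw [D.σ_σ_s, ← sq, hss]
      simp)))
    ((D.normForm_apply _).trans (D.trace_eq _ (D.x * D.a) (by
      rw [D.σ_σ_d, mul_neg, ← sq, hdd]
      simp only [map_neg, map_mul]
      ring)))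
    ((D.normForm_apply _).trans (D.trace_eq _ (-(D.x * D.a)) (by
      rw [hσd3, mul_neg, ← sq, D.σ_d_sq]
      simp only [map_neg, map_mul]
      ring)))
    (D.normForm_polar_eq_zero (trace_eq_zero_of_map_eq_neg D.σ (by
      rw [D.σ_σ_s, one_mul, D.σ_s])))
    (D.normForm_polar_eq_zero (D.trace_eq_zero_of_anti (by
      simp only [map_mul, map_neg, map_one, D.σ_σ_d]
      ring)))
    (D.normForm_polar_eq_zero (D.trace_eq_zero_of_anti (by
      simp only [map_mul, map_neg, map_one, D.σ_σ_d]
      ring)))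
    (D.normForm_polar_eq_zero (D.trace_eq_zero_of_anti (by
      simp only [map_mul, map_neg, D.σ_σ_s, D.σ_σ_d]
      ring)))
    (D.normForm_polar_eq_zero (D.trace_eq_zero_of_anti (by
      simp only [map_mul, map_neg, D.σ_σ_s, D.σ_σ_d]
      ring)))
    (D.normForm_polar_eq_zero (trace_eq_zero_of_map_eq_neg D.σ (by
      simp only [map_mul, map_neg, D.σ_σ_d]
      ring)))]
  have e1 : gw (4 : k) = gw 1 := gw_congr h2 (by norm_num)
  have e2 : gw (4 * D.Δ) = gw D.Δ := gw_congr h2 (by ring)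
  have e3 : gw (4 * -(D.x * D.Δ)) = gw (-D.x * D.Δ) := gw_congr h2 (by ring)
  have hsum : IsSumOfSquares (2 ^ 1) D.Δ := isSumOfSquares_two_iff.mpr ⟨D.a, D.b, D.Δ_eq⟩
  have e4 := nsmul_gw_mul hΔ hsum (neg_ne_zero.mpr hx)
  rw [pow_one, two_nsmul, two_nsmul, mul_comm D.Δ] at e4
  rw [e1, e2, e3, add_assoc, e4, ← add_assoc]

/-- Comparison of the norm form with its multiple by a norm. -/
theorem transfer {β : K} {p q f : k} (hf : f ≠ 0)
    (hβ : β * D.σ (D.σ β) = algebraMap k K p + algebraMap k K q * D.s)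
    (hpq : p ^ 2 - D.Δ * q ^ 2 = -f ^ 2) :
    p ≠ 0 ∧ gw p + gw (-(p * D.Δ)) + (gw 1 + gw (-1)) =
      gw 1 + gw D.Δ + gw (-D.x) + gw (-D.x) := by
  have h2 : (2 : k) ≠ 0 := NeZero.ne 2
  have h4 : (4 : k) ≠ 0 := by
    rw [show (4 : k) = 2 * 2 by norm_num]
    exact mul_ne_zero h2 h2
  have hΔ := D.Δ_ne
  have hx := D.x_ne
  have hss := D.s_sq
  have hdd := D.d_sq
  -- For `p = 0` the norm equation would make `Δ = (f/q)²` a square.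
  have hp : p ≠ 0 := by
    rintro rfl
    have hq : q ≠ 0 := by
      rintro rfl
      exact hf (by simpa using hpq)
    exact D.Δ_ne_sq (f / q) (by
      field_simp
      linear_combination (-1 : k) * hpq)
  refine ⟨hp, ?_⟩
  -- These are the coordinates of `α = -γd²`. On vectors `βud` with `u ∈ k(√Δ)` the norm form is
  -- `tr(αu²)`.
  set p' : k := -(p * D.x * D.Δ) + q * D.x * D.a * D.Δ with hp'
  set q' : k := p * D.x * D.a - q * D.x * D.Δ with hq'
  set γ : K := algebraMap k K p + algebraMap k K q * D.s with hγ
  have hα : -(γ * D.d ^ 2) = algebraMap k K p' + algebraMap k K q' * D.s := by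
    rw [hdd, hp', hq', hγ]
    simp only [map_add, map_sub, map_mul, map_neg]
    linear_combination (algebraMap k K q * algebraMap k K D.x * algebraMap k K D.a) * hss
  -- `N(α) = N(γ)N(d²)` with `N(d²) = x²Δ(Δ - a²) = x²Δb²`. So `N(α)` is `-Δ` up to squares, which
  -- forces the plane `u ↦ tr(αu²)` to be hyperbolic.
  have hN : p' ^ 2 - D.Δ * q' ^ 2 = -(D.Δ * (f * D.x * D.b) ^ 2) := by
    have : p' ^ 2 - D.Δ * q' ^ 2 =
        (p ^ 2 - D.Δ * q ^ 2) * (D.x ^ 2 * D.Δ * (D.Δ - D.a ^ 2)) := by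
      rw [hp', hq']
      ring
    rw [this, hpq]
    linear_combination (-f ^ 2 * D.x ^ 2 * D.Δ) * D.Δ_eq
  have hg : f * D.x * D.b ≠ 0 := mul_ne_zero (mul_ne_zero hf hx) D.b_ne
  have hval : ∀ e e' : K, D.σ (D.σ e) = e' →
      D.normForm.Q (β * e) = Algebra.trace k K (γ * (e * e')) := by
    rintro e _ rfl
    rw [normForm_apply]
    refine congrArg _ ?_
    rw [map_mul, map_mul, ← hβ]
    ring
  have hpol : ∀ e e' e'' : K, D.σ (D.σ e') = e'' → Algebra.trace k K (γ * (e * e'')) = 0 →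
      QuadraticMap.polar D.normForm.Q (β * e) (β * e') = 0 := by
    rintro e e' _ rfl h
    refine D.normForm_polar_eq_zero (Eq.trans (congrArg _ ?_) h)
    rw [map_mul, map_mul, ← hβ]
    ring
  have hfix : ∀ p q : k, D.σ (D.σ ((algebraMap k K p - algebraMap k K q * D.s) * D.s)) =
      (algebraMap k K p - algebraMap k K q * D.s) * D.s := fun p q => by
    simp only [map_mul, map_sub, AlgEquiv.commutes, D.σ_σ_s]
  have hanti : ∀ p q p₁ q₁ : k, Algebra.trace k K (γ *
      ((algebraMap k K p + algebraMap k K q * D.s) *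
        ((algebraMap k K p₁ + algebraMap k K q₁ * D.s) * D.d))) = 0 := fun p q p₁ q₁ => by
    refine D.trace_eq_zero_of_anti ?_
    simp only [hγ, map_mul, map_add, AlgEquiv.commutes, D.σ_σ_s, D.σ_σ_d]
    ring
  have e4 : ∀ c : k, gw (4 * c) = gw c := fun c => gw_congr h2 (by ring)
  -- Compute the norm form on `β` times a basis. The vectors `1` and `γ'√Δ` contribute `⟨p, -pΔ⟩`;
  -- vectors `u₁d` and `u₂d`, with `uᵢ = pᵢ + qᵢ√Δ` orthogonal for `tr(αu²)`, contribute a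
  -- hyperbolic plane `⟨c, -c⟩`. It remains to choose `u₁` and `u₂`.
  have key : ∀ (p₁ q₁ p₂ q₂ c : k), c ≠ 0 →
      Algebra.trace k K ((algebraMap k K p' + algebraMap k K q' * D.s) *
        (algebraMap k K p₁ + algebraMap k K q₁ * D.s) ^ 2) = 4 * c →
      (∃ g : k, g ≠ 0 ∧ Algebra.trace k K ((algebraMap k K p' + algebraMap k K q' * D.s) *
        (algebraMap k K p₂ + algebraMap k K q₂ * D.s) ^ 2) = 4 * -(c * g ^ 2)) →
      Algebra.trace k K ((algebraMap k K p' + algebraMap k K q' * D.s) *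
        ((algebraMap k K p₁ + algebraMap k K q₁ * D.s) *
          (algebraMap k K p₂ + algebraMap k K q₂ * D.s))) = 0 →
      gw p + gw (-(p * D.Δ)) + (gw 1 + gw (-1)) = gw 1 + gw D.Δ + gw (-D.x) + gw (-D.x) := by
    rintro p₁ q₁ p₂ q₂ c hc ht₁ ⟨g, hg0, ht₂⟩ ht₃
    have hσ : ∀ p q : k, D.σ (D.σ ((algebraMap k K p + algebraMap k K q * D.s) * D.d)) =
        -((algebraMap k K p + algebraMap k K q * D.s) * D.d) := fun p q => by
      simp only [map_mul, map_add, AlgEquiv.commutes, D.σ_σ_s, D.σ_σ_d]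
      ring
    have hpΔ : p * D.Δ * f ^ 2 ≠ 0 := mul_ne_zero (mul_ne_zero hp hΔ) (pow_ne_zero 2 hf)
    have hcg : c * g ^ 2 ≠ 0 := mul_ne_zero hc (pow_ne_zero 2 hg0)
    rw [← of_normForm D, of_formCls_eq_four D.normForm D.finrank_eq (w₀ := 4 * p)
      (w₁ := 4 * -(p * D.Δ * f ^ 2)) (w₂ := 4 * c) (w₃ := 4 * -(c * g ^ 2))
      (mul_ne_zero h4 hp) (mul_ne_zero h4 (neg_ne_zero.mpr hpΔ)) (mul_ne_zero h4 hc)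
      (mul_ne_zero h4 (neg_ne_zero.mpr hcg))
      ((hval 1 1 (by simp)).trans (D.trace_eq p q (by rw [mul_one, mul_one])))
      ((hval _ _ (hfix p q)).trans (by
        rw [← sq, D.trace_mul_conj_mul_sq, hpq]
        ring))
      ((hval _ _ (hσ p₁ q₁)).trans (by
        rw [← ht₁, ← hα]
        congr 1
        ring))
      ((hval _ _ (hσ p₂ q₂)).trans (by
        rw [← ht₂, ← hα]
        congr 1
        ring))
      (hpol _ _ _ (hfix p q) (by
        rw [one_mul]
        exact D.trace_mul_conj_mul p q))
      (hpol _ _ _ (hσ p₁ q₁) (by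
        have := hanti (-1) 0 p₁ q₁
        rw [← this]
        congr 2
        simp only [map_neg, map_one, map_zero]
        ring))
      (hpol _ _ _ (hσ p₂ q₂) (by
        have := hanti (-1) 0 p₂ q₂
        rw [← this]
        congr 2
        simp only [map_neg, map_one, map_zero]
        ring))
      (hpol _ _ _ (hσ p₁ q₁) (by
        have := hanti (q * D.Δ) (-p) p₁ q₁
        rw [← this]
        congr 2
        simp only [map_neg, map_mul, ← hss]
        ring))
      (hpol _ _ _ (hσ p₂ q₂) (by
        have := hanti (q * D.Δ) (-p) p₂ q₂
        rw [← this]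
        congr 2
        simp only [map_neg, map_mul, ← hss]
        ring))
      (hpol _ _ _ (hσ p₂ q₂) (by
        rw [← ht₃, ← hα]
        congr 1
        ring)),
      e4, e4, e4, e4, add_assoc (gw p + _), gw_congr (e := -(p * D.Δ * f ^ 2)) (c := -(p * D.Δ)) hf (by ring),
      gw_congr (e := -(c * g ^ 2)) (c := -c) hg0 (by ring),
      gw_add_gw_neg hc]
  -- The general choice is `u₁ = 1` and `u₂ = α'√Δ`, where `α'` is the conjugate of `α`. When `p' =
  -- 0` the vector `1` is isotropic, and `1 ± √Δ` serve instead.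
  by_cases hp0 : p' = 0
  · have hq0 : q' ≠ 0 := by
      intro hq0
      rw [hp0, hq0] at hN
      exact mul_ne_zero hΔ (pow_ne_zero 2 hg) (by linear_combination hN)
    refine key 1 1 1 (-1) (2 * q' * D.Δ) (mul_ne_zero (mul_ne_zero h2 hq0) hΔ) ?_
      ⟨1, one_ne_zero, ?_⟩ ?_
    · refine D.trace_eq _ (q' * (1 + D.Δ)) ?_
      simp only [hp0, map_zero, map_one, map_mul, map_add, map_ofNat, ← hss]
      ring
    · refine D.trace_eq _ (q' * (1 + D.Δ)) ?_
      simp only [hp0, map_zero, map_one, map_neg, map_mul, map_add, map_ofNat, map_pow, ← hss]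
      ring
    · refine (D.trace_eq 0 (q' * (1 - D.Δ)) ?_).trans (mul_zero _)
      simp only [hp0, map_zero, map_one, map_neg, map_mul, map_sub, ← hss]
      ring
  · have hconj : algebraMap k K (-(q' * D.Δ)) + algebraMap k K p' * D.s =
        (algebraMap k K p' - algebraMap k K q' * D.s) * D.s := by
      simp only [map_neg, map_mul, ← hss]
      ring
    refine key 1 0 (-(q' * D.Δ)) p' p' hp0 ?_ ⟨D.Δ * (f * D.x * D.b), mul_ne_zero hΔ hg, ?_⟩ ?_
    · refine D.trace_eq _ q' ?_
      simp only [map_zero, map_one]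
      ring
    · rw [hconj, D.trace_mul_conj_mul_sq, hN]
      ring
    · rw [hconj, map_one, map_zero, zero_mul, add_zero, one_mul, D.trace_mul_conj_mul]

/-- The partial norm `γ = β · σ²β = p + q√Δ` has norm `-1`, so `transfer` applies with `f = 1`. It
remains to recognise `⟨p, -pΔ⟩` as `⟨-2, 2Δ⟩` and to rearrange. -/
theorem defect_eq_zero_of_norm {β : K} (hβ : β * D.σ β * D.σ (D.σ β) * D.σ (D.σ (D.σ β)) = -1) :
    D.defect = 0 := by
  have h2 : (2 : k) ≠ 0 := NeZero.ne 2
  obtain ⟨p, q, hγ⟩ := D.exists_eq_add_of_fixed (y := β * D.σ (D.σ β)) (by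
    rw [map_mul, map_mul, D.σ_pow_four, mul_comm])
  have hpq : p ^ 2 - D.Δ * q ^ 2 = -1 ^ 2 := by
    apply (algebraMap k K).injective
    have h1 := congrArg D.σ hγ
    rw [D.σ_add_mul, map_mul] at h1
    simp only [map_sub, map_mul, map_pow, map_neg, map_one, ← D.s_sq]
    linear_combination hβ - D.σ β * D.σ (D.σ (D.σ β)) * hγ -
      (algebraMap k K p + algebraMap k K q * D.s) * h1
  obtain ⟨hp, ht⟩ := D.transfer one_ne_zero hγ hpq
  -- With `p² - Δq² = -1` one finds `-2(p - 1)² + 2Δq² = 4p`, so `⟨-2, 2Δ⟩` represents `p` up to a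
  -- square.
  have hN : gw (-2 : k) + gw (2 * D.Δ) = gw p + gw (-(p * D.Δ)) := by
    rw [gw_add_gw_eq (y := p - 1) (z := q) (c := 2 ^ 2 * p) (neg_ne_zero.mpr h2)
      (mul_ne_zero h2 D.Δ_ne) (mul_ne_zero (pow_ne_zero 2 h2) hp) (by linear_combination (2 : k) * hpq)]
    rw [gw_congr (c := p) h2 (mul_comm _ _)]
    congr 1
    exact gw_congr (u := 2 ^ 2) (pow_ne_zero 2 h2) (by ring)
  have e1 := gw_two_add (k := k)
  have e2 := D.gw_Δ_add
  have e3 := D.gw_two_mul_Δ_add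
  have e4 := gw_add_gw_neg D.x_ne
  have e5 := gw_add_gw_neg h2
  rw [defect]
  rw [← hN] at ht
  linear_combination (norm := abel) e4 + e4 + ht - e5 + e2 - e3

/-- The solution of `1 + Δl² = x(g² + h²)` yields an element of norm `-f²` with `f ∈ k`. Applying
`transfer` to it and comparing with `defect = 0` shows that `f` is a norm from `k(√Δ)`, which allows
the factor `f²` to be removed. -/
theorem exists_norm_of_defect_eq_zero (h : D.defect = 0) :
    ∃ β, β * D.σ β * D.σ (D.σ β) * D.σ (D.σ (D.σ β)) = -1 := by
  have h2 : (2 : k) ≠ 0 := NeZero.ne 2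
  have hΔ := D.Δ_ne
  have hx := D.x_ne
  have ha := D.a_ne
  have hb := D.b_ne
  have hss := D.s_sq
  have e1 := gw_two_add (k := k)
  have e2 := D.gw_Δ_add
  have e3 := D.gw_two_mul_Δ_add
  have e4 := gw_add_gw_neg D.x_ne
  have e5 := gw_add_gw_neg h2
  obtain ⟨g, h', l, hE⟩ := D.exists_one_add_eq_of_defect_eq_zero h
  rw [defect] at h
  -- The element `w` is chosen so that `(a + √Δ) · w · σ²w` is rational. Because `(a + √Δ)d² =
  -- xb²√Δ`, the coefficient of `√Δ` in it is `(y₀ + ay₁)² + b²y₁² - xb²(1 + Δl²)`. This vanishes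
  -- for `y₁ = xh'` and `y₀ + ay₁ = bxg`. The constant term is `bf`.
  set y₀ : k := D.b * D.x * g - D.a * D.x * h' with hy₀
  set y₁ : k := D.x * h' with hy₁
  set w : K := (algebraMap k K y₀ + algebraMap k K y₁ * D.s) +
    (algebraMap k K 1 + algebraMap k K l * D.s) * D.d with hw
  set f : k := (D.a * (y₀ ^ 2 + D.Δ * y₁ ^ 2) + 2 * y₀ * y₁ * D.Δ -
    2 * D.x * D.b ^ 2 * D.Δ * l) / D.b with hf
  have hσσw : D.σ (D.σ w) = (algebraMap k K y₀ + algebraMap k K y₁ * D.s) -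
      (algebraMap k K 1 + algebraMap k K l * D.s) * D.d := by
    rw [hw]
    simp only [map_add, map_mul, AlgEquiv.commutes, D.σ_σ_s, D.σ_σ_d]
    ring
  have hbK : algebraMap k K D.b ≠ 0 := by simpa using hb
  have hsΔ := D.algebraMap_Δ
  rw [← hss] at hsΔ
  have hEK := congrArg (algebraMap k K) hE
  simp only [map_add, map_mul, map_pow, map_one, ← hss] at hEK
  have hfK : (algebraMap k K D.a + D.s) * (w * D.σ (D.σ w)) =
      algebraMap k K D.b * algebraMap k K f := by
    rw [← map_mul, hf, mul_div_cancel₀ _ hb, hσσw, hw]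
    have hdd := D.d_sq
    rw [← hss] at hdd
    simp only [hy₀, hy₁, map_add, map_sub, map_mul, map_pow, map_one, map_ofNat, ← hss]
    set A := algebraMap k K D.a
    set B := algebraMap k K D.b
    set X := algebraMap k K D.x
    set H := algebraMap k K h'
    set L := algebraMap k K l
    linear_combination (-X * D.s * (1 + L * D.s) ^ 2 + D.s * X ^ 2 * H ^ 2) * hsΔ -
      D.s * X * B ^ 2 * hEK - (A + D.s) * (1 + L * D.s) ^ 2 * hdd
  have hne : ∀ p q : k, algebraMap k K p + algebraMap k K q * D.s = 0 → p = 0 ∧ q = 0 := by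
    intro p q h
    have h3 := congrArg D.σ h
    rw [D.σ_add_mul, map_zero] at h3
    have h5 : (2 : K) ≠ 0 := two_ne_zero_of_algebra k K
    have h6 : 2 * algebraMap k K p = 0 := by linear_combination h + h3
    have h7 : 2 * D.s * algebraMap k K q = 0 := by linear_combination h - h3
    constructor
    · simpa [h5] using h6
    · simpa [h5, D.s_ne] using h7
  have hw0 : w ≠ 0 := by
    intro h0
    have h3 : D.σ (D.σ w) = 0 := by rw [h0, map_zero, map_zero]
    rw [hσσw] at h3
    rw [hw] at h0
    have h5 : 2 * ((algebraMap k K 1 + algebraMap k K l * D.s) * D.d) = 0 := by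
      linear_combination h0 - h3
    rw [mul_eq_zero, or_iff_right (two_ne_zero_of_algebra k K), mul_eq_zero,
      or_iff_left D.d_ne] at h5
    exact one_ne_zero (hne _ _ h5).1
  have hσw0 : D.σ (D.σ w) ≠ 0 := by simpa using hw0
  have hf0 : f ≠ 0 := by
    intro h0
    rw [h0, map_zero, mul_zero, mul_eq_zero, or_iff_left (mul_ne_zero hw0 hσw0)] at hfK
    exact one_ne_zero (hne D.a 1 (by rw [map_one, one_mul, hfK])).2
  have hfK0 : algebraMap k K f ≠ 0 := by simpa using hf0
  -- The partial norm of `f/w` is `f(a + √Δ)/b`, whose norm to `k` is `f²(a² - Δ)/b² = -f²`.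
  have hβ' : algebraMap k K f / w * D.σ (D.σ (algebraMap k K f / w)) =
      algebraMap k K (D.a * f / D.b) + algebraMap k K (f / D.b) * D.s := by
    simp only [map_div₀, map_mul, AlgEquiv.commutes]
    field_simp
    linear_combination -hfK
  obtain ⟨hp, ht⟩ := D.transfer hf0 hβ' (by
    field_simp
    rw [D.Δ_eq]
    ring)
  set p : k := D.a * f / D.b with hpdef
  -- Both `transfer` and `defect = 0` evaluate the norm form, and comparing them gives `⟨-2, 2Δ⟩ =
  -- ⟨p, -pΔ⟩`. Hence `p = -2y² + 2Δz²`.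
  have h1 : of (lineCls (-2) + lineCls (2 * D.Δ)) = gw p + of (lineCls (-(p * D.Δ))) := by
    rw [map_add]
    change gw (-2) + gw (2 * D.Δ) = gw p + gw (-(p * D.Δ))
    linear_combination (norm := abel) h - ht - e4 - e4 + e5 + e3 - e2
  obtain ⟨_, _, hy1, hy2, hy⟩ := FormClass.represents_add.mp (represents_of_gw hp h1)
  obtain ⟨y, rfl⟩ := (represents_lineCls (neg_ne_zero.mpr h2)).mp hy1
  obtain ⟨z, rfl⟩ := (represents_lineCls (mul_ne_zero h2 hΔ)).mp hy2
  -- The elements `n` and `m` of `k(√Δ)` have norms `-2a/b` and `-2p = -2af/b`, so `f` is the norm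
  -- of `m/n`.
  set n : K := algebraMap k K (D.a / D.b - 1) + algebraMap k K (1 / D.b) * D.s with hn
  have hnn : n * D.σ n = algebraMap k K (-2 * D.a / D.b) := by
    rw [hn, D.σ_add_mul]
    have : (D.a / D.b - 1) ^ 2 - D.Δ * (1 / D.b) ^ 2 = -2 * D.a / D.b := by
      field_simp
      rw [D.Δ_eq]
      ring
    rw [← this]
    simp only [map_sub, map_mul, map_pow, ← hss]
    ring
  have hn0 : n ≠ 0 := by
    intro h0
    rw [h0, zero_mul, eq_comm, map_eq_zero] at hnn
    exact div_ne_zero (mul_ne_zero (neg_ne_zero.mpr h2) ha) hb hnn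
  have hσn0 : D.σ n ≠ 0 := by simpa using hn0
  set m : K := algebraMap k K (2 * y) + algebraMap k K (2 * z) * D.s with hm
  have hmm : m * D.σ m = algebraMap k K (-2 * p) := by
    rw [hm, D.σ_add_mul, hy]
    simp only [map_add, map_mul, map_neg, map_pow, map_ofNat, ← hss]
    ring
  have hm0 : m ≠ 0 := by
    intro h0
    rw [h0, zero_mul, eq_comm, map_eq_zero] at hmm
    exact mul_ne_zero (neg_ne_zero.mpr h2) hp hmm
  have hσm0 : D.σ m ≠ 0 := by simpa using hm0
  have hfmn : algebraMap k K f * (n * D.σ n) = m * D.σ m := by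
    rw [hnn, hmm, ← map_mul, hpdef]
    congr 1
    field_simp
  have hσσm : D.σ (D.σ m) = m := D.σ_σ_add_mul _ _
  have hσσn : D.σ (D.σ n) = n := D.σ_σ_add_mul _ _
  have hββ := congrArg D.σ hβ'
  rw [map_mul, D.σ_add_mul] at hββ
  have hprod : algebraMap k K f / w * D.σ (D.σ (algebraMap k K f / w)) *
      (D.σ (algebraMap k K f / w) * D.σ (D.σ (D.σ (algebraMap k K f / w)))) =
      -algebraMap k K f ^ 2 := by
    rw [hβ', hββ]
    have : p ^ 2 - D.Δ * (f / D.b) ^ 2 = -f ^ 2 := by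
      rw [hpdef]
      field_simp
      rw [D.Δ_eq]
      ring
    rw [← map_pow, ← map_neg, ← this, map_sub, map_mul, map_pow, map_pow, ← hss]
    ring
  -- `N(f/w) = -f²`, while `n/m` lies in `k(√Δ)`, where its norm is `1/f`; its norm from `K` is
  -- therefore `1/f²`.
  refine ⟨algebraMap k K f / w * (n / m), ?_⟩
  simp only [map_mul]
  calc _ = (algebraMap k K f / w * D.σ (D.σ (algebraMap k K f / w)) *
      (D.σ (algebraMap k K f / w) * D.σ (D.σ (D.σ (algebraMap k K f / w))))) *
        ((n * D.σ n) / (m * D.σ m)) ^ 2 := by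
        simp only [map_div₀, hσσm, hσσn]
        field_simp
    _ = -1 := by
        rw [hprod, ← hfmn]
        field_simp

end CyclicQuartic

end GrothendieckWitt


namespace Burnside

open Algebra.GrothendieckAddGroup (of lift)

universe u₁

/-! ### Marks -/

section Marks

variable {H L : Type u₁} [Group H] [Group L]

/-- The number of points of a finite `H`-set fixed by a subgroup. -/
noncomputable def FinGSet.fixedCard (S : Subgroup H) (X : FinGSet H) : ℕ :=
  Nat.card {y : X // ∀ k ∈ S, k • y = y}

theorem FinGSet.fixedCard_congr (S : Subgroup H) {X Y : FinGSet H} (e : X ≃ Y)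
    (he : ∀ (g : H) (y : X), e (g • y) = g • e y) : X.fixedCard S = Y.fixedCard S := by
  refine Nat.card_congr (e.subtypeEquiv fun y => ?_)
  refine forall_congr' fun k => forall_congr' fun _ => ?_
  rw [← he, e.apply_eq_iff_eq]

/-- The mark homomorphism of a subgroup `S`: it takes `[X]` to the number of points of `X` that
are fixed by `S`. -/
noncomputable def mark (S : Subgroup H) : BurnsideRing H →+ ℤ :=
  lift
    { toFun := Quotient.lift (fun X : FinGSet H => (X.fixedCard S : ℤ)) (by
        rintro X Y ⟨e, he⟩
        exact congrArg _ (FinGSet.fixedCard_congr S e he))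
      map_zero' := by
        have : IsEmpty {y : FinGSet.empty H // ∀ k ∈ S, k • y = y} := ⟨fun y => y.1.elim⟩
        exact congrArg (Nat.cast : ℕ → ℤ) Nat.card_of_isEmpty
      map_add' := by
        rintro ⟨X⟩ ⟨Y⟩
        refine Eq.trans ?_ (Nat.cast_add (R := ℤ) (X.fixedCard S) (Y.fixedCard S))
        refine congrArg Nat.cast ?_
        refine Eq.trans (Nat.card_congr (Equiv.subtypeSum (α := X) (β := Y))) ?_
        rw [Nat.card_sum]
        refine congrArg₂ _ (Nat.card_congr (Equiv.subtypeEquivRight fun y => ?_))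
          (Nat.card_congr (Equiv.subtypeEquivRight fun y => ?_))
        · exact forall_congr' fun k => forall_congr' fun _ => Sum.inl_injective.eq_iff
        · exact forall_congr' fun k => forall_congr' fun _ => Sum.inr_injective.eq_iff }

theorem mark_mk (S : Subgroup H) (X : FinGSet H) :
    mark S (BurnsideRing.mk X) = X.fixedCard S :=
  lift_of _ _

theorem mark_one (S : Subgroup H) : mark S (1 : BurnsideRing H) = 1 := by
  refine (mark_mk S (FinGSet.point H)).trans ?_
  have : Unique {y : FinGSet.point H // ∀ k ∈ S, k • y = y} :=
    { default := ⟨PUnit.unit, fun _ _ => rfl⟩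
      uniq := fun y => Subtype.ext (Subsingleton.elim (α := PUnit) _ _) }
  rw [FinGSet.fixedCard, Nat.card_unique, Nat.cast_one]

theorem FinGSet.fixedCard_prod (S : Subgroup H) (X Y : FinGSet H) :
    (X.prod Y).fixedCard S = X.fixedCard S * Y.fixedCard S := by
  rw [FinGSet.fixedCard, FinGSet.fixedCard, FinGSet.fixedCard, ← Nat.card_prod]
  refine Nat.card_congr
    { toFun := fun p => (⟨p.1.1, fun k hk => congrArg Prod.fst (p.2 k hk)⟩,
        ⟨p.1.2, fun k hk => congrArg Prod.snd (p.2 k hk)⟩)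
      invFun := fun p => ⟨(p.1.1, p.2.1), fun k hk => Prod.ext (p.1.2 k hk) (p.2.2 k hk)⟩
      left_inv := fun _ => rfl
      right_inv := fun _ => rfl }

theorem mark_mul (S : Subgroup H) (z w : BurnsideRing H) :
    mark S (z * w) = mark S z * mark S w := by
  obtain ⟨X, X', rfl⟩ := z.exists_mk_sub_mk
  obtain ⟨Y, Y', rfl⟩ := w.exists_mk_sub_mk
  simp only [sub_mul, mul_sub, BurnsideRing.mk_mul, map_sub, mark_mk, FinGSet.fixedCard_prod,
    Nat.cast_mul]

/-- The mark of a subgroup as a ring homomorphism. -/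
noncomputable def markHom (S : Subgroup H) : BurnsideRing H →+* ℤ :=
  { mark S with
    map_one' := mark_one S
    map_mul' := mark_mul S }

theorem mark_resMap (φ : L →* H) (S : Subgroup L) (z : BurnsideRing H) :
    mark S (resMap φ z) = mark (S.map φ) z := by
  obtain ⟨X, Y, rfl⟩ := z.exists_mk_sub_mk
  have h : ∀ X : FinGSet H, (X.res φ).fixedCard S = X.fixedCard (S.map φ) := fun X => by
    refine Nat.card_congr (Equiv.subtypeEquivRight fun y => ?_)
    constructor
    · rintro hy _ ⟨k, hk, rfl⟩
      exact hy k hk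
    · exact fun hy k hk => hy _ ⟨k, hk, rfl⟩
  simp only [map_sub, resMap_mk, mark_mk, h]

/-- In a commutative group every point of `H ⧸ J` has stabilizer `J`, so `S` fixes all points or
none. -/
theorem fixedCard_coset [Finite H] (hH : ∀ g h : H, g * h = h * g) (S J : Subgroup H)
    [Decidable (S ≤ J)] :
    (FinGSet.coset J).fixedCard S = if S ≤ J then J.index else 0 := by
  have key : ∀ (k h : H), k • (h : H ⧸ J) = (h : H ⧸ J) ↔ k ∈ J := fun k h => by
    change ((k * h : H) : H ⧸ J) = h ↔ _
    rw [eq_comm, QuotientGroup.eq, hH k h, inv_mul_cancel_left]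
  split_ifs with hS
  · refine Nat.card_congr (Equiv.subtypeUnivEquiv fun y => ?_)
    obtain ⟨h, rfl⟩ := QuotientGroup.mk_surjective (s := J) y
    exact fun k hk => (key k h).mpr (hS hk)
  · have : IsEmpty {y : FinGSet.coset J // ∀ k ∈ S, k • y = y} := by
      refine ⟨fun y => hS fun k hk => ?_⟩
      obtain ⟨h, hh⟩ := QuotientGroup.mk_surjective (s := J) y.1
      have := y.2 k hk
      rw [← hh] at this
      exact (key k h).mp this
    exact Nat.card_of_isEmpty

/-! ### The additive generators of the Burnside ring -/

/-- Induction on the number of points, splitting off one orbit. Additive maps on the Burnside ring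
can then be compared on the classes `[H ⧸ J]`. -/
theorem BurnsideRing.mk_mem_closure_coset [Finite H] (X : FinGSet H) :
    BurnsideRing.mk X ∈ AddSubgroup.closure
      (Set.range fun J : Subgroup H => BurnsideRing.mk (FinGSet.coset J)) := by
  induction hn : Nat.card X using Nat.strong_induction_on generalizing X with
  | _ n ih =>
    rcases isEmpty_or_nonempty X with hX | ⟨⟨y⟩⟩
    · have : BurnsideRing.mk X = (0 : BurnsideRing H) :=
        (congrArg of (cls_eq (Y := FinGSet.empty H) ⟨fun y => hX.elim y, fun z => z.elim,
          fun y => hX.elim y, fun z => z.elim⟩ fun _ y => hX.elim y)).trans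
          (map_zero (of : GSetClass H →+ _))
      rw [this]
      exact zero_mem _
    · have hor : ∀ (g : H) (z : X), g • z ∈ MulAction.orbit H y ↔ z ∈ MulAction.orbit H y :=
        fun g z => by
          rw [← MulAction.orbit_eq_iff, MulAction.orbit_smul, MulAction.orbit_eq_iff]
      let B : FinGSet H :=
        { carrier := {z : X // z ∉ MulAction.orbit H y}
          action :=
            { smul := fun g z => ⟨g • z.1, fun h => z.2 ((hor g z.1).mp h)⟩
              one_smul := fun z => Subtype.ext (one_smul H z.1)
              mul_smul := fun g h z => Subtype.ext (mul_smul g h z.1) } }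
      have hsplit : cls X = cls (FinGSet.coset (MulAction.stabilizer H y)) + cls B := by
        refine cls_split X _ B (MulAction.ofQuotientStabilizer H y) Subtype.val ?_ ?_
          (MulAction.injective_ofQuotientStabilizer H y) Subtype.val_injective ?_ ?_
        · exact fun s q => MulAction.ofQuotientStabilizer_smul H y s q
        · exact fun _ _ => rfl
        · intro q z h
          exact z.2 (h ▸ MulAction.ofQuotientStabilizer_mem_orbit H y q)
        · intro z
          by_cases hz : z ∈ MulAction.orbit H y
          · obtain ⟨g, rfl⟩ := hz
            exact Or.inl ⟨((g : H) : H ⧸ MulAction.stabilizer H y), rfl⟩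
          · exact Or.inr ⟨⟨z, hz⟩, rfl⟩
      have hmk : BurnsideRing.mk X =
          BurnsideRing.mk (FinGSet.coset (MulAction.stabilizer H y)) + BurnsideRing.mk B :=
        (congrArg of hsplit).trans (map_add of _ _)
      rw [hmk]
      refine add_mem (AddSubgroup.subset_closure ⟨_, rfl⟩) (ih _ ?_ B rfl)
      rw [← hn]
      exact Finite.card_subtype_lt (x := y) fun h => h (MulAction.mem_orbit_self y)

theorem BurnsideRing.closure_coset [Finite H] :
    AddSubgroup.closure
      (Set.range fun J : Subgroup H => BurnsideRing.mk (FinGSet.coset J)) = ⊤ := by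
  refine (AddSubgroup.eq_top_iff' _).mpr fun z => ?_
  obtain ⟨X, Y, rfl⟩ := z.exists_mk_sub_mk
  exact sub_mem (mk_mem_closure_coset X) (mk_mem_closure_coset Y)

theorem BurnsideRing.addHom_ext [Finite H] {B : Type*} [AddGroup B] {f g : BurnsideRing H →+ B}
    (h : ∀ J : Subgroup H, f (BurnsideRing.mk (FinGSet.coset J)) =
      g (BurnsideRing.mk (FinGSet.coset J))) : f = g := by
  refine AddMonoidHom.eq_of_eqOn_dense closure_coset ?_
  rintro _ ⟨J, rfl⟩
  exact h J

theorem BurnsideRing.mk_coset_top [Finite H] :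
    BurnsideRing.mk (FinGSet.coset (⊤ : Subgroup H)) = 1 := by
  have : Unique (H ⧸ (⊤ : Subgroup H)) :=
    { default := ((1 : H) : H ⧸ (⊤ : Subgroup H))
      uniq := by
        rintro ⟨y⟩
        exact QuotientGroup.eq.mpr trivial }
  refine congrArg of (cls_eq (Y := FinGSet.point H)
    (Equiv.ofUnique (H ⧸ (⊤ : Subgroup H)) PUnit) fun _ _ => rfl)

/-! ### Transfers -/

theorem trMap_coset [Finite L] [Finite H] (φ : L →* H) (J : Subgroup L) :
    trMap φ (BurnsideRing.mk (FinGSet.coset J)) = BurnsideRing.mk (FinGSet.coset (J.map φ)) := by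
  rw [trMap_mk]
  refine congrArg of (cls_eq (X := FinGSet.ind φ (FinGSet.coset J))
    (Y := FinGSet.coset (J.map φ)) ⟨
      Quotient.lift (fun p : H × (L ⧸ J) => Quotient.liftOn' p.2
        (fun l => ((p.1 * φ l : H) : H ⧸ J.map φ)) ?_) ?_,
      Quotient.lift (fun h : H =>
        (Quotient.mk (FinGSet.indSetoid φ (FinGSet.coset J)) (h, ((1 : L) : L ⧸ J)))) ?_, ?_, ?_⟩ ?_)
  · intro l l' h
    rw [QuotientGroup.leftRel_apply] at h
    exact QuotientGroup.eq.mpr ⟨_, h, by simp [mul_assoc]⟩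
  · rintro ⟨h, q⟩ ⟨h', q'⟩ ⟨l, h1, h2⟩
    obtain ⟨m, rfl⟩ := QuotientGroup.mk_surjective q
    change h = h' * φ l at h1
    change ((l * m : L) : L ⧸ J) = q' at h2
    subst h1 h2
    change ((h' * φ l * φ m : H) : H ⧸ J.map φ) = ((h' * φ (l * m) : H) : H ⧸ J.map φ)
    rw [map_mul, mul_assoc]
  · rintro h h' hh
    obtain ⟨l, hl, he⟩ := QuotientGroup.leftRel_apply.mp hh
    refine Quotient.sound ⟨l⁻¹, ?_, ?_⟩
    · change h = h' * φ l⁻¹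
      rw [map_inv, he]
      simp
    · change ((l⁻¹ * 1 : L) : L ⧸ J) = ((1 : L) : L ⧸ J)
      exact QuotientGroup.eq.mpr (by simpa using hl)
  · rintro ⟨h, q⟩
    obtain ⟨m, rfl⟩ := QuotientGroup.mk_surjective q
    refine Quotient.sound ⟨m, rfl, ?_⟩
    change ((m * 1 : L) : L ⧸ J) = _
    rw [mul_one]
  · rintro ⟨h⟩
    change ((h * φ 1 : H) : H ⧸ J.map φ) = (h : H ⧸ J.map φ)
    rw [map_one, mul_one]
  · rintro g ⟨h, q⟩
    obtain ⟨m, rfl⟩ := QuotientGroup.mk_surjective q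
    change ((g * h * φ m : H) : H ⧸ J.map φ) = ((g * (h * φ m) : H) : H ⧸ J.map φ)
    rw [mul_assoc]

/-- The marks of a transfer between commutative groups. -/
theorem mark_trMap [Finite L] [Finite H] (hL : ∀ g h : L, g * h = h * g)
    (hH : ∀ g h : H, g * h = h * g) {φ : L →* H} (hφ : Function.Injective φ) (S : Subgroup H)
    [Decidable (S ≤ φ.range)] (z : BurnsideRing L) :
    mark S (trMap φ z) = if S ≤ φ.range then φ.range.index * mark (S.comap φ) z else 0 := by
  classical
  have hJ : ∀ J : Subgroup L, S ≤ J.map φ ↔ S ≤ φ.range ∧ S.comap φ ≤ J := fun J => by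
    constructor
    · refine fun h => ⟨h.trans (Subgroup.map_le_range φ J), fun l hl => ?_⟩
      obtain ⟨j, hj, he⟩ := h hl
      exact hφ he ▸ hj
    · rintro ⟨h1, h2⟩ k hk
      obtain ⟨l, rfl⟩ := h1 hk
      exact ⟨l, h2 hk, rfl⟩
  split_ifs with hS
  · refine DFunLike.congr_fun (BurnsideRing.addHom_ext (f := (mark S).comp (trMap φ))
      (g := (AddMonoidHom.mulLeft (φ.range.index : ℤ)).comp (mark (S.comap φ)))
      fun J => ?_) z
    simp only [AddMonoidHom.comp_apply, trMap_coset, mark_mk, fixedCard_coset hH,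
      fixedCard_coset hL, hJ, hS, true_and]
    change _ = (φ.range.index : ℤ) * _
    split_ifs
    · rw [Subgroup.index_map_of_injective J hφ, Nat.cast_mul, mul_comm]
    · simp
  · refine DFunLike.congr_fun (BurnsideRing.addHom_ext (f := (mark S).comp (trMap φ))
      (g := 0) fun J => ?_) z
    simp only [AddMonoidHom.comp_apply, trMap_coset, mark_mk, fixedCard_coset hH, hJ, hS,
      false_and, if_false]
    rfl

/-! ### Norms -/

theorem map_extendSub {M : Type*} {B C : Type*} [AddCommMonoid M] [AddCommGroup B]
    [AddCommGroup C] (f : B →+ C) (n : ℕ) (P : M → B) (y z : M) :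
    f (extendSub n P y z) = extendSub n (f ∘ P) y z := by
  have h : ∀ k : ℕ, f ∘ (fwdDiff z)^[k] P = (fwdDiff z)^[k] (f ∘ P) := fun k => by
    induction k with
    | zero => rfl
    | succ k ih =>
      rw [Function.iterate_succ_apply', Function.iterate_succ_apply', ← ih]
      exact funext fun a => map_sub f _ _
  rw [extendSub, extendSub, map_sum]
  refine Finset.sum_congr rfl fun k _ => ?_
  rw [map_zsmul, ← h]
  rfl

theorem extendSub_one {M : Type*} {B : Type*} [AddCommMonoid M] [AddCommGroup B] (P : M →+ B)
    (y z : M) : extendSub 1 P y z = P y - P z := by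
  simp [extendSub, Finset.sum_range_succ, fwdDiff]
  abel

/-- For a function of degree at most `2` this combination is the value at the formal difference `y -
z`. It serves for norms of index `2`. -/
theorem extendSub_two {M : Type*} {B : Type*} [AddCommMonoid M] [AddCommGroup B] (P : M → B)
    (y z : M) : extendSub 2 P y z = (3 : ℤ) • P y - (3 : ℤ) • P (y + z) + P (y + z + z) := by
  simp [extendSub, Finset.sum_range_succ, fwdDiff]
  abel

/-- The norm along the identity is the identity. -/
theorem normMap_id [Finite H] (z : BurnsideRing H) : normMap (MonoidHom.id H) z = z := by
  have hc : ∀ y : GSetClass H, coindClass (MonoidHom.id H) y = of y := fun y => by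
    obtain ⟨X, rfl⟩ := exists_cls y
    refine congrArg of (cls_eq (X := FinGSet.coind (MonoidHom.id H) X) (Y := X)
      ⟨fun f => f.1 1, fun w => ⟨fun h => h • w, fun l h => mul_smul l h w⟩,
        fun f => Subtype.ext (funext fun h => ?_), fun w => one_smul H w⟩ fun k f => ?_)
    · exact (f.2 h 1).symm.trans (congrArg f.1 (mul_one h))
    · have := f.2 k 1
      exact (congrArg f.1 ((one_mul k).trans (mul_one k).symm)).trans this
  obtain ⟨X, Y, rfl⟩ := z.exists_mk_sub_mk
  have hi : (MonoidHom.id H).range.index = 1 := by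
    rw [MonoidHom.range_eq_top.mpr Function.surjective_id, Subgroup.index_top]
  rw [normMap_sub, hi, show coindClass (MonoidHom.id H) = (of : GSetClass H →+ _) from funext hc]
  exact extendSub_one _ _ _

/-- Coinduction from a subgroup of index `2`. -/
noncomputable def coindEquiv [Finite H] {φ : L →* H} (hφ : Function.Injective φ)
    (h2 : φ.range.index = 2) {t : H} (ht : t ∉ φ.range) (X : FinGSet L) :
    FinGSet.coind φ X ≃ X × X :=
  Equiv.ofBijective (fun f => (f.1 1, f.1 t)) (by
    have hmem : ∀ h : H, h ∉ φ.range → h * t⁻¹ ∈ φ.range := fun h hh => by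
      rw [Subgroup.mul_mem_iff_of_index_two h2, inv_mem_iff]
      exact iff_of_false hh ht
    constructor
    · intro f f' hff
      obtain ⟨h1, h3⟩ := Prod.ext_iff.mp hff
      refine Subtype.ext (funext fun h => ?_)
      by_cases hh : h ∈ φ.range
      · obtain ⟨l, rfl⟩ := hh
        rw [← mul_one (φ l), f.2, f'.2]
        exact congrArg (l • ·) h1
      · obtain ⟨l, hl⟩ := hmem h hh
        rw [eq_mul_inv_iff_mul_eq] at hl
        rw [← hl, f.2, f'.2]
        exact congrArg (l • ·) h3
    · rintro ⟨y, z⟩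
      classical
      have hu : ∀ h : H, h ∈ φ.range → ∃ l, φ l = h := fun h hh => hh
      have hv : ∀ h : H, h ∉ φ.range → ∃ l, φ l * t = h := fun h hh => by
        obtain ⟨l, hl⟩ := hmem h hh
        exact ⟨l, by rw [hl, inv_mul_cancel_right]⟩
      choose! u hu using hu
      choose! v hv using hv
      let f : H → X := fun h => if h ∈ φ.range then u h • y else v h • z
      have f1 : ∀ l : L, f (φ l) = l • y := fun l => by
        have hh : φ l ∈ φ.range := ⟨l, rfl⟩
        simp only [f, if_pos hh, hφ (hu _ hh)]
      have f2 : ∀ l : L, f (φ l * t) = l • z := fun l => by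
        have hh : φ l * t ∉ φ.range := by
          rw [Subgroup.mul_mem_cancel_left _ (show φ l ∈ φ.range from ⟨l, rfl⟩)]
          exact ht
        simp only [f, if_neg hh, hφ (mul_right_cancel (hv _ hh))]
      refine ⟨⟨f, fun l h => ?_⟩, Prod.ext ?_ ?_⟩
      · by_cases hh : h ∈ φ.range
        · obtain ⟨m, rfl⟩ := hh
          rw [← map_mul, f1, f1, mul_smul]
        · rw [← hv h hh, ← mul_assoc, ← map_mul, f2, f2, mul_smul]
      · exact (congrArg f (map_one φ).symm).trans ((f1 1).trans (one_smul L y))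
      · have := f2 1
        rw [map_one, one_mul, one_smul] at this
        exact this)

/-- Evaluation at the coset representatives `1` and `t` identifies the coinduced set with `X × X`.
By commutativity `φ k` acts there diagonally as `k`. -/
theorem fixedCard_coind_map [Finite H] (hH : ∀ g h : H, g * h = h * g) {φ : L →* H}
    (hφ : Function.Injective φ) (h2 : φ.range.index = 2) (S : Subgroup L) (X : FinGSet L) :
    (FinGSet.coind φ X).fixedCard (S.map φ) = X.fixedCard S ^ 2 := by
  obtain ⟨t, ht⟩ : ∃ t : H, t ∉ φ.range := by
    by_contra! h
    rw [(Subgroup.eq_top_iff' _).mpr h, Subgroup.index_top] at h2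
    omega
  rw [sq, ← FinGSet.fixedCard_prod]
  refine Nat.card_congr ((coindEquiv hφ h2 ht X).subtypeEquiv fun f => ?_)
  have hk : ∀ k : L, φ k • f = f ↔ k • ((f.1 1, f.1 t) : X.prod X) = (f.1 1, f.1 t) := fun k => by
    have h1 : coindEquiv hφ h2 ht X (φ k • f) = k • ((f.1 1, f.1 t) : X.prod X) := by
      refine Prod.ext ?_ ?_
      · exact (congrArg f.1 (hH 1 (φ k))).trans (f.2 k 1)
      · exact (congrArg f.1 (hH t (φ k))).trans (f.2 k t)
    rw [← (coindEquiv hφ h2 ht X).apply_eq_iff_eq, h1]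
    rfl
  constructor
  · exact fun h k hk' => (hk k).mp (h _ ⟨k, hk', rfl⟩)
  · rintro h _ ⟨k, hk', rfl⟩
    exact (hk k).mpr (h k hk')

/-- A map fixed by all translations is constant, and equivariance makes its value a fixed point. -/
theorem fixedCard_coind_top [Finite H] (φ : L →* H) (X : FinGSet L) :
    (FinGSet.coind φ X).fixedCard ⊤ = X.fixedCard ⊤ := by
  have hconst : ∀ f : FinGSet.coind φ X, (∀ k ∈ (⊤ : Subgroup H), k • f = f) →
      ∀ h, f.1 h = f.1 1 := fun f hf h => by
    have h1 := congrArg (fun f : FinGSet.coind φ X => f.1 1) (hf h trivial)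
    exact (congrArg f.1 (one_mul h).symm).trans h1
  refine Nat.card_congr
    { toFun := fun f => ⟨f.1.1 1, fun l _ => ?_⟩
      invFun := fun y => ⟨⟨fun _ => y.1, fun l _ => (y.2 l trivial).symm⟩, fun _ _ => rfl⟩
      left_inv := fun f => ?_
      right_inv := fun _ => rfl }
  · exact (f.1.2 l 1).symm.trans (hconst f.1 f.2 _)
  · exact Subtype.ext (Subtype.ext (funext fun h => (hconst f.1 f.2 h).symm))

/-- On actual sets the mark is squared, and the extension to formal differences by `extendSub_two`
of a square is again the square. -/
theorem mark_normMap_map [Finite H] (hH : ∀ g h : H, g * h = h * g) {φ : L →* H}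
    (hφ : Function.Injective φ) (h2 : φ.range.index = 2) (S : Subgroup L) (z : BurnsideRing L) :
    mark (S.map φ) (normMap φ z) = mark S z ^ 2 := by
  obtain ⟨X, Y, rfl⟩ := z.exists_mk_sub_mk
  have hc : ∀ w : GSetClass L, mark (S.map φ) (coindClass φ w) = mark S (of w) ^ 2 := fun w => by
    obtain ⟨W, rfl⟩ := exists_cls w
    refine (mark_mk _ _).trans ?_
    rw [fixedCard_coind_map hH hφ h2, Nat.cast_pow]
    exact congrArg (· ^ 2) (mark_mk S W).symm
  have hadd : ∀ w w' : GSetClass L, mark S (of (w + w')) = mark S (of w) + mark S (of w') :=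
    fun w w' => (congrArg _ (map_add of w w')).trans (map_add (mark S) _ _)
  rw [normMap_sub, h2, map_extendSub, extendSub_two]
  simp only [Function.comp_apply, hc, hadd, map_sub]
  change _ = (mark S (of (cls X)) - mark S (of (cls Y))) ^ 2
  simp only [zsmul_eq_mul]
  push_cast
  ring

theorem mark_normMap_top [Finite H] {φ : L →* H} (h2 : φ.range.index = 2) (z : BurnsideRing L) :
    mark ⊤ (normMap φ z) = mark ⊤ z := by
  obtain ⟨X, Y, rfl⟩ := z.exists_mk_sub_mk
  have hc : ∀ w : GSetClass L, mark ⊤ (coindClass φ w) = mark ⊤ (of w) := fun w => by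
    obtain ⟨W, rfl⟩ := exists_cls w
    refine (mark_mk _ _).trans ?_
    rw [fixedCard_coind_top]
    exact (mark_mk ⊤ W).symm
  have hadd : ∀ w w' : GSetClass L, mark ⊤ (of (w + w')) = mark ⊤ (of w) + mark ⊤ (of w') :=
    fun w w' => (congrArg _ (map_add of w w')).trans (map_add (mark ⊤) _ _)
  rw [normMap_sub, h2, map_extendSub, extendSub_two]
  simp only [Function.comp_apply, hc, hadd, map_sub]
  change _ = mark ⊤ (of (cls X)) - mark ⊤ (of (cls Y))
  simp only [zsmul_eq_mul]
  push_cast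
  ring

end Marks

end Burnside


namespace Burnside

universe u₁

/-! ### Tambara ideals over a cyclic group of order four -/

section CyclicFour

variable {G : Type u₁} [Group G]

/-- The subgroup structure of a cyclic group of order `4` with subgroup `C₂` of order `2`. -/
structure IsMiddleSubgroup (C₂ : Subgroup G) : Prop where
  comm : ∀ g h : G, g * h = h * g
  card_eq : Nat.card G = 4
  card_two : Nat.card C₂ = 2
  eq_or : ∀ H : Subgroup G, H = ⊥ ∨ H = C₂ ∨ H = ⊤

theorem isMiddleSubgroup (hcyc : IsCyclic G) (hcard : Nat.card G = 4) {C₂ : Subgroup G}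
    (hC₂ : Nat.card C₂ = 2) : IsMiddleSubgroup C₂ := by
  have : Finite G := Nat.finite_of_card_ne_zero (by omega)
  have := Fintype.ofFinite G
  classical
  refine ⟨fun g h => (IsCyclic.commGroup (α := G)).mul_comm g h, hcard, hC₂, fun H => ?_⟩
  have hle : (({g | g ^ 2 = 1} : Finset G) : Set G).ncard ≤ 2 := by
    rw [Set.ncard_coe_finset]
    exact IsCyclic.card_pow_eq_one_le (by norm_num)
  -- A cyclic group has at most two solutions of `g² = 1`, so a subgroup of order `2` consists of
  -- exactly these.
  have key : ∀ J : Subgroup G, Nat.card J = 2 →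
      (J : Set G) = (({g | g ^ 2 = 1} : Finset G) : Set G) := fun J hJ => by
    refine Set.eq_of_subset_of_ncard_le (fun g hg => ?_) ?_
    · have : (⟨g, hg⟩ : J) ^ 2 = 1 := by
        rw [← hJ]
        exact pow_card_eq_one'
      simpa using congrArg Subtype.val this
    · rw [← Nat.card_coe_set_eq (J : Set G)]
      exact hle.trans hJ.ge
  have hd : Nat.card H ∣ 4 := hcard ▸ H.card_subgroup_dvd_card
  have hpos := Nat.le_of_dvd (by norm_num) hd
  interval_cases h : Nat.card H
  · omega
  · exact Or.inl (Subgroup.eq_bot_of_card_eq H h)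
  · exact Or.inr (Or.inl (SetLike.coe_injective ((key H h).trans (key C₂ hC₂).symm)))
  · omega
  · exact Or.inr (Or.inr (Subgroup.eq_top_of_card_eq H (h.trans hcard.symm)))

/-- The mark of `S` at level `G ⧸ H`. -/
noncomputable def levelMark (H S : Subgroup G) : BurnsideRing H →+* ℤ :=
  markHom (S.subgroupOf H)

theorem levelMark_eq (H S : Subgroup G) (z : BurnsideRing H) :
    levelMark H S z = mark (S.subgroupOf H) z := rfl

theorem levelMark_tambaraRes {L H S : Subgroup G} (h : L ≤ H) (hS : S ≤ L) (z : BurnsideRing H) :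
    levelMark L S (tambaraRes h z) = levelMark H S z := by
  rw [levelMark_eq, levelMark_eq, tambaraRes, mark_resMap]
  congr 1
  congr 1
  ext ⟨g, hg⟩
  constructor
  · rintro ⟨k, hk, he⟩
    rw [← he]
    exact hk
  · exact fun hk => ⟨⟨g, hS hk⟩, hk, rfl⟩

theorem levelMark_tambaraConj (hG : ∀ g h : G, g * h = h * g) (g : G) {H S : Subgroup G}
    (z : BurnsideRing H) :
    levelMark (H.map (MulAut.conj g).toMonoidHom) S (tambaraConj g H z) = levelMark H S z := by
  rw [levelMark_eq, levelMark_eq, tambaraConj, mark_resMap]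
  congr 1
  congr 1
  have hc : ∀ k, (MulAut.conj g).toMonoidHom k = k := fun k => by
    change g * k * g⁻¹ = k
    rw [hG g k, mul_inv_cancel_right]
  let ψ := H.equivMapOfInjective (MulAut.conj g).toMonoidHom (MulAut.conj g).injective
  have hψ : ∀ k, (ψ k : G) = k := fun k => hc k
  ext k
  constructor
  · rintro ⟨l, hl, rfl⟩
    change ((ψ.symm l : H) : G) ∈ S
    rw [← hψ, MulEquiv.apply_symm_apply]
    exact hl
  · refine fun hk => ⟨ψ k, ?_, ψ.symm_apply_apply k⟩
    change (ψ k : G) ∈ S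
    rw [hψ]
    exact hk

theorem IsMiddleSubgroup.index_eq {C₂ : Subgroup G} (hC : IsMiddleSubgroup C₂) : C₂.index = 2 := by
  have := C₂.card_mul_index
  rw [hC.card_two, hC.card_eq] at this
  omega

theorem IsMiddleSubgroup.not_le_bot {C₂ : Subgroup G} (hC : IsMiddleSubgroup C₂) : ¬ C₂ ≤ ⊥ := fun h => by
  have := hC.card_two
  rw [le_bot_iff.mp h, Subgroup.card_bot] at this
  omega

theorem IsMiddleSubgroup.not_top_le {C₂ : Subgroup G} (hC : IsMiddleSubgroup C₂) : ¬ ⊤ ≤ C₂ := fun h => by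
  have := hC.index_eq
  rw [top_le_iff.mp h, Subgroup.index_top] at this
  omega

theorem IsMiddleSubgroup.not_top_le_bot {C₂ : Subgroup G} (hC : IsMiddleSubgroup C₂) : ¬ (⊤ : Subgroup G) ≤ ⊥ := fun h => hC.not_le_bot (le_top.trans h)

variable [Finite G]

theorem orbitClass_self (H : Subgroup G) : orbitClass H H = 1 := by
  rw [orbitClass, Subgroup.subgroupOf_self]
  exact BurnsideRing.mk_coset_top

theorem closure_orbitClass (H : Subgroup G) :
    AddSubgroup.closure {z : BurnsideRing H | ∃ J ≤ H, z = orbitClass H J} = ⊤ := by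
  rw [eq_top_iff, ← BurnsideRing.closure_coset]
  refine AddSubgroup.closure_mono ?_
  rintro _ ⟨J, rfl⟩
  refine ⟨J.map H.subtype, Subgroup.map_subtype_le J, ?_⟩
  rw [orbitClass, Subgroup.subgroupOf, Subgroup.comap_map_eq_self_of_injective H.subtype_injective]

theorem levelMark_orbitClass (hG : ∀ g h : G, g * h = h * g) (H S J : Subgroup G) (hS : S ≤ H)
    [Decidable (S ≤ J)] :
    levelMark H S (orbitClass H J) = if S ≤ J then (J.relIndex H : ℤ) else 0 := by
  classical
  rw [levelMark_eq, orbitClass, mark_mk,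
    fixedCard_coset fun g h => Subtype.ext (hG g.1 h.1)]
  have : S.subgroupOf H ≤ J.subgroupOf H ↔ S ≤ J := by
    rw [← Subgroup.map_subtype_le_map_subtype, Subgroup.subgroupOf_map_subtype,
      Subgroup.subgroupOf_map_subtype, inf_of_le_left hS, le_inf_iff, and_iff_left hS]
  simp only [this]
  split_ifs <;> rfl

theorem levelMark_tambaraTr (hG : ∀ g h : G, g * h = h * g) {L H S : Subgroup G} (h : L ≤ H)
    (hS : S ≤ H) [Decidable (S ≤ L)] (z : BurnsideRing L) :
    levelMark H S (tambaraTr h z) = if S ≤ L then (L.relIndex H : ℤ) * levelMark L S z else 0 := by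
  classical
  have hr : (Subgroup.inclusion h).range = L.subgroupOf H := Subgroup.inclusion_range h
  have hSL : S.subgroupOf H ≤ L.subgroupOf H ↔ S ≤ L := by
    rw [← Subgroup.map_subtype_le_map_subtype, Subgroup.subgroupOf_map_subtype,
      Subgroup.subgroupOf_map_subtype, inf_of_le_left hS, inf_of_le_left h]
  rw [levelMark_eq, levelMark_eq, tambaraTr,
    mark_trMap (fun g h => Subtype.ext (hG g.1 h.1)) (fun g h => Subtype.ext (hG g.1 h.1))
      (Subgroup.inclusion_injective h)]
  simp only [hr, hSL]
  rfl

theorem tambaraNorm_self {H : Subgroup G} (h : H ≤ H) (z : BurnsideRing H) :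
    tambaraNorm h z = z := normMap_id z

theorem levelMark_tambaraNorm_of_le (hG : ∀ g h : G, g * h = h * g) {L H S : Subgroup G}
    (h : L ≤ H) (h2 : L.relIndex H = 2) (hS : S ≤ L) (z : BurnsideRing L) :
    levelMark H S (tambaraNorm h z) = levelMark L S z ^ 2 := by
  have hr : (Subgroup.inclusion h).range = L.subgroupOf H := Subgroup.inclusion_range h
  have hm : S.subgroupOf H = (S.subgroupOf L).map (Subgroup.inclusion h) := by
    ext ⟨g, hg⟩
    constructor
    · exact fun hk => ⟨⟨g, hS hk⟩, hk, rfl⟩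
    · rintro ⟨k, hk, he⟩
      rw [← he]
      exact hk
  rw [levelMark_eq, levelMark_eq, hm]
  exact mark_normMap_map (fun g h => Subtype.ext (hG g.1 h.1)) (Subgroup.inclusion_injective h)
    (hr ▸ h2) _ z

theorem levelMark_tambaraNorm_self {L H : Subgroup G} (h : L ≤ H) (h2 : L.relIndex H = 2)
    (z : BurnsideRing L) : levelMark H H (tambaraNorm h z) = levelMark L L z := by
  have hr : (Subgroup.inclusion h).range = L.subgroupOf H := Subgroup.inclusion_range h
  rw [levelMark_eq, levelMark_eq, Subgroup.subgroupOf_self, Subgroup.subgroupOf_self]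
  exact mark_normMap_top (hr ▸ h2) z

namespace IsMiddleSubgroup

variable {C₂ : Subgroup G}

theorem exists_eq_bot (z : BurnsideRing (⊥ : Subgroup G)) : ∃ m : ℤ, z = m := by
  have hz : z ∈ AddSubgroup.closure {z | ∃ J ≤ (⊥ : Subgroup G), z = orbitClass ⊥ J} := by
    rw [closure_orbitClass]
    trivial
  induction hz using AddSubgroup.closure_induction with
  | mem z h =>
    obtain ⟨J, hJ, rfl⟩ := h
    rw [le_bot_iff.mp hJ, orbitClass_self]
    exact ⟨1, Int.cast_one.symm⟩
  | zero => exact ⟨0, Int.cast_zero.symm⟩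
  | add z w _ _ hz hw =>
    obtain ⟨m, rfl⟩ := hz
    obtain ⟨m', rfl⟩ := hw
    exact ⟨m + m', (Int.cast_add _ _).symm⟩
  | neg z _ hz =>
    obtain ⟨m, rfl⟩ := hz
    exact ⟨-m, (Int.cast_neg _).symm⟩

theorem exists_eq_middle (hC : IsMiddleSubgroup C₂) (z : BurnsideRing C₂) : ∃ m n : ℤ, z = m + n * orbitClass C₂ ⊥ := by
  have hz : z ∈ AddSubgroup.closure {z | ∃ J ≤ C₂, z = orbitClass C₂ J} := by
    rw [closure_orbitClass]
    trivial
  induction hz using AddSubgroup.closure_induction with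
  | mem z h =>
    obtain ⟨J, hJ, rfl⟩ := h
    rcases hC.eq_or J with rfl | rfl | rfl
    · exact ⟨0, 1, by simp⟩
    · exact ⟨1, 0, by simp [orbitClass_self]⟩
    · exact (hC.not_top_le hJ).elim
  | zero => exact ⟨0, 0, by simp⟩
  | add z w _ _ hz hw =>
    obtain ⟨m, n, rfl⟩ := hz
    obtain ⟨m', n', rfl⟩ := hw
    exact ⟨m + m', n + n', by push_cast; ring⟩
  | neg z _ hz =>
    obtain ⟨m, n, rfl⟩ := hz
    exact ⟨-m, -n, by push_cast; ring⟩

theorem exists_eq_top (hC : IsMiddleSubgroup C₂) (z : BurnsideRing (⊤ : Subgroup G)) :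
    ∃ m n p : ℤ,
    z = m + n * orbitClass (⊤ : Subgroup G) C₂ + p * orbitClass (⊤ : Subgroup G) ⊥ := by
  have hz : z ∈ AddSubgroup.closure {z | ∃ J ≤ (⊤ : Subgroup G), z = orbitClass ⊤ J} := by
    rw [closure_orbitClass]
    trivial
  induction hz using AddSubgroup.closure_induction with
  | mem z h =>
    obtain ⟨J, hJ, rfl⟩ := h
    rcases hC.eq_or J with rfl | rfl | rfl
    · exact ⟨0, 0, 1, by simp⟩
    · exact ⟨0, 1, 0, by simp⟩
    · exact ⟨1, 0, 0, by simp [orbitClass_self]⟩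
  | zero => exact ⟨0, 0, 0, by simp⟩
  | add z w _ _ hz hw =>
    obtain ⟨m, n, p, rfl⟩ := hz
    obtain ⟨m', n', p', rfl⟩ := hw
    exact ⟨m + m', n + n', p + p', by push_cast; ring⟩
  | neg z _ hz =>
    obtain ⟨m, n, p, rfl⟩ := hz
    exact ⟨-m, -n, -p, by push_cast; ring⟩

theorem levelMark_middle_bot (hC : IsMiddleSubgroup C₂) : levelMark C₂ ⊥ (orbitClass C₂ ⊥) = 2 := by
  classical
  rw [levelMark_orbitClass hC.comm _ _ _ bot_le, if_pos le_rfl, Subgroup.relIndex_bot_left,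
    hC.card_two]
  rfl

theorem levelMark_middle_self (hC : IsMiddleSubgroup C₂) : levelMark C₂ C₂ (orbitClass C₂ ⊥) = 0 := by
  classical
  rw [levelMark_orbitClass hC.comm _ _ _ le_rfl, if_neg hC.not_le_bot]

theorem levelMark_top_bot_bot (hC : IsMiddleSubgroup C₂) : levelMark ⊤ ⊥ (orbitClass (⊤ : Subgroup G) ⊥) = 4 := by
  classical
  rw [levelMark_orbitClass hC.comm _ _ _ bot_le, if_pos le_rfl, Subgroup.relIndex_bot_left,
    Subgroup.card_top, hC.card_eq]
  rfl

theorem levelMark_top_bot (hC : IsMiddleSubgroup C₂) : levelMark ⊤ ⊥ (orbitClass (⊤ : Subgroup G) C₂) = 2 := by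
  classical
  rw [levelMark_orbitClass hC.comm _ _ _ bot_le, if_pos bot_le, Subgroup.relIndex_top_right,
    hC.index_eq]
  rfl

theorem levelMark_top_middle_bot (hC : IsMiddleSubgroup C₂) : levelMark ⊤ C₂ (orbitClass (⊤ : Subgroup G) ⊥) = 0 := by
  classical
  rw [levelMark_orbitClass hC.comm _ _ _ le_top, if_neg hC.not_le_bot]

theorem levelMark_top_middle (hC : IsMiddleSubgroup C₂) : levelMark ⊤ C₂ (orbitClass (⊤ : Subgroup G) C₂) = 2 := by
  classical
  rw [levelMark_orbitClass hC.comm _ _ _ le_top, if_pos le_rfl, Subgroup.relIndex_top_right,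
    hC.index_eq]
  rfl

theorem levelMark_top_top_bot (hC : IsMiddleSubgroup C₂) : levelMark ⊤ ⊤ (orbitClass (⊤ : Subgroup G) ⊥) = 0 := by
  classical
  rw [levelMark_orbitClass hC.comm _ _ _ le_top, if_neg hC.not_top_le_bot]

theorem levelMark_top_top (hC : IsMiddleSubgroup C₂) : levelMark ⊤ ⊤ (orbitClass (⊤ : Subgroup G) C₂) = 0 := by
  classical
  rw [levelMark_orbitClass hC.comm _ _ _ le_top, if_neg hC.not_top_le]

/-- The table of marks is triangular with nonzero diagonal, so marks determine an element.
Identities in the Burnside rings can then be checked numerically. -/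
theorem ext_middle (hC : IsMiddleSubgroup C₂) {z w : BurnsideRing C₂} (h₁ : levelMark C₂ ⊥ z = levelMark C₂ ⊥ w)
    (h₂ : levelMark C₂ C₂ z = levelMark C₂ C₂ w) : z = w := by
  obtain ⟨m, n, rfl⟩ := hC.exists_eq_middle z
  obtain ⟨m', n', rfl⟩ := hC.exists_eq_middle w
  simp only [map_add, map_mul, map_intCast, hC.levelMark_middle_bot, Int.cast_id,
    hC.levelMark_middle_self] at h₁ h₂
  obtain rfl : m = m' := by omega
  obtain rfl : n = n' := by omega
  rfl

theorem ext_top (hC : IsMiddleSubgroup C₂) {z w : BurnsideRing (⊤ : Subgroup G)} (h₁ : levelMark ⊤ ⊥ z = levelMark ⊤ ⊥ w)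
    (h₂ : levelMark ⊤ C₂ z = levelMark ⊤ C₂ w) (h₃ : levelMark ⊤ ⊤ z = levelMark ⊤ ⊤ w) :
    z = w := by
  obtain ⟨m, n, p, rfl⟩ := hC.exists_eq_top z
  obtain ⟨m', n', p', rfl⟩ := hC.exists_eq_top w
  simp only [map_add, map_mul, map_intCast, hC.levelMark_top_bot_bot, Int.cast_id,
    hC.levelMark_top_bot, hC.levelMark_top_middle_bot, hC.levelMark_top_middle,
    hC.levelMark_top_top_bot, hC.levelMark_top_top] at h₁ h₂ h₃
  obtain rfl : m = m' := by omega
  obtain rfl : n = n' := by omega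
  obtain rfl : p = p' := by omega
  rfl

/-- The marks of `m + n t + p u` at `⊤` and at `C₂` are `m` and `m + 2n`. This congruence is what
makes `markIdeal` stable under multiplication. -/
theorem two_dvd_levelMark_sub (hC : IsMiddleSubgroup C₂) (z : BurnsideRing (⊤ : Subgroup G)) :
    (2 : ℤ) ∣ levelMark ⊤ ⊤ z - levelMark ⊤ C₂ z := by
  obtain ⟨m, n, p, rfl⟩ := hC.exists_eq_top z
  simp only [map_add, map_mul, map_intCast, Int.cast_id, hC.levelMark_top_middle_bot,
    hC.levelMark_top_middle, hC.levelMark_top_top_bot, hC.levelMark_top_top]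
  omega

end IsMiddleSubgroup

end CyclicFour

end Burnside


/-! ### Tambara ideals defined by congruences between marks, and their generators -/

namespace Burnside

universe u₁

section MarkIdeal

variable {G : Type u₁} [Group G]

/-- The congruences between marks that define `markIdeal`. -/
def MarkCongruence (C₂ : Subgroup G) (n π : ℕ) (H : Subgroup G) (z : BurnsideRing H) : Prop :=
  -- For `z = m + q[C₂/e]` with `m + 2q = 0` the mark at `C₂` is `-2q`, so the middle condition says
  -- `n ∣ q`. For `z = m + q t + p u` at the top with `m + 2q + 4p = 0`, the mark at `C₂` is `-4p`
  -- and `2 · mark ⊤ - mark C₂` is `-4(q + p)`; the conditions say `π ∣ p` and `2 ∣ q + p`. The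
  -- hypotheses `C₂ ≤ H` and `⊤ ≤ H` treat the levels uniformly.
  levelMark H ⊥ z = 0 ∧ (C₂ ≤ H → (2 * n : ℤ) ∣ levelMark H C₂ z) ∧
    (⊤ ≤ H → (4 * π : ℤ) ∣ levelMark H C₂ z ∧ (8 : ℤ) ∣ 2 * levelMark H ⊤ z - levelMark H C₂ z)

variable [Finite G]

/-- The Tambara ideal cut out by congruences between marks. -/
noncomputable def markIdeal {C₂ : Subgroup G} (hC : IsMiddleSubgroup C₂) (n π : ℕ) (hn : 2 ∣ n)
    (hπ : π ∣ n) (hnπ : n ∣ 2 * π) : TambaraIdeal G where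
  level H :=
    { carrier := {z | MarkCongruence C₂ n π H z}
      zero_mem' := by simp [MarkCongruence]
      add_mem' := by
        rintro z w ⟨hz, hz', hz''⟩ ⟨hw, hw', hw''⟩
        refine ⟨by rw [map_add, hz, hw, add_zero], fun h => ?_, fun h => ⟨?_, ?_⟩⟩
        · rw [map_add]
          exact dvd_add (hz' h) (hw' h)
        · rw [map_add]
          exact dvd_add (hz'' h).1 (hw'' h).1
        · rw [map_add, map_add, mul_add, add_sub_add_comm]
          exact dvd_add (hz'' h).2 (hw'' h).2
      smul_mem' := by
        rintro c z ⟨hz, hz', hz''⟩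
        simp only [smul_eq_mul]
        refine ⟨by rw [map_mul, hz, mul_zero], fun h => ?_, fun h => ⟨?_, ?_⟩⟩
        · rw [map_mul]
          exact (hz' h).mul_left _
        · rw [map_mul]
          exact (hz'' h).1.mul_left _
        · obtain rfl := top_le_iff.mp h
          rw [map_mul, map_mul]
          -- Write `2c₁z₁ - c₂z₂ = c₁(2z₁ - z₂) + (c₁ - c₂)z₂`, with index `1` for the mark at `⊤`
          -- and `2` for the mark at `C₂`. The last product is divisible by `2 · 4π`.
          have h1 : (8 : ℤ) ∣ (levelMark ⊤ ⊤ c - levelMark ⊤ C₂ c) * levelMark ⊤ C₂ z := by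
            obtain ⟨r, hr⟩ := hC.two_dvd_levelMark_sub c
            obtain ⟨t, ht⟩ := (hz'' h).1
            rw [hr, ht]
            exact ⟨r * (π * t), by ring⟩
          have h2 := dvd_add ((hz'' h).2.mul_left (levelMark ⊤ ⊤ c)) h1
          rwa [show ∀ r t r' t' : ℤ, r * (2 * r' - t') + (r - t) * t' = 2 * (r * r') - t * t' from
            fun r t r' t' => by ring] at h2 }
  res_mem {L H} h := by
    rintro z ⟨hz, hz', hz''⟩
    refine ⟨by rwa [levelMark_tambaraRes h bot_le], fun hL => ?_, fun hL => ?_⟩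
    · rw [levelMark_tambaraRes h hL]
      exact hz' (hL.trans h)
    · rw [levelMark_tambaraRes h hL, levelMark_tambaraRes h (le_top.trans hL)]
      exact hz'' (hL.trans h)
  tr_mem {L H} h := by
    classical
    rintro z ⟨hz, hz', hz''⟩
    refine ⟨?_, fun hH => ?_, fun hH => ?_⟩
    · rw [levelMark_tambaraTr hC.comm h bot_le, hz, mul_zero, ite_self]
    · rw [levelMark_tambaraTr hC.comm h hH]
      split_ifs with hL
      · exact (hz' hL).mul_left _
      · exact dvd_zero _
    · obtain rfl := top_le_iff.mp hH
      rw [levelMark_tambaraTr hC.comm h le_top, levelMark_tambaraTr hC.comm h le_top]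
      rcases hC.eq_or L with rfl | rfl | rfl
      · rw [if_neg hC.not_le_bot, if_neg hC.not_top_le_bot]
        simp
      · rw [if_pos le_rfl, if_neg hC.not_top_le, Subgroup.relIndex_top_right, hC.index_eq]
        -- Transfer from `C₂` doubles the mark at `C₂`, giving `4nt`, and has mark `0` at `⊤`. Here
        -- `π ∣ n` and the parity of `n` enter.
        obtain ⟨t, ht⟩ := hz' le_rfl
        obtain ⟨a, rfl⟩ := hπ
        obtain ⟨b, hb⟩ := hn
        rw [ht]
        refine ⟨⟨a * t, by push_cast; ring⟩, ⟨-(b * t), ?_⟩⟩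
        rw [hb]
        push_cast
        ring
      · rw [if_pos le_top, if_pos le_rfl, Subgroup.relIndex_self, Nat.cast_one, one_mul, one_mul]
        exact hz'' le_rfl
  norm_mem {L H} h := by
    rintro z ⟨hz, hz', hz''⟩
    change MarkCongruence C₂ n π H _
    have h0 : MarkCongruence C₂ n π H (tambaraNorm h z - tambaraNorm h z) := by
      rw [sub_self]
      simp [MarkCongruence]
    rcases hC.eq_or L with rfl | rfl | rfl
    · obtain ⟨m, rfl⟩ := IsMiddleSubgroup.exists_eq_bot z
      rw [map_intCast, Int.cast_id] at hz
      subst hz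
      rwa [Int.cast_zero] at h0 ⊢
    · rcases hC.eq_or H with rfl | rfl | rfl
      · exact (hC.not_le_bot h).elim
      · rw [tambaraNorm_self, tambaraNorm_self, sub_zero]
        exact ⟨hz, hz', hz''⟩
      · have hi : L.relIndex ⊤ = 2 := by
          rw [Subgroup.relIndex_top_right, hC.index_eq]
        obtain ⟨t, ht⟩ := hz' le_rfl
        obtain ⟨a, ha⟩ := hπ
        obtain ⟨b, hb⟩ := hn
        -- The norm squares the mark `2nt` at `C₂` and keeps it at `⊤`. So the last congruence
        -- concerns `4nt - 4n²t²`, which is divisible by `8` for even `n`.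
        have h1 : levelMark ⊤ L (tambaraNorm h z - tambaraNorm h 0) = (2 * n * t) ^ 2 := by
          rw [map_sub, levelMark_tambaraNorm_of_le hC.comm h hi le_rfl,
            levelMark_tambaraNorm_of_le hC.comm h hi le_rfl, ht]
          simp
        refine ⟨?_, fun _ => ?_, fun _ => ⟨?_, ?_⟩⟩
        · rw [map_sub, levelMark_tambaraNorm_of_le hC.comm h hi bot_le,
            levelMark_tambaraNorm_of_le hC.comm h hi bot_le, hz]
          simp
        · rw [h1]
          exact ⟨t * (2 * n * t), by ring⟩
        · rw [h1]
          refine ⟨a * n * t ^ 2, ?_⟩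
          rw [show (n : ℤ) = π * a by exact_mod_cast ha]
          ring
        · rw [h1, map_sub, levelMark_tambaraNorm_self h hi, levelMark_tambaraNorm_self h hi, ht]
          refine ⟨b * t - 2 * (b * t) ^ 2, ?_⟩
          rw [show (n : ℤ) = 2 * b by exact_mod_cast hb, map_zero]
          ring
    · obtain rfl := top_le_iff.mp h
      rw [tambaraNorm_self, tambaraNorm_self, sub_zero]
      exact ⟨hz, hz', hz''⟩
  conj_mem g H := by
    rintro z ⟨hz, hz', hz''⟩
    refine ⟨?_, fun _ => ?_, fun _ => ⟨?_, ?_⟩⟩ <;>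
      simp only [levelMark_tambaraConj hC.comm]
    · exact hz
    all_goals
      rename_i hle
      have hH : H.map (MulAut.conj g).toMonoidHom = H := by
        have hc : (MulAut.conj g).toMonoidHom = MonoidHom.id G := by
          ext k
          change g * k * g⁻¹ = k
          rw [hC.comm g k, mul_inv_cancel_right]
        rw [hc, Subgroup.map_id]
      rw [hH] at hle
    · exact hz' hle
    · exact (hz'' hle).1
    · exact (hz'' hle).2

theorem mem_markIdeal {C₂ : Subgroup G} (hC : IsMiddleSubgroup C₂) {n π : ℕ} {hn : 2 ∣ n}
    {hπ : π ∣ n} {hnπ : n ∣ 2 * π} {H : Subgroup G} {z : BurnsideRing H} :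
    z ∈ (markIdeal hC n π hn hπ hnπ).level H ↔ MarkCongruence C₂ n π H z := Iff.rfl

theorem TambaraIdeal.mem_span_level {S : Set (Σ H : Subgroup G, BurnsideRing H)} {H : Subgroup G}
    {z : BurnsideRing H} : z ∈ (TambaraIdeal.span S).level H ↔
      ∀ I : TambaraIdeal G, (∀ s ∈ S, s.2 ∈ I.level s.1) → z ∈ I.level H := by
  change z ∈ (⨅ I : {I : TambaraIdeal G // ∀ s ∈ S, s.2 ∈ I.level s.1}, I.1.level H) ↔ _
  rw [Ideal.mem_iInf, Subtype.forall]

namespace IsMiddleSubgroup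

variable {C₂ : Subgroup G}

theorem markCongruence_bot_iff {n π : ℕ}
    {z : BurnsideRing (⊥ : Subgroup G)} : MarkCongruence C₂ n π ⊥ z ↔ z = 0 := by
  constructor
  · rintro ⟨hz, -⟩
    obtain ⟨m, rfl⟩ := exists_eq_bot z
    rw [map_intCast, Int.cast_id] at hz
    rw [hz, Int.cast_zero]
  · rintro rfl
    simp [MarkCongruence]

theorem markCongruence_middle_iff (hC : IsMiddleSubgroup C₂) {n π : ℕ} (m q : ℤ) :
    MarkCongruence C₂ n π C₂ (m + q * orbitClass C₂ ⊥ : BurnsideRing C₂) ↔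
      m + 2 * q = 0 ∧ (n : ℤ) ∣ q := by
  simp only [MarkCongruence, map_add, map_mul, map_intCast, hC.levelMark_middle_bot, Int.cast_id,
    hC.levelMark_middle_self, hC.not_top_le, le_refl, true_imp_iff, false_imp_iff, and_true,
    mul_zero, add_zero]
  constructor
  · rintro ⟨h1, r, hr⟩
    exact ⟨by omega, -r, by linarith⟩
  · rintro ⟨h1, r, rfl⟩
    exact ⟨by linarith, -r, by linarith⟩

theorem markCongruence_top_iff (hC : IsMiddleSubgroup C₂) {n π : ℕ} (hnπ : n ∣ 2 * π)
    (m q p : ℤ) :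
    MarkCongruence C₂ n π ⊤ (m + q * orbitClass (⊤ : Subgroup G) C₂ +
        p * orbitClass (⊤ : Subgroup G) ⊥ : BurnsideRing (⊤ : Subgroup G)) ↔
      m + 2 * q + 4 * p = 0 ∧ (2 : ℤ) ∣ q + p ∧ (π : ℤ) ∣ p := by
  simp only [MarkCongruence, map_add, map_mul, map_intCast, Int.cast_id, hC.levelMark_top_bot_bot,
    hC.levelMark_top_bot, hC.levelMark_top_middle_bot, hC.levelMark_top_middle,
    hC.levelMark_top_top_bot, hC.levelMark_top_top, le_refl, le_top, true_imp_iff, mul_zero,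
    add_zero]
  constructor
  · rintro ⟨h1, -, ⟨r, hr⟩, h3⟩
    exact ⟨by linarith, by omega, -r, by linarith⟩
  · rintro ⟨h1, h2, r, rfl⟩
    refine ⟨by linarith, ?_, ⟨-r, by linarith⟩, by omega⟩
    obtain ⟨c, hc⟩ := hnπ
    have hc' : (2 * π : ℤ) = n * c := by exact_mod_cast hc
    exact ⟨-(c * r), by linear_combination h1 - 2 * r * hc'⟩

/-- A Tambara ideal that contains three particular elements contains `markIdeal`. -/
theorem mem_level_of_markCongruence (hC : IsMiddleSubgroup C₂) {n π : ℕ} (hnπ : n ∣ 2 * π)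
    (I : TambaraIdeal G)
    (h₁ : (π : BurnsideRing (⊤ : Subgroup G)) * (orbitClass ⊤ ⊥ - orbitClass ⊤ C₂ - 2) ∈ I.level ⊤)
    (h₂ : 2 * orbitClass ⊤ C₂ - 4 ∈ I.level ⊤)
    (h₃ : (n : BurnsideRing C₂) * (orbitClass C₂ ⊥ - 2) ∈ I.level C₂) (H : Subgroup G)
    {z : BurnsideRing H} (hz : MarkCongruence C₂ n π H z) : z ∈ I.level H := by
  rcases hC.eq_or H with rfl | rfl | rfl
  · rw [markCongruence_bot_iff.mp hz]
    exact zero_mem _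
  · obtain ⟨m, q, rfl⟩ := hC.exists_eq_middle z
    obtain ⟨h4, r, rfl⟩ := (hC.markCongruence_middle_iff m q).mp hz
    convert (I.level H).mul_mem_left (r : BurnsideRing H) h₃ using 1
    rw [eq_neg_of_add_eq_zero_left h4]
    push_cast
    ring
  · obtain ⟨m, q, p, rfl⟩ := hC.exists_eq_top z
    obtain ⟨h4, ⟨c, hc⟩, r, rfl⟩ := (hC.markCongruence_top_iff hnπ m q p).mp hz
    convert add_mem ((I.level ⊤).mul_mem_left (r : BurnsideRing (⊤ : Subgroup G)) h₁)
      ((I.level ⊤).mul_mem_left (c : BurnsideRing (⊤ : Subgroup G)) h₂) using 1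
    obtain rfl : q = 2 * c - π * r := by linarith
    obtain rfl : m = -4 * c - 2 * π * r := by linarith
    push_cast
    ring

/-- The single generator `g = u - t - 2` produces the other two elements required by
`mem_level_of_markCongruence`: `(2 - t)g = 2t - 4`, and the restriction of `g` to `C₂` is `2([C₂/e]
- 2)`. -/
theorem mem_span_singleton_iff (hC : IsMiddleSubgroup C₂) (H : Subgroup G) (z : BurnsideRing H) :
    z ∈ (TambaraIdeal.span
        {(⟨⊤, orbitClass ⊤ ⊥ - orbitClass ⊤ C₂ - 2⟩ : Σ H : Subgroup G, BurnsideRing H)}).level H ↔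
      MarkCongruence C₂ 2 1 H z := by
  rw [TambaraIdeal.mem_span_level]
  constructor
  · intro h
    refine (mem_markIdeal hC (hn := dvd_rfl) (hπ := one_dvd 2) (hnπ := by norm_num)).mp (h _ ?_)
    rintro s rfl
    rw [mem_markIdeal]
    convert (hC.markCongruence_top_iff (n := 2) (π := 1) (by norm_num) (-2) (-1) 1).mpr
      (by norm_num) using 1
    push_cast
    ring
  · intro hz I hI
    have hg := hI _ rfl
    dsimp only at hg
    refine hC.mem_level_of_markCongruence (by norm_num) I ?_ ?_ ?_ H hz
    · rwa [Nat.cast_one, one_mul]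
    · convert (I.level ⊤).mul_mem_left (2 - orbitClass ⊤ C₂) hg using 1
      apply hC.ext_top <;>
      simp only [map_sub, map_mul, map_ofNat, hC.levelMark_top_bot_bot,
        hC.levelMark_top_bot, hC.levelMark_top_middle_bot, hC.levelMark_top_middle,
        hC.levelMark_top_top_bot, hC.levelMark_top_top] <;> norm_num
    · convert I.res_mem le_top _ hg using 1
      apply hC.ext_middle
      · rw [levelMark_tambaraRes le_top bot_le]
        simp only [map_sub, map_mul, map_ofNat, hC.levelMark_top_bot_bot, map_natCast,
          hC.levelMark_top_bot, hC.levelMark_middle_bot]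
        norm_num
      · rw [levelMark_tambaraRes le_top le_rfl]
        simp only [map_sub, map_mul, map_ofNat, hC.levelMark_top_middle_bot, map_natCast,
          hC.levelMark_top_middle, hC.levelMark_middle_self]
        norm_num

theorem mem_span_triple_iff (hC : IsMiddleSubgroup C₂) {n π : ℕ} (hn : 2 ∣ π)
    (hπ : π ∣ n) (hnπ : n ∣ 2 * π) (H : Subgroup G) (z : BurnsideRing H) :
    z ∈ (TambaraIdeal.span
        {(⟨⊤, 2 * orbitClass ⊤ C₂ - 4⟩ : Σ H : Subgroup G, BurnsideRing H),
          ⟨⊤, (π : BurnsideRing (⊤ : Subgroup G)) * (orbitClass ⊤ ⊥ - 4)⟩,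
          ⟨C₂, (n : BurnsideRing C₂) * (orbitClass C₂ ⊥ - 2)⟩}).level H ↔
      MarkCongruence C₂ n π H z := by
  rw [TambaraIdeal.mem_span_level]
  obtain ⟨a, rfl⟩ := hn
  constructor
  · intro h
    refine (mem_markIdeal hC (hn := (Dvd.intro _ rfl).trans hπ) (hπ := hπ)
      (hnπ := hnπ)).mp (h _ ?_)
    rintro s (rfl | rfl | rfl) <;> rw [mem_markIdeal]
    · convert (hC.markCongruence_top_iff hnπ (-4) 2 0).mpr (by norm_num) using 1
      push_cast
      ring
    · convert (hC.markCongruence_top_iff hnπ (-4 * (2 * a)) 0 (2 * a)).mpr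
        ⟨by ring, ⟨a, by ring⟩, ⟨1, by push_cast; ring⟩⟩ using 1
      push_cast
      ring
    · convert (hC.markCongruence_middle_iff (n := n) (π := 2 * a) (-2 * n) n).mpr
        ⟨by ring, dvd_rfl⟩ using 1
      push_cast
      ring
  · intro hz I hI
    have h₁ := hI ⟨⊤, 2 * orbitClass ⊤ C₂ - 4⟩ (Or.inl rfl)
    have h₂ := hI _ (Or.inr (Or.inl rfl))
    have h₃ := hI _ (Or.inr (Or.inr rfl))
    dsimp only at h₁ h₂ h₃
    refine hC.mem_level_of_markCongruence hnπ I ?_ h₁ h₃ H hz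
    -- With `π = 2a` one has `π(u - 4) - a(2t - 4) = π(u - t - 2)`.
    convert sub_mem h₂ ((I.level ⊤).mul_mem_left (a : BurnsideRing (⊤ : Subgroup G)) h₁) using 1
    push_cast
    ring

end IsMiddleSubgroup

end MarkIdeal

end Burnside


namespace GrothendieckWitt

open Algebra.GrothendieckAddGroup (of lift)

universe v₁

/-! ### Sums of squares in a quadratic extension -/

section QuadraticSquares

variable {k E : Type*} [Field k] [Field E] [Algebra k E]

theorem tau_dvd_tau_of_forall {k L : Type*} [Field k] [Field L] {α : k} {β : L}
    (h : ∀ n, IsSumOfSquares (2 ^ n) β → IsSumOfSquares (2 ^ n) α) : tau α ∣ tau β := by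
  obtain ⟨h', -⟩ | ⟨n, hn, hs⟩ := tau_eq_zero_or β
  · rw [h']
    exact dvd_zero _
  · rw [hn]
    exact tau_dvd_of_isSumOfSquares (h n hs)

theorem tau_congr {k L : Type*} [Field k] [Field L] (e : k ≃+* L) (α : k) :
    tau (e α) = tau α :=
  Nat.dvd_antisymm (tau_dvd_tau_of_forall fun _ h => h.map (e : k →+* L))
    (tau_dvd_tau_of_forall fun _ h => by simpa using h.map (e.symm : L →+* k))

theorem piLevel_congr {k L : Type*} [Field k] [Field L] (e : k ≃+* L) (α : k) :
    piLevel (e α) = piLevel α := by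
  simp only [piLevel, tau_congr]

theorem two_dvd_piLevel (α : k) : 2 ∣ piLevel α := by
  rw [piLevel]
  split_ifs with h₁ h₂
  · exact dvd_zero 2
  · exact dvd_rfl
  · obtain ⟨h, -⟩ | ⟨n, hn, -⟩ := tau_eq_zero_or α
    · exact (h₁ h).elim
    · rw [hn] at h₂ ⊢
      match n with
      | 0 => norm_num at h₂
      | 1 => norm_num at h₂
      | n + 2 => exact ⟨2 ^ n, by rw [pow_add]; omega⟩

/-- If `δ = x (Δ - a s)` and `Δ = a² + b² = s²`, then `δ` is a product of `x` and a sum of two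
squares. -/
theorem IsSumOfSquares.mul_sub [NeZero (2 : E)] {n : ℕ} (hn : n ≠ 0) {Δ a b x s : E}
    (hsum : IsSumOfSquares (2 ^ n) x) (hΔ : Δ = a ^ 2 + b ^ 2) (hs : s ^ 2 = Δ) :
    IsSumOfSquares (2 ^ n) (x * (Δ - a * s)) := by
  have h2 : (2 : E) ≠ 0 := NeZero.ne 2
  refine hsum.mul ?_
  -- `Δ - as = ((s - a)² + b²)/2`, and half a sum of two squares is the sum of the squares of the
  -- half-sum and the half-difference.
  refine IsSumOfSquares.mono (m := 2) (Nat.le_self_pow hn 2) (isSumOfSquares_two_iff.mpr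
    ⟨(s - a + b) / 2, (s - a - b) / 2, ?_⟩)
  field_simp
  linear_combination 2 * hΔ - 2 * hs

/-- Write the squared elements as `uᵢ + vᵢs`, with `U = ∑ uᵢ²` and `V = ∑ vᵢ²`. The part without `s`
gives `xΔ = U + ΔV`, so `x = UΔ · (Δ⁻¹)² + V`, and `UΔ` is a sum of `2 ^ n` squares by
multiplicativity. -/
theorem IsSumOfSquares.of_mul_sub [NeZero (2 : k)] {n : ℕ} (hn : n ≠ 0) {Δ a b x : k} {s : E}
    (hΔ0 : Δ ≠ 0) (hΔ : Δ = a ^ 2 + b ^ 2) (hs : s ^ 2 = algebraMap k E Δ)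
    (hspan : ∀ y : E, ∃ u v : k, y = algebraMap k E u + algebraMap k E v * s)
    (hsk : ∀ u : k, algebraMap k E u ≠ s)
    (h : IsSumOfSquares (2 ^ n) (algebraMap k E x * (algebraMap k E Δ - algebraMap k E a * s))) :
    IsSumOfSquares (2 ^ (n + 1)) x := by
  obtain ⟨f, hf⟩ := h
  choose u v huv using fun i => hspan (f i)
  set U : k := ∑ i, u i ^ 2 with hU
  set V : k := ∑ i, v i ^ 2 with hV
  have h1 : ∑ i, f i ^ 2 = algebraMap k E (U + Δ * V) + algebraMap k E (∑ i, 2 * u i * v i) * s := by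
    rw [hU, hV, map_add, map_mul, map_sum, map_sum, map_sum, ← hs, Finset.mul_sum,
      Finset.sum_mul, ← Finset.sum_add_distrib, ← Finset.sum_add_distrib]
    refine Finset.sum_congr rfl fun i _ => ?_
    rw [huv]
    simp only [map_mul, map_pow, map_ofNat]
    ring
  rw [h1] at hf
  set q : k := ∑ i, 2 * u i * v i
  have hq : x * a + q = 0 := by
    by_contra hq
    refine hsk ((x * Δ - (U + Δ * V)) / (x * a + q)) ?_
    rw [map_div₀, div_eq_iff ((map_ne_zero _).mpr hq)]
    simp only [map_sub, map_add, map_mul] at hf ⊢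
    linear_combination hf
  have h2 : x * Δ = U + Δ * V := by
    apply (algebraMap k E).injective
    have hq' := congrArg (algebraMap k E) hq
    simp only [map_add, map_mul, map_zero] at hf hq' ⊢
    linear_combination hf + s * hq'
  have h3 : x = U * Δ * Δ⁻¹ ^ 2 + V := by
    field_simp
    linear_combination h2
  have hle : 2 ≤ 2 ^ n := Nat.le_self_pow hn 2
  rw [h3, pow_succ, mul_two]
  refine IsSumOfSquares.add (IsSumOfSquares.mul (IsSumOfSquares.mul ⟨u, rfl⟩ ?_) ?_) ⟨v, rfl⟩
  · exact (isSumOfSquares_two_iff.mpr ⟨a, b, hΔ⟩).mono hle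
  · exact (isSumOfSquares_one_iff.mpr ⟨Δ⁻¹, rfl⟩).mono (one_le_two.trans hle)

/-- The levels of `x` and of `δ = x (Δ - a √Δ)` differ by a factor of at most `2`. -/
theorem piLevel_dvd_tau_and_tau_dvd [NeZero (2 : k)] {Δ a b x : k} {s : E}
    (hΔ0 : Δ ≠ 0) (hΔ : Δ = a ^ 2 + b ^ 2) (hs : s ^ 2 = algebraMap k E Δ)
    (hspan : ∀ y : E, ∃ u v : k, y = algebraMap k E u + algebraMap k E v * s)
    (hsk : ∀ u : k, algebraMap k E u ≠ s)
    (hδ : ∀ y : E, y ^ 2 ≠ algebraMap k E x * (algebraMap k E Δ - algebraMap k E a * s)) :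
    piLevel x ∣ tau (algebraMap k E x * (algebraMap k E Δ - algebraMap k E a * s)) ∧
      tau (algebraMap k E x * (algebraMap k E Δ - algebraMap k E a * s)) ∣ 2 * piLevel x := by
  have : NeZero (2 : E) := ⟨fun h => NeZero.ne (2 : k)
    ((algebraMap k E).injective (by rw [map_ofNat, map_zero, h]))⟩
  set δ := algebraMap k E x * (algebraMap k E Δ - algebraMap k E a * s)
  have hup : ∀ n, n ≠ 0 → IsSumOfSquares (2 ^ n) x → IsSumOfSquares (2 ^ n) δ := fun n hn h =>
    IsSumOfSquares.mul_sub (b := algebraMap k E b) hn (h.map (algebraMap k E))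
      (by rw [hΔ, map_add, map_pow, map_pow]) hs
  have hdown : ∀ n, IsSumOfSquares (2 ^ n) δ → n ≠ 0 ∧ IsSumOfSquares (2 ^ (n + 1)) x :=
    fun n h => by
      have hn : n ≠ 0 := by
        rintro rfl
        obtain ⟨y, hy⟩ := isSumOfSquares_one_iff.mp h
        exact hδ y hy.symm
      exact ⟨hn, IsSumOfSquares.of_mul_sub hn hΔ0 hΔ hs hspan hsk h⟩
  rcases tau_eq_zero_or δ with ⟨hδ0, hδn⟩ | ⟨j, hj, hjs⟩
  · rcases tau_eq_zero_or x with ⟨hx0, -⟩ | ⟨n, -, hns⟩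
    · simp [piLevel, hδ0, hx0]
    · exact (hδn (n + 1) (hup (n + 1) n.succ_ne_zero
        (hns.mono (Nat.pow_le_pow_right two_pos n.le_succ)))).elim
  · obtain ⟨hj0, hjx⟩ := hdown j hjs
    have h1 := tau_dvd_of_isSumOfSquares hjx
    rcases tau_eq_zero_or x with ⟨-, hxn⟩ | ⟨n, hn, hns⟩
    · exact (hxn _ hjx).elim
    · rw [hj, piLevel, hn]
      rw [hn, Nat.pow_dvd_pow_iff_le_right one_lt_two] at h1
      -- Here `τ(x) = 2 ^ n` and `τ(δ) = 2 ^ j` with `j ≥ 1`, because `δ` is not a square. The two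
      -- transfers of sums of squares give `n ≤ j + 1` and `j ≤ max n 1`.
      match n, j with
      | _, 0 => exact (hj0 rfl).elim
      | 0, j + 1 =>
        have h2 := tau_dvd_of_isSumOfSquares (hup 1 one_ne_zero (hns.mono one_le_two))
        rw [hj, Nat.pow_dvd_pow_iff_le_right one_lt_two] at h2
        obtain rfl : j = 0 := by omega
        norm_num
      | 1, j + 1 =>
        have h2 := tau_dvd_of_isSumOfSquares (hup 1 one_ne_zero hns)
        rw [hj, Nat.pow_dvd_pow_iff_le_right one_lt_two] at h2
        obtain rfl : j = 0 := by omega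
        norm_num
      | n + 2, j + 1 =>
        have h2 := tau_dvd_of_isSumOfSquares (hup (n + 2) (by omega) hns)
        rw [hj, Nat.pow_dvd_pow_iff_le_right one_lt_two] at h2
        have h3 : 2 < 2 ^ (n + 2) := by
          have := Nat.one_le_two_pow (n := n)
          rw [pow_add]
          omega
        rw [if_neg (by positivity), if_neg (by omega), pow_succ 2 (n + 1),
          Nat.mul_div_cancel _ two_pos, mul_comm 2, ← pow_succ]
        exact ⟨pow_dvd_pow 2 (by omega), pow_dvd_pow 2 h2⟩

/-- If `x` times a sum of two squares is `1 + u²`, then `x` is a sum of two squares. -/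
theorem isSumOfSquares_two_of_one_add_sq_eq [NeZero (2 : E)] {x u g h : E}
    (he : 1 + u ^ 2 = x * (g ^ 2 + h ^ 2)) : IsSumOfSquares 2 x := by
  have h2 : (2 : E) ≠ 0 := NeZero.ne 2
  -- If `-1` is a square, every element is a sum of two squares, being a difference of two squares.
  have hi : ∀ i : E, i ^ 2 = -1 → IsSumOfSquares 2 x := fun i hi =>
    isSumOfSquares_two_iff.mpr ⟨(x + 1) / 2, i * (x - 1) / 2, by
      field_simp
      linear_combination -(x - 1) ^ 2 * hi⟩
  by_cases hN : g ^ 2 + h ^ 2 = 0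
  · exact hi u (by rw [hN] at he; linear_combination he)
  -- The two-square identity for `(1 + u²)(g² + h²)`, divided by `(g² + h²)²`.
  · refine isSumOfSquares_two_iff.mpr ⟨(g - u * h) / (g ^ 2 + h ^ 2),
      (h + u * g) / (g ^ 2 + h ^ 2), ?_⟩
    field_simp
    linear_combination -(g ^ 2 + h ^ 2) * he

end QuadraticSquares

/-! ### Kernels in the Grothendieck–Witt group -/

/-- For `τ ≥ 4` this is `π = τ/2`; for `τ ∈ {1, 2}` both sides always hold. The definition of `π` is
adapted to the relation `2 • defect = 4 • (⟨x⟩ - ⟨1⟩)`. -/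
theorem piLevel_dvd_two_mul_iff {k : Type*} [Field k] (α : k) (r : ℤ) :
    (piLevel α : ℤ) ∣ 2 * r ↔ (tau α : ℤ) ∣ 4 * r := by
  rw [piLevel]
  obtain ⟨h, -⟩ | ⟨n, hn, -⟩ := tau_eq_zero_or α
  · rw [h, if_pos rfl]
    simp
  · rw [hn, if_neg (by positivity)]
    match n with
    | 0 => simp
    | 1 =>
      rw [if_pos (by norm_num)]
      exact iff_of_true ⟨r, by norm_num⟩ ⟨2 * r, by push_cast; ring⟩
    | n + 2 =>
      have h1 := Nat.one_le_two_pow (n := n)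
      rw [if_neg (by rw [pow_add]; omega), pow_succ 2 (n + 1), Nat.mul_div_cancel _ two_pos]
      push_cast
      rw [show (4 * r : ℤ) = 2 * r * 2 by ring, Int.mul_dvd_mul_iff_right two_ne_zero]

/-- The dimension forces `m = -2q`; replacing `2⟨1⟩` by `2⟨2⟩` leaves `q • (⟨2δ⟩ - ⟨2⟩)`, whose
vanishing is governed by `τ(δ)`. -/
theorem zsmul_gw_two_mul_sub {k : Type v₁} [Field k] [NeZero (2 : k)] {δ : k} (hδ : δ ≠ 0)
    (m q : ℤ) : m • gw 1 + q • (gw 2 + gw (2 * δ)) = 0 ↔ m + 2 * q = 0 ∧ (tau δ : ℤ) ∣ q := by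
  have h2 : (2 : k) ≠ 0 := NeZero.ne 2
  have e := CyclicQuartic.gw_two_add (k := k)
  rw [← zsmul_gw_sub_eq_zero_iff hδ h2]
  constructor
  · intro h
    have hd := congrArg dimHom h
    simp only [map_add, map_zsmul, dimHom_gw one_ne_zero, dimHom_gw h2,
      dimHom_gw (mul_ne_zero h2 hδ), smul_eq_mul, map_zero] at hd
    obtain rfl : m = -2 * q := by linarith
    refine ⟨by ring, ?_⟩
    linear_combination (norm := (module)) h - q • e
  · rintro ⟨h1, h⟩
    obtain rfl : m = -2 * q := by linarith
    linear_combination (norm := (module)) h + q • e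

/-! ### The annihilator of the defect and the relations at the top level -/

namespace CyclicQuartic

variable {k K : Type v₁} [Field k] [Field K] [Algebra k K] (D : CyclicQuartic k K)
  [NeZero (2 : k)]

theorem two_zsmul_defect : (2 : ℤ) • D.defect = (4 : ℤ) • (gw (1 * D.x) - gw 1) := by
  have e1 := gw_two_add (k := k)
  have e2 := D.gw_Δ_add
  have e3 := D.gw_two_mul_Δ_add
  rw [defect, one_mul]
  linear_combination (norm := (module)) e2 - e1 - e3

/-- Even multiples are decided by `τ(x)`. An odd multiple cannot vanish unless the defect does, and
`π` is even, so it never divides an odd number. -/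
theorem zsmul_defect_eq_zero_iff (h : D.defect ≠ 0) (p : ℤ) :
    p • D.defect = 0 ↔ (piLevel D.x : ℤ) ∣ p := by
  have heven : ∀ r : ℤ, (2 * r) • D.defect = 0 ↔ (piLevel D.x : ℤ) ∣ 2 * r := fun r => by
    rw [piLevel_dvd_two_mul_iff, ← zsmul_gw_sub_eq_zero_iff D.x_ne one_ne_zero, mul_comm,
      mul_smul, D.two_zsmul_defect, smul_smul, mul_comm]
  rcases Int.even_or_odd' p with ⟨r, rfl | rfl⟩
  · exact heven r
  · refine iff_of_false (fun h1 => h ?_) fun h1 => ?_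
    · have h3 : (2 * (2 * r + 1)) • D.defect = 0 := by rw [mul_smul, h1, smul_zero]
      rw [heven, piLevel_dvd_two_mul_iff] at h3
      -- `τ(x)` is a power of `2` dividing `4` times an odd number, hence divides `4`. Then twice
      -- the defect vanishes, and with the odd multiple the defect itself does.
      have h4 : (tau D.x : ℤ) ∣ 4 := by
        obtain ⟨h5, -⟩ | ⟨n, hn, -⟩ := tau_eq_zero_or D.x
        · rw [h5, Nat.cast_zero, zero_dvd_iff] at h3
          omega
        · rw [hn] at h3 ⊢
          refine IsCoprime.dvd_of_dvd_mul_right ?_ h3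
          push_cast
          exact IsCoprime.pow_left ⟨-r, 1, by ring⟩
      have h5 := (heven 1).mpr ((piLevel_dvd_two_mul_iff D.x 1).mpr (by simpa using h4))
      linear_combination (norm := (module)) h1 - r • h5
    · have h3 : (2 : ℤ) ∣ 2 * r + 1 :=
        (Int.natCast_dvd_natCast.mpr (two_dvd_piLevel D.x)).trans h1
      omega

/-- The discriminant here is the class of `Δ`, which is not a square. The defect has trivial
discriminant, so the discriminant detects the parity of `q + p` below. -/
theorem discHom_gw_two_sub_ne_zero :
    discHom (gw 2 + gw (2 * D.Δ) - (gw 1 + gw 1)) ≠ 0 := by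
  have h2 : (2 : k) ≠ 0 := NeZero.ne 2
  simp only [map_add, map_sub, discHom_gw h2, discHom_gw (mul_ne_zero h2 D.Δ_ne),
    discHom_gw (one_ne_zero (α := k)), ← ofMul_mul, ← ofMul_div, ← QuotientGroup.mk_mul,
    ← QuotientGroup.mk_div]
  rw [Ne, ofMul_eq_zero, QuotientGroup.eq_one_iff]
  rintro ⟨u, hu⟩
  have hu' := congrArg (Units.val) hu
  simp only [powMonoidHom_apply, Units.val_pow_eq_pow_val, Units.val_div_eq_div_val,
    Units.val_mul, Units.val_mk0] at hu'
  field_simp at hu'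
  refine D.Δ_ne_sq (u / 2) ?_
  field_simp
  linear_combination -hu'

theorem discHom_defect : discHom D.defect = 0 := by
  have h2 : (2 : k) ≠ 0 := NeZero.ne 2
  have hΔ := D.Δ_ne
  have hx := D.x_ne
  simp only [defect, map_add, map_sub, discHom_gw h2, discHom_gw (mul_ne_zero h2 hΔ),
    discHom_gw (one_ne_zero (α := k)), discHom_gw hΔ, discHom_gw hx, ← ofMul_mul, ← ofMul_div,
    ← QuotientGroup.mk_mul, ← QuotientGroup.mk_div]
  rw [ofMul_eq_zero, QuotientGroup.eq_one_iff]
  refine ⟨Units.mk0 (D.x / 2) (div_ne_zero hx h2), Units.ext ?_⟩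
  simp only [powMonoidHom_apply, Units.val_pow_eq_pow_val, Units.val_div_eq_div_val,
    Units.val_mul, Units.val_mk0]
  field_simp

/-- The relations between the trace forms of the orbits. -/
theorem zsmul_add_zsmul_add_zsmul_eq_zero_iff (m q p : ℤ) :
    m • gw 1 + q • (gw 2 + gw (2 * D.Δ)) + p • (gw 1 + gw D.Δ + gw D.x + gw D.x) = 0 ↔
      m + 2 * q + 4 * p = 0 ∧ (2 : ℤ) ∣ q + p ∧ p • D.defect = 0 := by
  have h2 : (2 : k) ≠ 0 := NeZero.ne 2
  have e1 := gw_two_add (k := k)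
  have e3 := D.gw_two_mul_Δ_add
  constructor
  · intro h
    have hd := congrArg dimHom h
    simp only [map_add, map_zsmul, dimHom_gw one_ne_zero, dimHom_gw h2, dimHom_gw D.Δ_ne,
      dimHom_gw D.x_ne, dimHom_gw (mul_ne_zero h2 D.Δ_ne), smul_eq_mul, map_zero] at hd
    obtain rfl : m = -2 * q - 4 * p := by linarith
    -- The second element is killed by `2` and has nontrivial discriminant, so `q + p` must be even,
    -- and then only `p • defect` remains.
    have h' : p • D.defect + (q + p) • (gw 2 + gw (2 * D.Δ) - (gw 1 + gw 1)) = 0 := by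
      rw [defect]
      linear_combination (norm := (module)) h
    have hqp : (2 : ℤ) ∣ q + p := by
      by_contra hodd
      obtain ⟨r, hr⟩ : Odd (q + p) := by
        rwa [← Int.not_even_iff_odd, even_iff_two_dvd]
      have h4 : p • D.defect + (gw 2 + gw (2 * D.Δ) - (gw 1 + gw 1)) = 0 := by
        rw [hr] at h'
        linear_combination (norm := (module)) h' - r • e1 - r • e3
      refine D.discHom_gw_two_sub_ne_zero ?_
      have h5 : p • D.defect ∈ discHom.ker := zsmul_mem (AddMonoidHom.mem_ker.mpr D.discHom_defect) p
      have h6 := congrArg discHom h4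
      rwa [map_add, AddMonoidHom.mem_ker.mp h5, zero_add, map_zero] at h6
    obtain ⟨r, hr⟩ := hqp
    refine ⟨by ring, ⟨r, hr⟩, ?_⟩
    rw [hr] at h'
    linear_combination (norm := (module)) h' - r • e1 - r • e3
  · rintro ⟨h1, ⟨r, hr⟩, h3⟩
    obtain rfl : q = 2 * r - p := by linarith
    obtain rfl : m = -4 * r - 2 * p := by linarith
    rw [defect] at h3
    linear_combination (norm := (module)) h3 + r • e1 + r • e3

end CyclicQuartic

end GrothendieckWitt


namespace GrothendieckWitt

open Algebra.GrothendieckAddGroup (of lift)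

universe v₁

/-! ### Trace forms -/

section TraceForms

variable {k M : Type v₁} [Field k] [Field M] [Algebra k M] [FiniteDimensional k M]
  [Algebra.IsSeparable k M] [NeZero (2 : k)]

theorem traceForm_apply (y : M) : (traceForm k M).Q y = Algebra.trace k M (y * y) := rfl

theorem traceForm_polar {y z : M} (h : Algebra.trace k M (y * z) = 0) :
    QuadraticMap.polar (traceForm k M).Q y z = 0 := by
  refine (LinearMap.BilinMap.polar_toQuadraticMap (x := y) (y := z)).trans ?_
  change Algebra.trace k M (y * z) + Algebra.trace k M (z * y) = 0
  rw [mul_comm z y, h, add_zero]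

theorem of_traceForm_of_finrank_eq_one (h : Module.finrank k M = 1) :
    of (formCls (traceForm k M)) = gw 1 := by
  refine of_formCls_eq_one (traceForm k M) h (e₀ := (1 : M)) one_ne_zero ?_
  rw [traceForm_apply, one_mul, ← map_one (algebraMap k M), Algebra.trace_algebraMap, h, one_smul]

theorem of_traceForm_of_finrank_eq_two (h : Module.finrank k M = 2) {r : M} {c : k}
    (hr : r ^ 2 = algebraMap k M c) (hc : ∀ u : k, u ^ 2 ≠ c) :
    of (formCls (traceForm k M)) = gw 2 + gw (2 * c) := by
  have h2 : (2 : k) ≠ 0 := NeZero.ne 2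
  have hc0 : c ≠ 0 := fun h0 => hc 0 (by rw [h0, zero_pow two_ne_zero])
  have htr : ∀ u : k, Algebra.trace k M (algebraMap k M u) = 2 * u := fun u => by
    rw [Algebra.trace_algebraMap, h, nsmul_eq_mul, Nat.cast_ofNat]
  have hmin : minpoly k r = Polynomial.X ^ 2 - Polynomial.C c :=
    (minpoly.eq_of_irreducible_of_monic (X_pow_sub_C_irreducible_of_prime Nat.prime_two hc)
      (by simp [hr]) (Polynomial.monic_X_pow_sub_C c two_ne_zero)).symm
  have htr0 : Algebra.trace k M r = 0 := by
    rw [trace_eq_finrank_mul_minpoly_nextCoeff, hmin, Polynomial.nextCoeff_of_natDegree_pos]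
    · simp
    · simp
  refine of_formCls_eq_two (traceForm k M) h (e₀ := (1 : M)) (e₁ := r) h2 (mul_ne_zero h2 hc0)
    ?_ ?_ ?_
  · rw [traceForm_apply, one_mul, ← map_one (algebraMap k M), htr, mul_one]
  · rw [traceForm_apply, ← sq, hr, htr]
  · exact traceForm_polar (by rw [one_mul, htr0])

theorem formCls_traceForm_congr {M' : Type v₁} [Field M'] [Algebra k M'] [FiniteDimensional k M']
    [Algebra.IsSeparable k M'] (e : M ≃ₐ[k] M') :
    formCls (traceForm k M) = formCls (traceForm k M') := by
  refine formCls_eq (A := traceForm k M) (B := traceForm k M') e.toLinearEquiv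
    fun (y : M) => ?_
  change Algebra.trace _ _ (e y * e y) = Algebra.trace _ _ (y * y)
  rw [← map_mul, Algebra.trace_eq_of_algEquiv]

/-- The orthogonal basis is again `1, √Δ, d, σd`, with entries `4, 4Δ, 4Δx, 4Δx`; the pair `⟨Δx,
Δx⟩` equals `⟨x, x⟩` because `Δ` is a sum of two squares. -/
theorem CyclicQuartic.of_traceForm (D : CyclicQuartic k M) :
    of (formCls (traceForm k M)) = gw 1 + gw D.Δ + gw D.x + gw D.x := by
  have h2 : (2 : k) ≠ 0 := NeZero.ne 2
  have h4 : (4 : k) ≠ 0 := by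
    rw [show (4 : k) = 2 * 2 by norm_num]
    exact mul_ne_zero h2 h2
  have hΔ := D.Δ_ne
  have hx := D.x_ne
  have hss := D.s_sq
  rw [of_formCls_eq_four (traceForm k M) D.finrank_eq (e₀ := (1 : M)) (e₁ := D.s) (e₂ := D.d)
    (e₃ := D.σ D.d) (w₀ := 4) (w₁ := 4 * D.Δ) (w₂ := 4 * (D.Δ * D.x)) (w₃ := 4 * (D.Δ * D.x))
    h4 (mul_ne_zero h4 hΔ) (mul_ne_zero h4 (mul_ne_zero hΔ hx))
    (mul_ne_zero h4 (mul_ne_zero hΔ hx))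
    ((traceForm_apply _).trans ((D.trace_eq 1 0 (by simp)).trans (by ring)))
    ((traceForm_apply _).trans (D.trace_eq D.Δ 0 (by rw [← sq, hss]; simp)))
    ((traceForm_apply _).trans (D.trace_eq _ (-(D.x * D.a)) (by
      rw [← sq, D.d_sq]
      simp only [map_neg, map_mul]
      ring)))
    ((traceForm_apply _).trans (D.trace_eq _ (D.x * D.a) (by
      rw [← sq, D.σ_d_sq]
      simp only [map_mul]
      ring)))
    (traceForm_polar (trace_eq_zero_of_map_eq_neg D.σ (by rw [one_mul, D.σ_s])))
    (traceForm_polar (D.trace_eq_zero_of_anti (by rw [one_mul, D.σ_σ_d])))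
    (traceForm_polar (D.trace_eq_zero_of_anti (by rw [one_mul, D.σ_σ_d, map_neg])))
    (traceForm_polar (D.trace_eq_zero_of_anti (by
      simp only [map_mul, D.σ_σ_s, D.σ_σ_d]
      ring)))
    (traceForm_polar (D.trace_eq_zero_of_anti (by
      simp only [map_mul, map_neg, D.σ_σ_s, D.σ_σ_d]
      ring)))
    (traceForm_polar (trace_eq_zero_of_map_eq_neg D.σ (by
      simp only [map_mul, D.σ_σ_d]
      ring)))]
  have e4 : ∀ c : k, gw (4 * c) = gw c := fun c => gw_congr h2 (by ring)
  have e5 := nsmul_gw_mul hΔ (n := 1) (isSumOfSquares_two_iff.mpr ⟨D.a, D.b, D.Δ_eq⟩) hx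
  rw [pow_one, two_nsmul, two_nsmul] at e5
  rw [e4, e4, ← mul_one (4 : k), e4, add_assoc, e5, ← add_assoc]

end TraceForms

end GrothendieckWitt


/-! ### The Dress map on transitive sets -/

namespace GrothendieckWitt

open Algebra.GrothendieckAddGroup (of lift)
open Burnside IntermediateField

universe v₁

section Galois

variable {F : Type*} {K : Type v₁} [Field F] [Field K] [Algebra F K]

theorem mem_fixedExtension_subgroupOf {H J : Subgroup Gal(K/F)} (hJ : J ≤ H) {y : K} :
    y ∈ fixedExtension H (J.subgroupOf H) ↔ y ∈ fixedField J :=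
  ⟨fun h g => h ⟨⟨g.1, hJ g.2⟩, g.2⟩, fun h g => h ⟨g.1.1, g.2⟩⟩

variable [FiniteDimensional F K] [IsGalois F K]

theorem finrank_fixedExtension (H : Subgroup Gal(K/F)) (L : Subgroup H) :
    Module.finrank (fixedField H) (fixedExtension H L) * Nat.card L = Nat.card H := by
  have h1 : Module.finrank (fixedExtension H L) K = Nat.card L := by
    have := Fintype.ofFinite L
    rw [Nat.card_eq_fintype_card]
    exact FixedPoints.finrank_eq_card L K
  rw [← h1, Module.finrank_mul_finrank, finrank_fixedField_eq_card]

variable [NeZero (2 : F)]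

theorem dressMap_orbitClass (H J : Subgroup Gal(K/F)) :
    dressMap H (orbitClass H J) =
      of (formCls (traceForm (fixedField H) (fixedExtension H (J.subgroupOf H)))) :=
  dressMap_coset H _

theorem dressMap_one (H : Subgroup Gal(K/F)) : dressMap H 1 = gw 1 := by
  rw [← orbitClass_self, dressMap_orbitClass]
  refine of_traceForm_of_finrank_eq_one ?_
  have h := finrank_fixedExtension H (H.subgroupOf H)
  rw [Subgroup.subgroupOf_self, Subgroup.card_top] at h
  rw [Subgroup.subgroupOf_self]
  exact mul_right_cancel₀ (b := Nat.card H) Nat.card_pos.ne' (h.trans (one_mul _).symm)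

theorem dressMap_orbitClass_bot (H : Subgroup Gal(K/F)) :
    dressMap H (orbitClass H ⊥) = of (formCls (traceForm (fixedField H) K)) := by
  rw [dressMap_orbitClass]
  have h : fixedExtension H ((⊥ : Subgroup Gal(K/F)).subgroupOf H) = ⊤ := by
    refine eq_top_iff.mpr fun y _ => (mem_fixedExtension_subgroupOf bot_le).mpr ?_
    rintro ⟨g, hg⟩
    rw [Subgroup.mem_bot] at hg
    subst hg
    rfl
  exact congrArg of (formCls_traceForm_congr ((equivOfEq h).trans topEquiv))

/-- For a quadratic step the trace form is read off from a square root `r` generating it; this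
covers both `E/F` and `K/E`. -/
theorem dressMap_orbitClass_of_card {H J : Subgroup Gal(K/F)} (hJ : J ≤ H)
    (hcard : Nat.card H = 2 * Nat.card J) {r : K} {c : fixedField H} (hrJ : r ∈ fixedField J)
    (hr : r ^ 2 = algebraMap (fixedField H) K c) (hc : ∀ u : fixedField H, u ^ 2 ≠ c) :
    dressMap H (orbitClass H J) = gw 2 + gw (2 * c) := by
  rw [dressMap_orbitClass]
  refine of_traceForm_of_finrank_eq_two (r := ⟨r, (mem_fixedExtension_subgroupOf hJ).mpr hrJ⟩)
    ?_ (Subtype.ext hr) hc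
  have h := finrank_fixedExtension H (J.subgroupOf H)
  rw [Nat.card_congr (Subgroup.subgroupOfEquivOfLe hJ).toEquiv, hcard] at h
  exact mul_right_cancel₀ Nat.card_pos.ne' h

end Galois

end GrothendieckWitt


/-! ### Fixed fields of a cyclic group of order four -/

namespace GrothendieckWitt

open Algebra.GrothendieckAddGroup (of lift)
open Burnside IntermediateField

universe v₁

section CyclicGaloisFour

variable {F : Type*} {K : Type v₁} [Field F] [Field K] [Algebra F K]

theorem mem_fixedField_zpowers_iff {σ : Gal(K/F)} {y : K} :
    y ∈ fixedField (Subgroup.zpowers σ) ↔ σ y = y := by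
  change y ∈ fixedField (Subgroup.zpowers σ) ↔ σ ∈ MulAction.stabilizer Gal(K/F) y
  rw [mem_fixedField_iff, ← Subgroup.zpowers_le]
  rfl

variable {C₂ : Subgroup Gal(K/F)} {σ : Gal(K/F)}

theorem zpowers_eq_top (hC : IsMiddleSubgroup C₂) (hσ : orderOf σ = 4) : Subgroup.zpowers σ = ⊤ := by
  have : Finite Gal(K/F) := Nat.finite_of_card_ne_zero (by rw [hC.card_eq]; norm_num)
  refine Subgroup.eq_top_of_card_eq _ ?_
  rw [Nat.card_zpowers, hσ, hC.card_eq]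

theorem zpowers_sq_eq (hC : IsMiddleSubgroup C₂) (hσ : orderOf σ = 4) : Subgroup.zpowers (σ ^ 2) = C₂ := by
  have : Finite Gal(K/F) := Nat.finite_of_card_ne_zero (by rw [hC.card_eq]; norm_num)
  have h2 : Nat.card (Subgroup.zpowers (σ ^ 2)) = 2 := by
    rw [Nat.card_zpowers, orderOf_pow, hσ]
    norm_num
  rcases hC.eq_or (Subgroup.zpowers (σ ^ 2)) with h | h | h
  · rw [h, Subgroup.card_bot] at h2
    omega
  · exact h
  · rw [h, Subgroup.card_top, hC.card_eq] at h2
    omega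

theorem mem_fixedField_top_iff (hC : IsMiddleSubgroup C₂) (hσ : orderOf σ = 4) {y : K} : y ∈ fixedField (⊤ : Subgroup Gal(K/F)) ↔ σ y = y := by
  rw [← zpowers_eq_top hC hσ, mem_fixedField_zpowers_iff]

theorem mem_fixedField_middle_iff (hC : IsMiddleSubgroup C₂) (hσ : orderOf σ = 4) {y : K} : y ∈ fixedField C₂ ↔ σ (σ y) = y := by
  rw [← zpowers_sq_eq hC hσ, mem_fixedField_zpowers_iff]
  rfl

theorem fixedField_middle_not_le (hC : IsMiddleSubgroup C₂) [FiniteDimensional F K] :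
    ¬ fixedField C₂ ≤ fixedField (⊤ : Subgroup Gal(K/F)) := fun h => by
  have h1 := fixingSubgroup_antitone h
  rw [fixingSubgroup_fixedField, fixingSubgroup_fixedField] at h1
  exact hC.not_top_le h1

theorem exists_algebraMap_eq [FiniteDimensional F K] [IsGalois F K]
    (c : fixedField (⊤ : Subgroup Gal(K/F))) : ∃ f : F, algebraMap F _ f = c := by
  have h : (c : K) ∈ (⊥ : IntermediateField F K) :=
    (IsGalois.mem_bot_iff_fixed (c : K)).mpr fun g => c.2 ⟨g, trivial⟩
  obtain ⟨f, hf⟩ := mem_bot.mp h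
  exact ⟨f, Subtype.ext hf⟩

theorem not_mem_fixedField_middle (hC : IsMiddleSubgroup C₂) [FiniteDimensional F K] {d : K}
    (hK : (fixedField C₂)⟮d⟯ = ⊤) : d ∉ fixedField C₂ := fun hd => by
  have h1 : (fixedField C₂)⟮d⟯ = ⊥ := adjoin_simple_eq_bot_iff.mpr (mem_bot.mpr ⟨⟨d, hd⟩, rfl⟩)
  have h2 := bot_eq_top_iff_finrank_eq_one.mp (h1.symm.trans hK)
  rw [finrank_fixedField_eq_card, hC.card_two] at h2
  omega

/-- The base field is `fixedField ⊤` and not `F`, because the Dress map at the top level takes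
values in forms over `fixedField ⊤`. The signs `σ s = -s` and `σ² d = -d` hold because otherwise `s`
or `d` would lie in too small a fixed field. -/
theorem exists_cyclicQuartic (hC : IsMiddleSubgroup C₂) (hσ : orderOf σ = 4) [FiniteDimensional F K] [NeZero (2 : F)] {Δ a b x : F} (ha : a ≠ 0)
    (hb : b ≠ 0) (hx : x ≠ 0) (hΔ : Δ = a ^ 2 + b ^ 2) (s : fixedField C₂)
    (hs : s ^ 2 = algebraMap F (fixedField C₂) Δ) (hE : F⟮(s : K)⟯ = fixedField C₂)
    {δ : fixedField C₂} (hδ : δ = algebraMap F (fixedField C₂) x *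
      (algebraMap F (fixedField C₂) Δ - algebraMap F (fixedField C₂) a * s))
    {d : K} (hd : d ^ 2 = algebraMap (fixedField C₂) K δ) (hK : (fixedField C₂)⟮d⟯ = ⊤) :
    ∃ D : CyclicQuartic (fixedField (⊤ : Subgroup Gal(K/F))) K, (∀ y, D.σ y = σ y) ∧
      D.s = s ∧ D.Δ = algebraMap F _ Δ ∧ D.x = algebraMap F _ x := by
  have hinj : Function.Injective (algebraMap F (fixedField (⊤ : Subgroup Gal(K/F)))) :=
    (algebraMap F _).injective
  have hsK : (s : K) ^ 2 = algebraMap F K Δ := congrArg Subtype.val hs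
  have hdK : d ^ 2 = algebraMap F K x * (algebraMap F K Δ - algebraMap F K a * s) := by
    rw [hd, hδ]
    rfl
  have hσs : σ s = -(s : K) := by
    have h1 : σ s ^ 2 = (s : K) ^ 2 := by rw [← map_pow, hsK, AlgEquiv.commutes]
    rcases sq_eq_sq_iff_eq_or_eq_neg.mp h1 with h | h
    · refine (fixedField_middle_not_le hC ?_).elim
      rw [← hE, adjoin_simple_le_iff]
      exact (mem_fixedField_top_iff hC hσ).mpr h
    · exact h
  have hσσd : σ (σ d) = -d := by
    have h1 : σ (σ d) ^ 2 = d ^ 2 := by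
      rw [← map_pow, ← map_pow, hd]
      exact (mem_fixedField_middle_iff hC hσ).mp δ.2
    rcases sq_eq_sq_iff_eq_or_eq_neg.mp h1 with h | h
    · exact (not_mem_fixedField_middle hC hK ((mem_fixedField_middle_iff hC hσ).mpr h)).elim
    · exact h
  refine ⟨{
    σ := AlgEquiv.ofRingEquiv (f := (σ : K ≃+* K)) fun c => c.2 ⟨σ, trivial⟩
    s := s
    d := d
    Δ := algebraMap F _ Δ
    a := algebraMap F _ a
    b := algebraMap F _ b
    x := algebraMap F _ x
    a_ne := (map_ne_zero _).mpr ha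
    b_ne := (map_ne_zero _).mpr hb
    x_ne := (map_ne_zero _).mpr hx
    s_ne := fun h => fixedField_middle_not_le hC (by
      rw [← hE, adjoin_simple_le_iff, h]
      exact zero_mem _)
    d_ne := fun h => not_mem_fixedField_middle hC hK (by
      rw [h]
      exact zero_mem _)
    Δ_eq := by rw [hΔ, map_add, map_pow, map_pow]
    s_sq := hsK
    d_sq := hdK
    σ_s := hσs
    σ_σ_d := hσσd
    σ_pow_four := fun y => by
      have h := DFunLike.congr_fun (hσ ▸ pow_orderOf_eq_one σ) y
      exact h
    mem_of_fixed := fun y hy => ⟨⟨y, (mem_fixedField_top_iff hC hσ).mpr hy⟩, rfl⟩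
    finrank_eq := by rw [finrank_fixedField_eq_card, Subgroup.card_top, hC.card_eq] },
    fun _ => rfl, rfl, rfl, rfl⟩

end CyclicGaloisFour

/-! ### The trace ideal as a system of congruences -/

section Kernel

variable {F : Type*} {K : Type v₁} [Field F] [Field K] [Algebra F K] [FiniteDimensional F K]
  [IsGalois F K] [NeZero (2 : F)]

theorem dressMap_intCast (H : Subgroup Gal(K/F)) (m : ℤ) :
    dressMap H (m : BurnsideRing H) = m • gw 1 := by
  rw [← zsmul_one, map_zsmul, dressMap_one]

theorem dressMap_intCast_mul (H : Subgroup Gal(K/F)) (m : ℤ) (z : BurnsideRing H) :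
    dressMap H (m * z) = m • dressMap H z := by
  rw [← zsmul_eq_mul, map_zsmul]

theorem zsmul_gw_one_eq_zero_iff {k : Type*} [Field k] [NeZero (2 : k)] {m : ℤ} :
    m • gw (1 : k) = 0 ↔ m = 0 := by
  refine ⟨fun h => ?_, fun h => by rw [h, zero_smul]⟩
  have hd := congrArg dimHom h
  rwa [map_zsmul, dimHom_gw one_ne_zero, map_zero, smul_eq_mul, mul_one] at hd

/-- The trace ideal in terms of marks. -/
theorem mem_traceIdeal_iff {C₂ : Subgroup Gal(K/F)} (hC : IsMiddleSubgroup C₂) {s : fixedField C₂} {δ : fixedField C₂} {d : K}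
    (hd : d ^ 2 = algebraMap (fixedField C₂) K δ) (hδ : ∀ u : fixedField C₂, u ^ 2 ≠ δ)
    (D : CyclicQuartic (fixedField (⊤ : Subgroup Gal(K/F))) K) (hDs : D.s = s) {π : ℕ}
    (hπ : ∀ p : ℤ, p • D.defect = 0 ↔ (π : ℤ) ∣ p) (hdvd : tau δ ∣ 2 * π)
    (H : Subgroup Gal(K/F)) (z : BurnsideRing H) :
    z ∈ traceIdeal F K H ↔ MarkCongruence C₂ (tau δ) π H z := by
  rw [traceIdeal, AddMonoidHom.mem_ker]
  rcases hC.eq_or H with rfl | rfl | rfl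
  · rw [IsMiddleSubgroup.markCongruence_bot_iff]
    obtain ⟨m, rfl⟩ := IsMiddleSubgroup.exists_eq_bot z
    constructor
    · intro h
      rw [dressMap_intCast, zsmul_gw_one_eq_zero_iff] at h
      rw [h, Int.cast_zero]
    · intro h
      rw [h, map_zero]
  · obtain ⟨m, q, rfl⟩ := hC.exists_eq_middle z
    have hδ0 : δ ≠ 0 := fun h => hδ 0 (by rw [h, zero_pow two_ne_zero])
    rw [hC.markCongruence_middle_iff, ← zsmul_gw_two_mul_sub hδ0, map_add, dressMap_intCast,
      dressMap_intCast_mul, dressMap_orbitClass_of_card bot_le (by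
        rw [hC.card_two, Subgroup.card_bot]) (fun g => ?_) hd hδ]
    obtain ⟨g, hg⟩ := g
    rw [Subgroup.mem_bot] at hg
    subst hg
    rfl
  · obtain ⟨m, q, p, rfl⟩ := hC.exists_eq_top z
    rw [hC.markCongruence_top_iff hdvd, ← hπ, ← D.zsmul_add_zsmul_add_zsmul_eq_zero_iff, map_add,
      map_add, dressMap_intCast, dressMap_intCast_mul, dressMap_intCast_mul,
      dressMap_orbitClass_bot, D.of_traceForm,
      dressMap_orbitClass_of_card le_top (by
        rw [hC.card_two, Subgroup.card_top, hC.card_eq]) (r := D.s) (hDs ▸ s.2) D.s_sq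
        fun u h => D.Δ_ne_sq u h.symm]

end Kernel

end GrothendieckWitt

/-! ### The main theorem -/

open Burnside GrothendieckWitt IntermediateField in
theorem mainTheorem4 {F : Type u} {K : Type v} [Field F] [Field K] [Algebra F K]
    [FiniteDimensional F K] [IsGalois F K] [NeZero (2 : F)]
    (hcyc : IsCyclic Gal(K/F)) (hcard : Nat.card Gal(K/F) = 4)
    (C₂ : Subgroup Gal(K/F)) (hC₂ : Nat.card C₂ = 2)
    (Δ a b x : F) (ha : a ≠ 0) (hb : b ≠ 0) (hx : x ≠ 0) (hΔ : Δ = a ^ 2 + b ^ 2)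
    (s : fixedField C₂) (hs : s ^ 2 = algebraMap F (fixedField C₂) Δ)
    (hE : F⟮(s : K)⟯ = fixedField C₂)
    (δ : fixedField C₂)
    (hδ : δ = algebraMap F (fixedField C₂) x *
      (algebraMap F (fixedField C₂) Δ - algebraMap F (fixedField C₂) a * s))
    (d : K) (hd : d ^ 2 = algebraMap (fixedField C₂) K δ)
    (hK : (fixedField C₂)⟮d⟯ = ⊤) :
    (EmbedsInCyclic F K 8 →
      ∀ H : Subgroup Gal(K/F), traceIdeal F K H =
        ((TambaraIdeal.span
          {(⟨⊤, orbitClass ⊤ ⊥ - orbitClass ⊤ C₂ - 2⟩ :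
            Σ H : Subgroup Gal(K/F), BurnsideRing H)}).level H).toAddSubgroup) ∧
    (¬ EmbedsInCyclic F K 8 →
      ∀ H : Subgroup Gal(K/F), traceIdeal F K H =
        ((TambaraIdeal.span
          {(⟨⊤, 2 * orbitClass ⊤ C₂ - 4⟩ : Σ H : Subgroup Gal(K/F), BurnsideRing H),
            ⟨⊤, (piLevel x : BurnsideRing (⊤ : Subgroup Gal(K/F))) * (orbitClass ⊤ ⊥ - 4)⟩,
            ⟨C₂, (tau δ : BurnsideRing C₂) * (orbitClass C₂ ⊥ - 2)⟩}).level H).toAddSubgroup) := by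
  obtain ⟨σ, hσ⟩ : ∃ σ : Gal(K/F), orderOf σ = 4 := by
    obtain ⟨σ, hσ⟩ := hcyc.exists_generator
    exact ⟨σ, hcard ▸ orderOf_eq_card_of_forall_mem_zpowers hσ⟩
  have hC := isMiddleSubgroup hcyc hcard hC₂
  obtain ⟨D, hDσ, hDs, hDΔ, hDx⟩ :=
    exists_cyclicQuartic hC hσ ha hb hx hΔ s hs hE hδ hd hK
  have hsk : ∀ u : F, algebraMap F (fixedField C₂) u ≠ s := fun u h => by
    refine fixedField_middle_not_le hC ?_
    rw [← hE, adjoin_simple_le_iff, ← h]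
    exact IntermediateField.algebraMap_mem _ u
  have hδsq : ∀ u : fixedField C₂, u ^ 2 ≠ δ := fun u h => by
    refine not_mem_fixedField_middle hC hK ?_
    have h1 : d ^ 2 = (u : K) ^ 2 := by
      rw [hd, ← h]
      rfl
    rcases sq_eq_sq_iff_eq_or_eq_neg.mp h1 with h2 | h2
    · exact h2 ▸ u.2
    · exact h2 ▸ neg_mem u.2
  have hspan : ∀ y : fixedField C₂, ∃ u v : F,
      y = algebraMap F _ u + algebraMap F _ v * s := fun y => by
    have h1 := (mem_fixedField_middle_iff hC hσ).mp y.2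
    rw [← hDσ, ← hDσ] at h1
    obtain ⟨p, q, hpq⟩ := D.exists_eq_add_of_fixed h1
    obtain ⟨u, rfl⟩ := exists_algebraMap_eq p
    obtain ⟨v, rfl⟩ := exists_algebraMap_eq q
    rw [hDs] at hpq
    exact ⟨u, v, Subtype.ext hpq⟩
  have hΔ0 : Δ ≠ 0 := fun h => D.Δ_ne (by rw [hDΔ, h, map_zero])
  obtain ⟨h₁, h₂⟩ := piLevel_dvd_tau_and_tau_dvd hΔ0 hΔ hs hspan hsk (hδ ▸ hδsq)
  rw [← hδ] at h₁ h₂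
  -- The levels agree because `algebraMap` is an isomorphism from `F` onto `fixedField ⊤`.
  have hpi : piLevel D.x = piLevel x := by
    rw [hDx]
    exact piLevel_congr (RingEquiv.ofBijective
      (algebraMap F (fixedField (⊤ : Subgroup Gal(K/F))))
      ⟨(algebraMap F _).injective, exists_algebraMap_eq⟩) x
  have hemb : EmbedsInCyclic F K 8 ↔ D.defect = 0 := by
    rw [embedsInCyclic_eight_iff hcard hσ]
    constructor
    · rintro ⟨β, hβ⟩
      refine D.defect_eq_zero_of_norm (β := β) ?_
      simpa only [hDσ] using hβ
    · intro h
      obtain ⟨β, hβ⟩ := D.exists_norm_of_defect_eq_zero h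
      exact ⟨β, by simpa only [hDσ] using hβ⟩
  constructor
  · intro h H
    have h0 := hemb.mp h
    -- In `E` the element `Δ` is the square of `s`, so `1 + Δl² = x(g² + h²)` makes `x`, and with it
    -- `δ`, a sum of two squares: `τ(δ) ∣ 2`. Conversely `2 ∣ π(x) ∣ τ(δ)`.
    have htau : tau δ = 2 := by
      obtain ⟨g, h, l, he⟩ := D.exists_one_add_eq_of_defect_eq_zero h0
      have hxs : IsSumOfSquares (2 ^ 1) (algebraMap F (fixedField C₂) x) := by
        obtain ⟨g, rfl⟩ := exists_algebraMap_eq g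
        obtain ⟨h, rfl⟩ := exists_algebraMap_eq h
        obtain ⟨l, rfl⟩ := exists_algebraMap_eq l
        refine isSumOfSquares_two_of_one_add_sq_eq (u := s * algebraMap F _ l)
          (g := algebraMap F _ g) (h := algebraMap F _ h) ?_
        have he' : 1 + Δ * l ^ 2 = x * (g ^ 2 + h ^ 2) := by
          apply (algebraMap F (fixedField (⊤ : Subgroup Gal(K/F)))).injective
          simpa only [map_add, map_mul, map_pow, map_one, hDΔ, hDx] using he
        rw [mul_pow, hs]
        simpa only [map_add, map_mul, map_pow, map_one] using
          congrArg (algebraMap F (fixedField C₂)) he'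
      have h3 := tau_dvd_of_isSumOfSquares (IsSumOfSquares.mul_sub
        (a := algebraMap F _ a) (b := algebraMap F _ b) one_ne_zero hxs
        (by rw [hΔ, map_add, map_pow, map_pow]) hs)
      rw [← hδ, pow_one] at h3
      exact Nat.dvd_antisymm h3 ((two_dvd_piLevel x).trans h₁)
    ext z
    -- The defect vanishes, so every integer annihilates it and the role of `π` is played by `1`.
    rw [mem_traceIdeal_iff hC hd hδsq D hDs (π := 1) (by simp [h0]) (by rw [htau]), htau]
    exact (hC.mem_span_singleton_iff H z).symm
  · intro h H
    ext z
    rw [mem_traceIdeal_iff hC hd hδsq D hDs (π := piLevel x)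
      (fun p => by rw [D.zsmul_defect_eq_zero_iff (fun h0 => h (hemb.mpr h0)), hpi]) h₂]
    exact (hC.mem_span_triple_iff (two_dvd_piLevel x) h₁ h₂ H z).symm
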